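/- **Setting.** Let $n\ge 1$, $\hbar>0$, $\varepsilon_1,\varepsilon_2>0$; $\log=\log_2$, so $\log e=1/\ln 2$. On $\mathcal H=L^2(\mathbb R^n)$ let $\mathsf Q$ and $\mathsf P$ be the projection valued measures on $\mathbb R^n$ of the position operators $Q=(Q_1,\dots,Q_n)$ (multiplication by the coordinates) and of the momentum operators $P=-i\hbar\nabla$. A state is a positive operator of trace one on $\mathcal H$; $\mathsf Q_\rho(\cdot)=\operatorname{Tr}\{\rho\,\mathsf Q(\cdot)\}$ and $\mathsf P_\rho(\cdot)=\operatorname{Tr}\{\rho\,\mathsf P(\cdot)\}$ are the distributions of position and momentum in the state $\rho$. Let $W(x,p)=\exp\{\tfrac i\hbar(p\cdot Q-x\cdot P)\}$, $x,p\in\mathbb R^n$, be the Weyl operators and $\Pi$ the parity operator. A state $\rho$ is *Gaussian* if there are vectors $a,b\in\mathbb R^n$ and real $n\times n$ matrices $A,B,C$ such that $$\begin{pmatrix}A&C+\tfrac{i\hbar}2\mathbb 1\\ C^T-\tfrac{i\hbar}2\mathbb 1&B\end{pmatrix}\ge 0$$ and, for all $k,l\in\mathbb R^n$, $$\operatorname{Tr}\{\rho\,W(-\hbar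 l,\hbar k)\}=\exp\{i(k\cdot a+l\cdot b)-\tfrac12(k\cdot Ak+l\cdot Bl)-k\cdot Cl\};$$ then $a,b,A,B,C$ are determined by $\rho$ (they are its means, variance matrices and quantum covariances) and are written $a^\rho,b^\rho,A^\rho,B^\rho,C^\rho$. Let $\mathcal G$ be the set of Gaussian states and $\mathcal G_\varepsilon=\{\rho\in\mathcal G: A^\rho\ge\varepsilon_1\mathbb 1,\ B^\rho\ge\varepsilon_2\mathbb 1\}$. A minimum uncertainty state is a $\rho\in\mathcal G$ with $\det A^\rho\,\det B^\rho=(\hbar/2)^{2n}$. For a state $\sigma$, the covariant phase-space observable $\mathsf M^\sigma$ has operator density $M^\sigma(x,p)=(2\pi\hbar)^{-n}W(x,p)\Pi\sigma\Pi W(x,p)^*$; in the state $\rho$ its distribution $\mathsf M^\sigma_\rho$ on $\mathbb R^n\times\mathbb R^n$ has density $\operatorname{Tr}\{\rho M^\sigma(x,p)\}$, with position marginal $\mathsf M^\sigma_{1,\rho}$ and momentum marginal $\mathsf M^\sigma_{2,\rho}$. With the relative entropy $S(\mu\|\nu)=\int\log\frac{d\mu}{d\nu}\,d\mu\in[0,+\infty]$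 put $$S(\rho,\mathsf M^\sigma)=S(\mathsf Q_\rho\|\mathsf M^\sigma_{1,\rho})+S(\mathsf P_\rho\|\mathsf M^\sigma_{2,\rho}),\quad D_\varepsilon(\sigma)=\sup_{\rho\in\mathcal G_\varepsilon}S(\rho,\mathsf M^\sigma),\quad c^G_{\rm inc}(\varepsilon)=\inf_{\sigma\in\mathcal G}D_\varepsilon(\sigma).$$ **Theorem.** (i) If $\varepsilon_1\varepsilon_2\ge\hbar^2/4$, then $$c^G_{\rm inc}(\varepsilon)=n(\log e)\Big\{\ln\Big(1+\frac{\hbar}{2\sqrt{\varepsilon_1\varepsilon_2}}\Big)-\frac{\hbar}{2\sqrt{\varepsilon_1\varepsilon_2}+\hbar}\Big\}.$$ There is a unique $\sigma_\varepsilon\in\mathcal G$ with $c^G_{\rm inc}(\varepsilon)=D_\varepsilon(\sigma_\varepsilon)$; it is a minimum uncertainty state with $a=b=0$, $A=\frac\hbar2\sqrt{\varepsilon_1/\varepsilon_2}\,\mathbb 1$, $B=\frac\hbar2\sqrt{\varepsilon_2/\varepsilon_1}\,\mathbb 1$, $C=0$. (ii) If $\varepsilon_1\varepsilon_2<\hbar^2/4$,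 then $c^G_{\rm inc}(\varepsilon)\ge n(\log e)(\ln2-\tfrac12)$. There is exactly one state $\sigma_\varepsilon\in\mathcal G$ with $a=b=0$, $A=\varepsilon_1\mathbb 1$, $B=\frac{\hbar^2}{4\varepsilon_1}\mathbb 1$, $C=0$, and every Gaussian state $\rho_\varepsilon$ with $A=\varepsilon_1\mathbb 1$ and $B=\frac{\hbar^2}{4\varepsilon_1}\mathbb 1$ lies in $\mathcal G_\varepsilon$ and satisfies $$n(\log e)(\ln2-\tfrac12)=S(\rho_\varepsilon,\mathsf M^{\sigma_\varepsilon})=\inf_{\sigma\in\mathcal G}S(\rho_\varepsilon,\mathsf M^\sigma).$$ (iii) (State-independent measurement uncertainty relation.) Let $\beta=\varepsilon_2$ if $\varepsilon_1\varepsilon_2\ge\hbar^2/4$ and $\beta=\frac{\hbar^2}{4\varepsilon_1}$ otherwise. Gaussian states $\rho_\varepsilon$ with $A=\varepsilon_1\mathbb 1$, $B=\beta\mathbb 1$ exist, and every such $\rho_\varepsilon$ lies in $\mathcal G_\varepsilon$ and satisfies, for all $\sigma\in\mathcal G$, $$S(\rho_\varepsilon,\mathsf M^\sigma)\ \ge\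 \begin{cases} n(\log e)\Big\{\ln\Big(1+\frac{\hbar}{2\sqrt{\varepsilon_1\varepsilon_2}}\Big)-\frac{\hbar}{2\sqrt{\varepsilon_1\varepsilon_2}+\hbar}\Big\},&\varepsilon_1\varepsilon_2\ge\hbar^2/4,\\[2mm] n(\log e)\{\ln 2-\tfrac12\},&\varepsilon_1\varepsilon_2<\hbar^2/4.\end{cases}$$ Thus the lower bound grows linearly in $n$. -/

import Mathlib

open MeasureTheory
open scoped ENNReal ComplexOrder

noncomputable section

namespace QGauss

/-! ### Trace, states, observables and their outcome distributions -/

section Hilbert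

variable (H : Type) [NormedAddCommGroup H] [InnerProductSpace ℂ H] [CompleteSpace H]

/-- A fixed orthonormal basis of the Hilbert space. -/
def onb : HilbertBasis (exists_hilbertBasis ℂ H).choose ℂ H :=
  (exists_hilbertBasis ℂ H).choose_spec.choose

variable {H}

/-- The trace. It is only applied to trace class operators (a density operator times a bounded
operator), for which it does not depend on the orthonormal basis. -/
def trace (T : H →L[ℂ] H) : ℂ := ∑' i, inner ℂ (onb H i) (T (onb H i))

variable (H)

/-- States: positive operators of trace one. -/
structure DensityOperator where
  op : H →L[ℂ] H
  pos : op.IsPositive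
  trace_one : HasSum (fun i => inner ℂ (onb H i) (op (onb H i))) 1

/-- Positive operator valued measures on `X` (weakly countably additive, normalized). -/
structure POVM (X : Type) [MeasurableSpace X] where
  E : Set X → (H →L[ℂ] H)
  pos : ∀ A, MeasurableSet A → (E A).IsPositive
  univ : E Set.univ = 1
  hasSum : ∀ (A : ℕ → Set X), (∀ k, MeasurableSet (A k)) → Pairwise (Function.onFun Disjoint A) →
    ∀ ψ : H, HasSum (fun k => inner ℂ ψ (E (A k) ψ)) (inner ℂ ψ (E (⋃ k, A k) ψ))

variable {H}

lemma DensityOperator.exists_sqrt (ρ : DensityOperator H) :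
    ∃ S : H →L[ℂ] H, IsSelfAdjoint S ∧ S * S = ρ.op := by
  have h0 : (0 : H →L[ℂ] H) ≤ ρ.op := (ContinuousLinearMap.nonneg_iff_isPositive _).2 ρ.pos
  exact ⟨CFC.sqrt ρ.op, (CFC.sqrt_nonneg ρ.op).isSelfAdjoint, CFC.sqrt_mul_sqrt_self ρ.op h0⟩

lemma DensityOperator.summable_sqrt (ρ : DensityOperator H) {S : H →L[ℂ] H}
    (hS : IsSelfAdjoint S) (hSS : S * S = ρ.op) : Summable (fun i => ‖S (onb H i)‖ ^ 2) := by
  have h := ρ.trace_one.summable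
  have h2 : (fun i => inner ℂ (onb H i) (ρ.op (onb H i))) =
      fun i => ((‖S (onb H i)‖ ^ 2 : ℝ) : ℂ) := by
    funext i
    rw [← hSS, mul_apply_eq_comp,
      ← ContinuousLinearMap.adjoint_inner_left, hS.adjoint_eq, inner_self_eq_norm_sq_to_K]
    simp
  rw [h2] at h
  exact_mod_cast h

lemma hasSum_sq_coeff (x : H) : HasSum (fun i => ‖inner ℂ (onb H i) x‖ ^ 2) (‖x‖ ^ 2) := by
  have h := (onb H).hasSum_inner_mul_inner x x
  rw [inner_self_eq_norm_sq_to_K] at h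
  have h2 : (fun i => inner ℂ x (onb H i) * inner ℂ (onb H i) x) =
      fun i => ((‖inner ℂ (onb H i) x‖ ^ 2 : ℝ) : ℂ) := by
    funext i
    rw [← inner_conj_symm x, ← Complex.normSq_eq_conj_mul_self, Complex.normSq_eq_norm_sq]
  rw [h2] at h
  have h3 : ((‖x‖ : ℂ)) ^ 2 = ((‖x‖ ^ 2 : ℝ) : ℂ) := by push_cast; rfl
  exact Complex.hasSum_ofReal.1 (h3 ▸ h)

lemma summable_double {F : H →L[ℂ] H} (hF : Summable (fun i => ‖F (onb H i)‖ ^ 2)) :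
    Summable (fun q : _ × _ => ‖inner ℂ (onb H q.2) (F (onb H q.1))‖ ^ 2) := by
  rw [summable_prod_of_nonneg (fun _ => by positivity)]
  refine ⟨fun i => (hasSum_sq_coeff (F (onb H i))).summable, ?_⟩
  simpa only [(hasSum_sq_coeff _).tsum_eq] using hF

/-- `Tr (ρ T) = Tr (ρ^{1/2} T ρ^{1/2})`. -/
lemma DensityOperator.trace_mul (ρ : DensityOperator H) {S : H →L[ℂ] H}
    (hS : IsSelfAdjoint S) (hSS : S * S = ρ.op) (T : H →L[ℂ] H) :
    trace (ρ.op * T) = ∑' j, inner ℂ (S (onb H j)) (T (S (onb H j))) := by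
  have hadj : ∀ x y : H, inner ℂ (S x) y = inner ℂ x (S y) := fun x y => by
    rw [← ContinuousLinearMap.adjoint_inner_left, hS.adjoint_eq]
  set T' := ContinuousLinearMap.adjoint T with hT'
  let f : (_ × _) → ℂ := fun q =>
    inner ℂ (T' (S (onb H q.2))) (onb H q.1) * inner ℂ (onb H q.1) (S (onb H q.2))
  have s1 := summable_double (ρ.summable_sqrt hS hSS)
  have s2 : Summable (fun i => ‖(T' * S) (onb H i)‖ ^ 2) := by
    refine Summable.of_nonneg_of_le (fun _ => by positivity) (fun i => ?_)
      ((ρ.summable_sqrt hS hSS).mul_left (‖T'‖ ^ 2))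
    rw [← mul_pow]
    exact pow_le_pow_left₀ (norm_nonneg _) (T'.le_opNorm _) 2
  have s3 := summable_double s2
  have hf' : Summable fun q : _ × _ => f q.swap := by
    refine Summable.of_norm_bounded (s3.add s1) (fun q => ?_)
    simp only [f, Prod.fst_swap, Prod.snd_swap, norm_mul]
    rw [norm_inner_symm]
    simp only [mul_apply_eq_comp]
    nlinarith [sq_nonneg (‖inner ℂ (onb H q.2) (T' (S (onb H q.1)))‖ -
      ‖inner ℂ (onb H q.2) (S (onb H q.1))‖),
      sq_nonneg ‖inner ℂ (onb H q.2) (T' (S (onb H q.1)))‖,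
      sq_nonneg ‖inner ℂ (onb H q.2) (S (onb H q.1))‖]
  have hf : Summable f := by
    simpa [Function.comp_def] using (Equiv.prodComm _ _).summable_iff.2 hf'
  have e1 : ∀ i, ∑' j, f (i, j) = inner ℂ (onb H i) ((ρ.op * T) (onb H i)) := by
    intro i
    rw [← hSS]
    simp only [mul_apply_eq_comp]
    rw [← hadj, ← ((onb H).hasSum_inner_mul_inner _ _).tsum_eq]
    refine tsum_congr fun j => ?_
    simp only [f]
    rw [hT', ContinuousLinearMap.adjoint_inner_left, ← hadj, ← hadj, mul_comm]
  have e2 : ∀ j, ∑' i, f (i, j) = inner ℂ (S (onb H j)) (T (S (onb H j))) := by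
    intro j
    simp only [f]
    rw [((onb H).hasSum_inner_mul_inner _ _).tsum_eq, hT',
      ContinuousLinearMap.adjoint_inner_left]
  unfold trace
  rw [← tsum_congr e1, ← tsum_congr e2]
  exact (Summable.tsum_comm (f := fun i j => f (i, j)) hf).symm

variable {X : Type} [MeasurableSpace X]

lemma POVM.ofReal_trace (M : POVM H X) (ρ : DensityOperator H) {S : H →L[ℂ] H}
    (hS : IsSelfAdjoint S) (hSS : S * S = ρ.op) {A : Set X} (hA : MeasurableSet A) :
    ENNReal.ofReal (trace (ρ.op * M.E A)).re =
      ∑' j, ENNReal.ofReal (inner ℂ (S (onb H j)) (M.E A (S (onb H j)))).re := by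
  have hs : Summable fun j => inner ℂ (S (onb H j)) (M.E A (S (onb H j))) := by
    refine Summable.of_norm_bounded ((ρ.summable_sqrt hS hSS).mul_left ‖M.E A‖) (fun j => ?_)
    calc _ ≤ ‖S (onb H j)‖ * ‖M.E A (S (onb H j))‖ := norm_inner_le_norm _ _
      _ ≤ ‖S (onb H j)‖ * (‖M.E A‖ * ‖S (onb H j)‖) := by gcongr; exact (M.E A).le_opNorm _
      _ = _ := by ring
  rw [ρ.trace_mul hS hSS, Complex.re_tsum hs, ENNReal.ofReal_tsum_of_nonneg]
  · exact fun j => (M.pos A hA).re_inner_nonneg_right _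
  · exact (Complex.hasSum_re hs.hasSum).summable

/-- The distribution of the observable `M` in the state `ρ`: `A ↦ Tr {ρ M(A)}`. -/
def POVM.dist (M : POVM H X) (ρ : DensityOperator H) : Measure X :=
  Measure.ofMeasurable (fun A _ => ENNReal.ofReal (trace (ρ.op * M.E A)).re)
    (by
      obtain ⟨S, hS, hSS⟩ := ρ.exists_sqrt
      rw [M.ofReal_trace ρ hS hSS MeasurableSet.empty]
      have h0 : ∀ ψ : H, inner ℂ ψ (M.E ∅ ψ) = 0 := by
        intro ψ
        have h := (M.hasSum (fun _ => ∅) (fun _ => MeasurableSet.empty)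
          (fun _ _ _ => by simp [Function.onFun]) ψ).summable
        exact (summable_const_iff _).1 h
      simp [h0])
    (by
      intro A hA hd
      obtain ⟨S, hS, hSS⟩ := ρ.exists_sqrt
      rw [M.ofReal_trace ρ hS hSS (MeasurableSet.iUnion hA)]
      simp_rw [fun k => M.ofReal_trace ρ hS hSS (hA k)]
      rw [ENNReal.tsum_comm]
      refine tsum_congr fun j => ?_
      have h := M.hasSum A hA hd (S (onb H j))
      rw [← h.tsum_eq, Complex.re_tsum h.summable, ENNReal.ofReal_tsum_of_nonneg]
      · exact fun k => (M.pos (A k) (hA k)).re_inner_nonneg_right _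
      · exact (Complex.hasSum_re h).summable)

end Hilbert

/-! ### The Schrödinger representation on `L²(ℝⁿ)` -/

/-- Configuration (or momentum) space `ℝⁿ`. -/
abbrev V (n : ℕ) : Type := EuclideanSpace ℝ (Fin n)

/-- The Hilbert space `L²(ℝⁿ)`. -/
abbrev L2 (n : ℕ) : Type := Lp ℂ 2 (volume : Measure (V n))

/-- Multiplication by a bounded function. -/
def mulOp {n : ℕ} (f : V n → ℂ) (hf : MemLp f ∞ volume) : L2 n →L[ℂ] L2 n :=
  (ContinuousLinearMap.mul ℂ ℂ).holderL volume ∞ 2 2 (hf.toLp f)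

lemma coeFn_mulOp {n : ℕ} (f : V n → ℂ) (hf : MemLp f ∞ volume) (ψ : L2 n) :
    mulOp f hf ψ =ᵐ[volume] fun x => f x * ψ x := by
  filter_upwards [(ContinuousLinearMap.mul ℂ ℂ).coeFn_holder (r := 2) (hf.toLp f) ψ,
    hf.coeFn_toLp] with x h1 h2
  rw [h2] at h1
  exact h1

open Classical in
/-- Multiplication by the indicator function of `A` (only used for measurable `A`). -/
def indicatorOp {n : ℕ} (A : Set (V n)) : L2 n →L[ℂ] L2 n :=
  if hA : MeasurableSet A then
    mulOp (A.indicator fun _ => 1) ((memLp_top_const (1 : ℂ)).indicator hA)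
  else 0

lemma inner_indicatorOp {n : ℕ} {A : Set (V n)} (hA : MeasurableSet A) (φ ψ : L2 n) :
    inner ℂ φ (indicatorOp A ψ) = ∫ x in A, inner ℂ (φ x) (ψ x) := by
  rw [L2.inner_def, ← integral_indicator hA, indicatorOp, dif_pos hA]
  refine integral_congr_ae ?_
  filter_upwards [coeFn_mulOp (A.indicator fun _ => 1)
    ((memLp_top_const (1 : ℂ)).indicator hA) ψ] with x hx
  rw [hx]
  by_cases h : x ∈ A <;> simp [h]

/-- The projection valued measure of the position operators `Q`. -/
def position (n : ℕ) : POVM (L2 n) (V n) where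
  E := indicatorOp
  pos := by
    intro A hA
    rw [ContinuousLinearMap.isPositive_iff_complex]
    intro ψ
    rw [← inner_conj_symm, inner_indicatorOp hA]
    have h : ∫ x in A, inner ℂ (ψ x) (ψ x) = ((∫ x in A, ‖ψ x‖ ^ 2 : ℝ) : ℂ) := by
      rw [← integral_complex_ofReal]
      refine integral_congr_ae (Filter.Eventually.of_forall fun x => ?_)
      simp only [inner_self_eq_norm_sq_to_K]
      simp
    rw [h]
    constructor
    · simp
    · simpa using integral_nonneg fun x => by positivity
  univ := by
    refine ContinuousLinearMap.ext fun ψ => ext_inner_left ℂ fun φ => ?_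
    rw [inner_indicatorOp MeasurableSet.univ, setIntegral_univ, ← L2.inner_def]
    rfl
  hasSum := by
    intro A hA hd ψ
    simp_rw [fun k => inner_indicatorOp (hA k) ψ ψ]
    rw [inner_indicatorOp (MeasurableSet.iUnion hA)]
    exact hasSum_integral_iUnion hA hd (L2.integrable_inner ψ ψ).integrableOn

/-- The unitary Fourier transform `(𝓕 ψ)(ξ) = ∫ e^{-2πi x·ξ} ψ(x) dx` on `L²(ℝⁿ)`. -/
def fourierOp (n : ℕ) : L2 n ≃ₗᵢ[ℂ] L2 n := Lp.fourierTransformₗᵢ (V n) ℂ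

/-- The projection valued measure of the momentum operators `P = -iħ∇`: in the Fourier
representation, `P` is multiplication by `2πħξ`. -/
def momentum (n : ℕ) (hbar : ℝ) : POVM (L2 n) (V n) where
  E B := ((fourierOp n).symm : L2 n →L[ℂ] L2 n) *
    indicatorOp ((fun ξ : V n => (2 * Real.pi * hbar) • ξ) ⁻¹' B) *
    ((fourierOp n : L2 n ≃L[ℂ] L2 n) : L2 n →L[ℂ] L2 n)
  pos := by
    intro B hB
    have hm : Measurable (fun ξ : V n => (2 * Real.pi * hbar) • ξ) := measurable_const_smul _
    have hp := (position n).pos _ (hm hB)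
    rw [ContinuousLinearMap.isPositive_iff_complex] at hp ⊢
    intro ψ
    have h : ∀ φ : L2 n, inner ℂ ((fourierOp n).symm φ) ψ = inner ℂ φ (fourierOp n ψ) := fun φ => by
      rw [← (fourierOp n).inner_map_map, LinearIsometryEquiv.apply_symm_apply]
    have := hp (fourierOp n ψ)
    rw [← h] at this
    exact this
  univ := by
    refine ContinuousLinearMap.ext fun ψ => ?_
    have h := (position n).univ
    change indicatorOp Set.univ = 1 at h
    simp [h]
  hasSum := by
    intro B hB hd ψ
    have hm : Measurable (fun ξ : V n => (2 * Real.pi * hbar) • ξ) := measurable_const_smul _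
    have h : ∀ φ : L2 n, inner ℂ ψ ((fourierOp n).symm φ) = inner ℂ (fourierOp n ψ) φ := fun φ => by
      rw [← (fourierOp n).inner_map_map, LinearIsometryEquiv.apply_symm_apply]
    have := (position n).hasSum (fun k => (fun ξ : V n => (2 * Real.pi * hbar) • ξ) ⁻¹' B k)
      (fun k => hm (hB k)) (fun i j hij => (hd hij).preimage _) (fourierOp n ψ)
    rw [← Set.preimage_iUnion] at this
    simp only [← h] at this
    exact this

/-- Translation `ψ ↦ ψ(· - x)`, i.e. `exp(-i x·P/ħ)`. -/
def translation {n : ℕ} (x : V n) : L2 n →L[ℂ] L2 n :=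
  (Lp.compMeasurePreservingₗᵢ ℂ (fun y : V n => y - x)
    (measurePreserving_sub_right volume x)).toContinuousLinearMap

lemma memLp_phase {n : ℕ} (hbar c : ℝ) (p : V n) :
    MemLp (fun y : V n => Complex.exp (Complex.I * (((inner ℝ p y - c) / hbar : ℝ) : ℂ)))
      ∞ volume := by
  refine memLp_top_of_bound (Continuous.aestronglyMeasurable (by fun_prop)) 1
    (Filter.Eventually.of_forall fun y => ?_)
  rw [mul_comm, Complex.norm_exp_ofReal_mul_I]

/-- The Weyl operators `W(x,p) = exp {(i/ħ)(p·Q - x·P)} = e^{-i x·p/(2ħ)} e^{i p·Q/ħ} e^{-i x·P/ħ}`: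
`(W(x,p) ψ)(y) = exp {(i/ħ) (p·y - p·x/2)} ψ(y - x)`. -/
def weyl {n : ℕ} (hbar : ℝ) (x p : V n) : L2 n →L[ℂ] L2 n :=
  mulOp _ (memLp_phase hbar (inner ℝ p x / 2) p) * translation x

/-- The parity operator `ψ ↦ ψ(-·)`. -/
def parity (n : ℕ) : L2 n →L[ℂ] L2 n :=
  (Lp.compMeasurePreservingₗᵢ ℂ (fun y : V n => -y)
    (Measure.measurePreserving_neg volume)).toContinuousLinearMap

/-- States on `L²(ℝⁿ)`. -/
abbrev State (n : ℕ) : Type := DensityOperator (L2 n)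

/-! ### Gaussian states -/

/-- The characteristic function `ρ̂(k,l) = Tr {ρ W(-ħ l, ħ k)} = Tr {ρ exp(i(k·Q + l·P))}`. -/
def charFn {n : ℕ} (hbar : ℝ) (ρ : State n) (k l : V n) : ℂ :=
  trace (ρ.op * weyl hbar (-(hbar • l)) (hbar • k))

/-- The matrix `V₊ = [[A, C + iħ/2], [Cᵀ - iħ/2, B]]`. -/
def Vplus {n : ℕ} (hbar : ℝ) (A B C : Matrix (Fin n) (Fin n) ℝ) :
    Matrix (Fin n ⊕ Fin n) (Fin n ⊕ Fin n) ℂ :=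
  Matrix.fromBlocks (A.map Complex.ofReal)
    (C.map Complex.ofReal + (Complex.I * hbar / 2) • (1 : Matrix (Fin n) (Fin n) ℂ))
    (C.transpose.map Complex.ofReal - (Complex.I * hbar / 2) • (1 : Matrix (Fin n) (Fin n) ℂ))
    (B.map Complex.ofReal)

/-- `ρ` is a Gaussian state with mean vector `(a, b)` and quantum variance matrix
`[[A, C], [Cᵀ, B]]`. -/
structure IsGaussianWith {n : ℕ} (hbar : ℝ) (ρ : State n) (a b : V n)
    (A B C : Matrix (Fin n) (Fin n) ℝ) : Prop where
  posSemidef : (Vplus hbar A B C).PosSemidef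
  charFn_eq : ∀ k l : V n, charFn hbar ρ k l =
    Complex.exp (Complex.I * ((inner ℝ k a + inner ℝ l b : ℝ) : ℂ)
      - ((1 / 2 * (k.ofLp ⬝ᵥ A.mulVec k.ofLp + l.ofLp ⬝ᵥ B.mulVec l.ofLp) : ℝ) : ℂ)
      - ((k.ofLp ⬝ᵥ C.mulVec l.ofLp : ℝ) : ℂ))

/-- The set of Gaussian states. -/
def gaussianStates (n : ℕ) (hbar : ℝ) : Set (State n) :=
  {ρ | ∃ (a b : V n) (A B C : Matrix (Fin n) (Fin n) ℝ), IsGaussianWith hbar ρ a b A B C}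

/-- A minimum uncertainty state: a Gaussian state with `(det A)(det B) = (ħ/2)^{2n}`. -/
def IsMinimumUncertainty {n : ℕ} (hbar : ℝ) (ρ : State n) : Prop :=
  ∃ (a b : V n) (A B C : Matrix (Fin n) (Fin n) ℝ), IsGaussianWith hbar ρ a b A B C ∧
    A.det * B.det = (hbar / 2) ^ (2 * n)

/-- The set of Gaussian states with `A ≥ ε₁ 1` and `B ≥ ε₂ 1`. -/
def gaussianStatesGE (n : ℕ) (hbar ε₁ ε₂ : ℝ) : Set (State n) :=
  {ρ | ∃ (a b : V n) (A B C : Matrix (Fin n) (Fin n) ℝ), IsGaussianWith hbar ρ a b A B C ∧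
    (A - ε₁ • (1 : Matrix (Fin n) (Fin n) ℝ)).PosSemidef ∧
    (B - ε₂ • (1 : Matrix (Fin n) (Fin n) ℝ)).PosSemidef}

/-! ### Covariant phase-space observables and entropic quantities -/

/-- The operator density `M^σ(x,p) = (2πħ)^{-n} W(x,p) Π σ Π W(x,p)*`. -/
def phaseSpaceDensity {n : ℕ} (hbar : ℝ) (σ : State n) (x p : V n) : L2 n →L[ℂ] L2 n :=
  (((1 / (2 * Real.pi * hbar) ^ n : ℝ)) : ℂ) •
    (weyl hbar x p * parity n * σ.op * parity n * ContinuousLinearMap.adjoint (weyl hbar x p))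

/-- The distribution on phase space of the covariant phase-space observable `M^σ` in the state `ρ`:
the measure with density `Tr {ρ M^σ(x,p)}`. -/
def phaseSpaceDist {n : ℕ} (hbar : ℝ) (σ ρ : State n) : Measure (V n × V n) :=
  (volume : Measure (V n × V n)).withDensity fun z =>
    ENNReal.ofReal (trace (ρ.op * phaseSpaceDensity hbar σ z.1 z.2)).re

/-- Relative entropy in bits, `S(μ‖ν) = ∫ log₂ (dμ/dν) dμ`, with values in `[0, ∞]`. -/
def relEntropy {X : Type} [MeasurableSpace X] (μ ν : Measure X) : ℝ≥0∞ :=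
  InformationTheory.klDiv μ ν / ENNReal.ofReal (Real.log 2)

/-- The error function `S(ρ, M^σ) = S(Q_ρ‖M^σ_{1,ρ}) + S(P_ρ‖M^σ_{2,ρ})`. -/
def errorFn {n : ℕ} (hbar : ℝ) (ρ σ : State n) : ℝ≥0∞ :=
  relEntropy ((position n).dist ρ) ((phaseSpaceDist hbar σ ρ).map Prod.fst) +
    relEntropy ((momentum n hbar).dist ρ) ((phaseSpaceDist hbar σ ρ).map Prod.snd)

/-- The Gaussian `(ε₁, ε₂)`-entropic divergence of `Q, P` from `M^σ`. -/
def divergence {n : ℕ} (hbar ε₁ ε₂ : ℝ) (σ : State n) : ℝ≥0∞ :=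
  ⨆ ρ ∈ gaussianStatesGE n hbar ε₁ ε₂, errorFn hbar ρ σ

/-- The Gaussian `(ε₁, ε₂)`-entropic incompatibility degree of `Q` and `P`. -/
def incompatibilityDegree (n : ℕ) (hbar ε₁ ε₂ : ℝ) : ℝ≥0∞ :=
  ⨅ σ ∈ gaussianStates n hbar, divergence hbar ε₁ ε₂ σ

end QGauss

end

/-!
# Entropic measurement uncertainty of position and momentum on Gaussian states

The position and momentum marginals of the covariant phase-space observable `M^σ` in the state `ρ`
are the convolutions of the position and momentum distributions of `ρ` with those of `σ`
(`phaseSpaceDist_map_fst_eq_conv`, `phaseSpaceDist_map_snd_eq_conv`). This is seen by writing both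
states as sums of rank one operators (`IsDecomposition`): the density `Tr {ρ M^σ(x,p)}` becomes a
sum of squared moduli of short-time Fourier transforms (`amp`), and each marginal follows from
Plancherel's theorem in the other variable.

For Gaussian states all these distributions are therefore Gaussian laws, whose relative entropies
are explicit (`HasGaussianCharFun.klDiv_eq`). If the variance matrices of `ρ` and `σ` are
simultaneously diagonal with eigenvalues `v i`, `v' i` (position) and `w i`, `w' i` (momentum), then,
up to terms in the means of `σ` that are nonnegative and vanish only for centred `σ`, the error
function `S(ρ, M^σ)` is the sum of the numbers `gaussGap (v' i / v i)` and `gaussGap (w' i / w i)`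
times `1 / (2 ln 2)`, where `gaussGap x = ln (1 + x) - x / (1 + x)` is increasing
(`IsGaussianWith.errorFn_eq`).

*Upper bound* (`IsGaussianWith.errorFn_le`). If `σ` is centred with variances `c ε₁ 1` and
`c ε₂ 1`, monotonicity of `gaussGap` bounds every summand by `gaussGap c`, uniformly in the states
with variances at least `ε₁ 1` and `ε₂ 1`. The choice `c = ħ / (2 √(ε₁ ε₂))` makes `σ` a minimum
uncertainty state.

*Lower bound* (`IsGaussianWith.le_errorFn`). Let `ρ` have variances `ε₁ 1` and `ε₂ 1`, and let `σ`
be any Gaussian state. As a function of `ln x`, `gaussGap x` is strictly convex, so for `x ≠ c`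
it lies strictly above its tangent at `c` (`gaussGap_tangent_lt`). Summing the tangent inequality
over all eigenvalues leaves the term `ln det A^σ + ln det B^σ`, which the uncertainty
relation bounds from below by `2 n ln (ħ / 2)` (`sum_log_eigenvalues_ge`). Equality forces the
variances of `σ` to be `c ε₁ 1` and `c ε₂ 1` and its means to be zero. As these variances
saturate the uncertainty relation, the covariances vanish too (`covariance_eq_zero_of_Vplus`), and
a state is determined by its characteristic function (`state_ext_of_charFn`), which gives
uniqueness of the optimal `σ`.

The Gaussian states that attain the bounds exist: random displacements of a pure Gaussian state have
any scalar variances that the uncertainty relation allows (`exists_isGaussianWith`).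

If `ε₁ ε₂ < ħ² / 4`, the bounds apply with `ħ² / (4 ε₁)` in place of `ε₂`, where `c = 1`.
-/

open MeasureTheory
open scoped ENNReal ComplexOrder

noncomputable section

namespace QGauss

/-! ### Relative entropy of Gaussian laws -/

section KL
open ProbabilityTheory InformationTheory
open scoped NNReal

lemma klDiv_map_measurableEquiv {X Y : Type*} [MeasurableSpace X] [MeasurableSpace Y]
    (μ ν : Measure X) [IsFiniteMeasure μ] [IsFiniteMeasure ν] (e : X ≃ᵐ Y) :
    klDiv (μ.map e) (ν.map e) = klDiv μ ν := by
  refine le_antisymm (klDiv_map_le μ ν e.measurable) ?_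
  have h := klDiv_map_le (μ.map e) (ν.map e) e.symm.measurable
  rwa [Measure.map_map e.symm.measurable e.measurable,
    Measure.map_map e.symm.measurable e.measurable, e.symm_comp_self, Measure.map_id,
    Measure.map_id] at h

lemma klDiv_prod {X Y : Type*} [MeasurableSpace X] [MeasurableSpace Y]
    (μ ν : Measure X) (κ η : Measure Y) [IsProbabilityMeasure μ] [IsProbabilityMeasure ν]
    [IsProbabilityMeasure κ] [IsProbabilityMeasure η] :
    klDiv (μ.prod κ) (ν.prod η) = klDiv μ ν + klDiv κ η := by
  have h := klDiv_compProd_eq_add μ ν (Kernel.const X κ) (Kernel.const X η)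
  simp only [Measure.compProd_const] at h
  rw [h, ← klDiv_map_measurableEquiv (μ.prod κ) (μ.prod η) MeasurableEquiv.prodComm]
  have h1 : ∀ τ : Measure Y, IsProbabilityMeasure τ →
      (μ.prod τ).map (MeasurableEquiv.prodComm : X × Y ≃ᵐ Y × X) = τ.prod μ := by
    intro τ _
    exact Measure.prod_swap
  rw [h1 κ inferInstance, h1 η inferInstance]
  have h2 := klDiv_compProd_left κ η (Kernel.const Y μ)
  simp only [Measure.compProd_const] at h2
  rw [h2]

lemma klDiv_pi {n : ℕ} (μ ν : Fin n → Measure ℝ) [∀ i, IsProbabilityMeasure (μ i)]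
    [∀ i, IsProbabilityMeasure (ν i)] :
    klDiv (Measure.pi μ) (Measure.pi ν) = ∑ i, klDiv (μ i) (ν i) := by
  induction n with
  | zero =>
    rw [Measure.pi_of_empty μ, Measure.pi_of_empty ν]
    simp
  | succ n ih =>
    rw [← klDiv_map_measurableEquiv _ _ (MeasurableEquiv.piFinSuccAbove (fun _ => ℝ) 0),
      (measurePreserving_piFinSuccAbove μ 0).map_eq,
      (measurePreserving_piFinSuccAbove ν 0).map_eq, klDiv_prod, ih, Fin.sum_univ_succ]
    simp

lemma integral_sub_sq_gaussianReal (m c : ℝ) (v : ℝ≥0) :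
    Integrable (fun x => (x - c) ^ 2) (gaussianReal m v) ∧
      ∫ x, (x - c) ^ 2 ∂gaussianReal m v = v + (m - c) ^ 2 := by
  have h2 : MemLp id 2 (gaussianReal m v) := memLp_id_gaussianReal 2
  have hi : Integrable (fun x => (x - c) ^ 2) (gaussianReal m v) :=
    (h2.sub (memLp_const c)).integrable_sq
  refine ⟨hi, ?_⟩
  have h3 := variance_eq_sub (h2.sub (memLp_const c))
  have h1 : Integrable (fun x : ℝ => x) (gaussianReal m v) := h2.integrable (by norm_num)
  have h4 : ∫ x, (x - c) ∂gaussianReal m v = m - c := by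
    rw [integral_sub h1 (integrable_const c), integral_id_gaussianReal]
    simp
  have h5 : Var[fun x => x - c; gaussianReal m v] = v := by
    rw [variance_sub_const (by fun_prop)]
    exact variance_fun_id_gaussianReal
  have h6 : Var[fun x => x - c; gaussianReal m v] =
    ∫ x, (x - c) ^ 2 ∂gaussianReal m v - (∫ x, (x - c) ∂gaussianReal m v) ^ 2 := h3
  rw [h5, h4] at h6
  linarith

/-- The relative entropy, in nats, of two nondegenerate Gaussian laws on the line. -/
lemma klDiv_gaussianReal (m m' : ℝ) {v w : ℝ≥0} (hv : v ≠ 0) (hw : w ≠ 0) :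
    klDiv (gaussianReal m v) (gaussianReal m' w) =
      ENNReal.ofReal (2⁻¹ * ((v : ℝ) / w - 1 - Real.log (v / w) + (m - m') ^ 2 / w)) := by
  have hv' : (0 : ℝ) < v := by positivity
  have hw' : (0 : ℝ) < w := by positivity
  set r : ℝ → ℝ := fun x => gaussianPDFReal m v x / gaussianPDFReal m' w x with hr
  have hrm : Measurable fun x => ENNReal.ofReal (r x) := by fun_prop
  have hd : gaussianReal m v = (gaussianReal m' w).withDensity fun x => ENNReal.ofReal (r x) := by
    rw [gaussianReal_of_var_ne_zero m hv, gaussianReal_of_var_ne_zero m' hw,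
      ← withDensity_mul _ (by fun_prop) hrm]
    congr 1
    funext x
    simp only [Pi.mul_apply, gaussianPDF, hr]
    rw [← ENNReal.ofReal_mul (gaussianPDFReal_nonneg _ _ _),
      mul_div_cancel₀ _ (gaussianPDFReal_pos _ _ _ hw).ne']
  have hac : gaussianReal m v ≪ gaussianReal m' w := by
    rw [hd]; exact withDensity_absolutelyContinuous _ _
  have hlog : ∀ x, Real.log (r x) = -(2⁻¹ * Real.log (v / w)) - (2 * (v : ℝ))⁻¹ * (x - m) ^ 2 +
      (2 * (w : ℝ))⁻¹ * (x - m') ^ 2 := by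
    intro x
    simp only [hr]
    rw [Real.log_div (gaussianPDFReal_pos _ _ _ hv).ne' (gaussianPDFReal_pos _ _ _ hw).ne']
    simp only [gaussianPDFReal]
    rw [Real.log_mul (by positivity) (by positivity), Real.log_mul (by positivity) (by positivity),
      Real.log_inv, Real.log_inv, Real.log_exp, Real.log_exp, Real.log_sqrt (by positivity),
      Real.log_sqrt (by positivity),
      Real.log_mul (x := 2 * Real.pi) (y := v) (by positivity) (by positivity),
      Real.log_mul (x := 2 * Real.pi) (y := w) (by positivity) (by positivity),
      Real.log_div hv'.ne' hw'.ne']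
    field_simp
    ring
  have hllr : llr (gaussianReal m v) (gaussianReal m' w) =ᵐ[gaussianReal m v]
      fun x => -(2⁻¹ * Real.log (v / w)) - (2 * (v : ℝ))⁻¹ * (x - m) ^ 2 +
      (2 * (w : ℝ))⁻¹ * (x - m') ^ 2 := by
    have h := Measure.rnDeriv_withDensity (gaussianReal m' w) hrm
    rw [← hd] at h
    filter_upwards [hac.ae_le h] with x hx
    rw [llr, hx, ENNReal.toReal_ofReal, hlog]
    exact div_nonneg (gaussianPDFReal_nonneg _ _ _) (gaussianPDFReal_nonneg _ _ _)
  obtain ⟨i1, e1⟩ := integral_sub_sq_gaussianReal m m v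
  obtain ⟨i2, e2⟩ := integral_sub_sq_gaussianReal m m' v
  have j1 := (integrable_const (μ := gaussianReal m v) (-(2⁻¹ * Real.log (v / w)))).sub
    (i1.const_mul (2 * (v : ℝ))⁻¹)
  have j2 := i2.const_mul (2 * (w : ℝ))⁻¹
  rw [klDiv_of_ac_of_integrable hac ((integrable_congr hllr).2 (j1.add j2)),
    integral_congr_ae hllr]
  congr 1
  have h1 := integral_add j1 j2
  have h2 := integral_sub (integrable_const (μ := gaussianReal m v) (-(2⁻¹ * Real.log (v / w))))
    (i1.const_mul (2 * (v : ℝ))⁻¹)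
  rw [integral_const_mul, e1] at h2
  simp only [Pi.sub_apply] at h1
  rw [h2, integral_const_mul, e2] at h1
  rw [h1]
  simp
  field_simp
  ring

lemma quadForm_eq_sum {n : ℕ} {A : Matrix (Fin n) (Fin n) ℝ}
    (e : OrthonormalBasis (Fin n) ℝ (V n)) {v : Fin n → ℝ}
    (hA : ∀ i, A.mulVec (e i).ofLp = v i • (e i).ofLp) (x : V n) :
    x.ofLp ⬝ᵥ A.mulVec x.ofLp = ∑ i, v i * inner ℝ (e i) x ^ 2 := by
  have hmv : WithLp.toLp 2 (A.mulVec x.ofLp) = ∑ i, (v i * inner ℝ (e i) x) • e i := by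
    conv_lhs => rw [← e.sum_repr x, WithLp.ofLp_sum, Matrix.mulVec_sum, WithLp.toLp_sum]
    refine Finset.sum_congr rfl fun i _ => ?_
    rw [WithLp.ofLp_smul, Matrix.mulVec_smul, hA, smul_smul, e.repr_apply_apply, mul_comm]
    simp
  have h2 : x.ofLp ⬝ᵥ A.mulVec x.ofLp = inner ℝ (WithLp.toLp 2 (A.mulVec x.ofLp)) x := by
    rw [EuclideanSpace.inner_eq_star_dotProduct]; simp
  rw [h2, hmv, sum_inner]
  refine Finset.sum_congr rfl fun i _ => ?_
  rw [real_inner_smul_left]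
  ring

/-- `μ` has the characteristic function of the Gaussian law with mean `a` and covariance matrix
`A`. -/
def HasGaussianCharFun {n : ℕ} (μ : Measure (V n)) (a : V n) (A : Matrix (Fin n) (Fin n) ℝ) :
    Prop :=
  ∀ t : V n, charFun μ t = Complex.exp (Complex.I * ((inner ℝ t a : ℝ) : ℂ) -
    ((1 / 2 * (t.ofLp ⬝ᵥ A.mulVec t.ofLp) : ℝ) : ℂ))

/-- In the coordinates of an orthonormal eigenbasis of its covariance matrix, a Gaussian law is a
product of one-dimensional ones. -/
lemma HasGaussianCharFun.map_repr_eq_pi {n : ℕ} {μ : Measure (V n)} [IsFiniteMeasure μ]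
    {a : V n} {A : Matrix (Fin n) (Fin n) ℝ} (hμ : HasGaussianCharFun μ a A)
    (e : OrthonormalBasis (Fin n) ℝ (V n)) {v : Fin n → ℝ≥0}
    (hA : ∀ i, A.mulVec (e i).ofLp = (v i : ℝ) • (e i).ofLp) :
    μ.map (e.measurableEquiv.trans (MeasurableEquiv.toLp 2 (Fin n → ℝ)).symm) =
      Measure.pi fun i => gaussianReal (inner ℝ (e i) a) (v i) := by
  rw [← charFun_eq_pi_iff]
  intro t
  rw [Measure.map_map (by fun_prop) (MeasurableEquiv.measurable _)]
  have h1 : charFun (Measure.map (WithLp.toLp 2 ∘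
      (e.measurableEquiv.trans (MeasurableEquiv.toLp 2 (Fin n → ℝ)).symm)) μ) t =
      charFun μ (e.repr.symm t) := by
    have h0 : (WithLp.toLp 2 ∘
      (e.measurableEquiv.trans (MeasurableEquiv.toLp 2 (Fin n → ℝ)).symm)) = e.repr := by
      funext x; rfl
    rw [h0, charFun_apply, charFun_apply, integral_map (by fun_prop) (by fun_prop)]
    refine integral_congr_ae (Filter.Eventually.of_forall fun x => ?_)
    simp only
    rw [← e.repr.inner_map_map x, LinearIsometryEquiv.apply_symm_apply]
  have hsum : e.repr.symm t = ∑ i, t.ofLp i • e i := (e.sum_repr_symm t).symm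
  have hq : (e.repr.symm t).ofLp ⬝ᵥ A.mulVec (e.repr.symm t).ofLp =
      ∑ i, (v i : ℝ) * t.ofLp i ^ 2 := by
    rw [quadForm_eq_sum e hA]
    refine Finset.sum_congr rfl fun i _ => ?_
    rw [← e.repr_apply_apply, LinearIsometryEquiv.apply_symm_apply]
  have hin : inner ℝ (e.repr.symm t) a = ∑ i, t.ofLp i * inner ℝ (e i) a := by
    rw [hsum, sum_inner]
    simp [inner_smul_left]
  rw [h1, hμ, hq, hin]
  simp only [charFun_gaussianReal]
  rw [← Complex.exp_sum]
  congr 1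
  rw [Finset.sum_sub_distrib]
  push_cast
  rw [Finset.mul_sum, Finset.mul_sum]
  congr 1
  · exact Finset.sum_congr rfl fun i _ => by ring
  · exact Finset.sum_congr rfl fun i _ => by ring

/-- The relative entropy of two Gaussian laws whose covariance matrices have a common orthonormal
eigenbasis. -/
lemma HasGaussianCharFun.klDiv_eq {n : ℕ} {μ ν : Measure (V n)} [IsFiniteMeasure μ]
    [IsFiniteMeasure ν] {a b : V n} {A B : Matrix (Fin n) (Fin n) ℝ}
    (hμ : HasGaussianCharFun μ a A) (hν : HasGaussianCharFun ν b B)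
    (e : OrthonormalBasis (Fin n) ℝ (V n)) {v w : Fin n → ℝ} (hv : ∀ i, 0 < v i)
    (hw : ∀ i, 0 < w i) (hA : ∀ i, A.mulVec (e i).ofLp = v i • (e i).ofLp)
    (hB : ∀ i, B.mulVec (e i).ofLp = w i • (e i).ofLp) :
    klDiv μ ν = ∑ i, ENNReal.ofReal (2⁻¹ * (v i / w i - 1 - Real.log (v i / w i) +
      inner ℝ (e i) (a - b) ^ 2 / w i)) := by
  lift v to Fin n → ℝ≥0 using fun i => (hv i).le
  lift w to Fin n → ℝ≥0 using fun i => (hw i).le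
  rw [← klDiv_map_measurableEquiv μ ν
    (e.measurableEquiv.trans (MeasurableEquiv.toLp 2 (Fin n → ℝ)).symm),
    hμ.map_repr_eq_pi e hA, hν.map_repr_eq_pi e hB, klDiv_pi]
  refine Finset.sum_congr rfl fun i _ => ?_
  rw [klDiv_gaussianReal _ _ (by have := hv i; simp only at this; exact_mod_cast this.ne')
    (by have := hw i; simp only at this; exact_mod_cast this.ne'), inner_sub_right]

end KL

/-! ### Uncertainty relations from the quantum variance matrix -/

section Uncertainty

variable {n : ℕ} {hbar : ℝ} {A B C : Matrix (Fin n) (Fin n) ℝ}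

lemma isHermitian_left_of_Vplus (hV : (Vplus hbar A B C).PosSemidef) : A.IsHermitian := by
  ext i j
  have h := hV.1.apply (Sum.inl i) (Sum.inl j)
  simp only [Vplus, Matrix.fromBlocks_apply₁₁, Matrix.map_apply] at h
  simpa using h

lemma isHermitian_right_of_Vplus (hV : (Vplus hbar A B C).PosSemidef) : B.IsHermitian := by
  ext i j
  have h := hV.1.apply (Sum.inr i) (Sum.inr j)
  simp only [Vplus, Matrix.fromBlocks_apply₂₂, Matrix.map_apply] at h
  simpa using h

/-- Positivity of the quantum variance matrix on the vector `(k + i k', l)`. -/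
lemma quadForm_nonneg_of_Vplus (hV : (Vplus hbar A B C).PosSemidef) (k k' l : Fin n → ℝ) :
    0 ≤ k ⬝ᵥ A.mulVec k + k' ⬝ᵥ A.mulVec k' + l ⬝ᵥ B.mulVec l + 2 * (k ⬝ᵥ C.mulVec l) +
      hbar * (k' ⬝ᵥ l) := by
  have hA := isHermitian_left_of_Vplus hV
  have h := hV.dotProduct_mulVec_nonneg
    (Sum.elim (fun i => (k i : ℂ) + Complex.I * k' i) (fun i => (l i : ℂ)))
  have h' := (Complex.le_def.1 h).1
  refine h'.trans_eq ?_
  have hsym : k ⬝ᵥ A.mulVec k' = k' ⬝ᵥ A.mulVec k := by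
    rw [Matrix.dotProduct_mulVec, ← Matrix.mulVec_transpose, dotProduct_comm]
    congr 2
  have hT : l ⬝ᵥ C.transpose.mulVec k = k ⬝ᵥ C.mulVec l := by
    rw [Matrix.dotProduct_mulVec, Matrix.vecMul_transpose, dotProduct_comm]
  have e1 : ∀ (M : Matrix (Fin n) (Fin n) ℝ) (u : Fin n → ℝ),
      (M.map Complex.ofReal).mulVec (fun i => (u i : ℂ)) = fun i => ((M.mulVec u i : ℝ) : ℂ) := by
    intro M u
    funext i
    simp [Matrix.mulVec, dotProduct]
  have e2 : ∀ u w : Fin n → ℝ, (fun i => (u i : ℂ)) ⬝ᵥ (fun i => (w i : ℂ)) =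
      ((u ⬝ᵥ w : ℝ) : ℂ) := by
    intro u w
    simp [dotProduct]
  have e3 : (fun i => (k i : ℂ) + Complex.I * k' i) =
      (fun i => (k i : ℂ)) + Complex.I • fun i => (k' i : ℂ) := by
    funext i; simp
  have e4 : star (Sum.elim (fun i => (k i : ℂ) + Complex.I * k' i) (fun i => (l i : ℂ))) =
      Sum.elim ((fun i => (k i : ℂ)) - Complex.I • fun i => (k' i : ℂ)) (fun i => (l i : ℂ)) := by
    funext i
    rcases i with i | i <;> simp [sub_eq_add_neg]
  rw [e4, e3, Vplus, Matrix.fromBlocks_mulVec, sumElim_dotProduct_sumElim]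
  simp only [Sum.elim_comp_inl, Sum.elim_comp_inr, Matrix.mulVec_add, Matrix.add_mulVec,
    Matrix.sub_mulVec, Matrix.mulVec_smul, Matrix.smul_mulVec, Matrix.one_mulVec, e1,
    dotProduct_add, dotProduct_sub, sub_dotProduct, dotProduct_smul, smul_dotProduct, e2,
    smul_eq_mul, hT, hsym]
  rw [dotProduct_comm l k, dotProduct_comm l k']
  simp
  ring

/-- The uncertainty relation between the variances of position in the direction `k` and of momentum
in the direction `l`. -/
lemma sq_dotProduct_le_of_Vplus (hV : (Vplus hbar A B C).PosSemidef) (k l : Fin n → ℝ) :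
    hbar ^ 2 / 4 * (k ⬝ᵥ l) ^ 2 ≤ (k ⬝ᵥ A.mulVec k) * (l ⬝ᵥ B.mulVec l) := by
  have h : ∀ t : ℝ, 0 ≤ k ⬝ᵥ A.mulVec k * (t * t) + hbar * (k ⬝ᵥ l) * t + l ⬝ᵥ B.mulVec l := by
    intro t
    have := quadForm_nonneg_of_Vplus hV 0 (t • k) l
    simp only [zero_dotProduct, Matrix.mulVec_smul, dotProduct_smul, smul_dotProduct,
      smul_eq_mul] at this
    linarith
  have := discrim_le_zero h
  rw [discrim] at this
  linarith

lemma quadForm_left_pos_of_Vplus (hbar_pos : 0 < hbar) (hV : (Vplus hbar A B C).PosSemidef)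
    {k : Fin n → ℝ} (hk : k ≠ 0) : 0 < k ⬝ᵥ A.mulVec k := by
  have h0 := quadForm_nonneg_of_Vplus hV k 0 0
  simp only [Matrix.mulVec_zero, dotProduct_zero, mul_zero, add_zero] at h0
  refine lt_of_le_of_ne h0 fun h => ?_
  have h1 := sq_dotProduct_le_of_Vplus hV k k
  rw [← h, zero_mul] at h1
  have h2 : 0 < k ⬝ᵥ k :=
    lt_of_le_of_ne (Finset.sum_nonneg fun i _ => mul_self_nonneg _)
      (Ne.symm (mt dotProduct_self_eq_zero.1 hk))
  have : 0 < hbar ^ 2 / 4 * (k ⬝ᵥ k) ^ 2 := by positivity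
  linarith

lemma quadForm_right_pos_of_Vplus (hbar_pos : 0 < hbar) (hV : (Vplus hbar A B C).PosSemidef)
    {l : Fin n → ℝ} (hl : l ≠ 0) : 0 < l ⬝ᵥ B.mulVec l := by
  have h0 := quadForm_nonneg_of_Vplus hV 0 0 l
  simp only [Matrix.mulVec_zero, dotProduct_zero, zero_dotProduct, mul_zero, add_zero,
    zero_add] at h0
  refine lt_of_le_of_ne h0 fun h => ?_
  have h1 := sq_dotProduct_le_of_Vplus hV l l
  rw [← h, mul_zero] at h1
  have h2 : 0 < l ⬝ᵥ l :=
    lt_of_le_of_ne (Finset.sum_nonneg fun i _ => mul_self_nonneg _)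
      (Ne.symm (mt dotProduct_self_eq_zero.1 hl))
  have : 0 < hbar ^ 2 / 4 * (l ⬝ᵥ l) ^ 2 := by positivity
  linarith

/-- If the variance matrices are scalar and saturate the uncertainty relation, then the quantum
covariances vanish. -/
lemma covariance_eq_zero_of_Vplus {α β : ℝ} (hα : 0 < α) (hαβ : α * β = hbar ^ 2 / 4)
    (hV : (Vplus hbar (α • (1 : Matrix (Fin n) (Fin n) ℝ)) (β • 1) C).PosSemidef) : C = 0 := by
  have key : ∀ l : Fin n → ℝ, C.mulVec l = 0 := by
    intro l
    -- the vector `(-(C l + (i ħ / 2) l) / α, l)` minimizes the quadratic form for fixed `l`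
    have h := quadForm_nonneg_of_Vplus hV (-(α⁻¹ • C.mulVec l)) (-((hbar / (2 * α)) • l)) l
    simp only [Matrix.smul_mulVec, Matrix.one_mulVec, dotProduct_smul, smul_dotProduct,
      smul_eq_mul, neg_dotProduct, dotProduct_neg] at h
    have hβ : β = hbar ^ 2 / (4 * α) := by field_simp; linarith
    rw [hβ] at h
    have h2 : 0 ≤ -(α⁻¹ * (C.mulVec l ⬝ᵥ C.mulVec l)) := by
      refine h.trans_eq ?_
      field_simp
      ring
    have h3 : 0 ≤ C.mulVec l ⬝ᵥ C.mulVec l := Finset.sum_nonneg fun i _ => mul_self_nonneg _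
    have h4 : C.mulVec l ⬝ᵥ C.mulVec l = 0 := by
      have : 0 < α⁻¹ := by positivity
      nlinarith
    exact dotProduct_self_eq_zero.1 h4
  ext i j
  have := congrFun (key (Pi.single j 1)) i
  simpa using this

/-- The logarithmic form of `det A det B ≥ (ħ/2)^{2n}`, in terms of eigenvalues. -/
lemma sum_log_eigenvalues_ge (hbar_pos : 0 < hbar) (hV : (Vplus hbar A B C).PosSemidef)
    (e f : OrthonormalBasis (Fin n) ℝ (V n)) {α β : Fin n → ℝ} (hα : ∀ i, 0 < α i)
    (hA : ∀ i, A.mulVec (e i).ofLp = α i • (e i).ofLp)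
    (hB : ∀ i, B.mulVec (f i).ofLp = β i • (f i).ofLp) :
    n * Real.log (hbar ^ 2 / 4) ≤ ∑ i, Real.log (α i) + ∑ j, Real.log (β j) := by
  have key : ∀ j, Real.log (hbar ^ 2 / 4) ≤
      Real.log (β j) + ∑ i, inner ℝ (e i) (f j) ^ 2 * Real.log (α i) := by
    intro j
    have hone : ∑ i, inner ℝ (e i) (f j) ^ 2 = 1 := by
      have := e.sum_sq_norm_inner_right (f j)
      simpa using this
    set m : ℝ := ∑ i, inner ℝ (e i) (f j) ^ 2 * (α i)⁻¹ with hm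
    -- the uncertainty relation is used in the directions `A⁻¹ fⱼ` and `fⱼ`
    set k : V n := ∑ i, ((α i)⁻¹ * inner ℝ (e i) (f j)) • e i with hk
    have hek : ∀ i, inner ℝ (e i) k = (α i)⁻¹ * inner ℝ (e i) (f j) := by
      intro i
      rw [hk, inner_sum]
      simp [real_inner_smul_right, e.inner_eq_ite]
    have h1 := sq_dotProduct_le_of_Vplus hV k.ofLp (f j).ofLp
    have h2 : k.ofLp ⬝ᵥ A.mulVec k.ofLp = m := by
      rw [quadForm_eq_sum e hA, hm]
      refine Finset.sum_congr rfl fun i _ => ?_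
      rw [hek]
      have := (hα i).ne'
      field_simp
    have h3 : k.ofLp ⬝ᵥ (f j).ofLp = m := by
      have : k.ofLp ⬝ᵥ (f j).ofLp = inner ℝ k (f j) := by
        rw [EuclideanSpace.inner_eq_star_dotProduct, dotProduct_comm]; simp
      rw [this, hk, sum_inner, hm]
      refine Finset.sum_congr rfl fun i _ => ?_
      rw [real_inner_smul_left]
      ring
    have h4 : (f j).ofLp ⬝ᵥ B.mulVec (f j).ofLp = β j := by
      rw [quadForm_eq_sum f hB]
      simp [f.inner_eq_ite]
    rw [h2, h3, h4] at h1
    -- Jensen's inequality for the logarithm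
    have hlogm : ∑ i, inner ℝ (e i) (f j) ^ 2 * Real.log ((α i)⁻¹) ≤ Real.log m := by
      have := strictConcaveOn_log_Ioi.concaveOn.le_map_sum (t := Finset.univ)
        (w := fun i => inner ℝ (e i) (f j) ^ 2) (p := fun i => (α i)⁻¹)
        (fun i _ => sq_nonneg _) hone (fun i _ => inv_pos.2 (hα i))
      simpa using this
    have hm0 : 0 < m := by
      have h0 : 0 ≤ m := Finset.sum_nonneg fun i _ =>
        mul_nonneg (sq_nonneg _) (inv_pos.2 (hα i)).le
      refine lt_of_le_of_ne h0 fun h => ?_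
      have h5 := (Finset.sum_eq_zero_iff_of_nonneg fun i _ =>
        mul_nonneg (sq_nonneg (inner ℝ (e i) (f j))) (inv_pos.2 (hα i)).le).1 (hm ▸ h.symm)
      rw [Finset.sum_eq_zero] at hone
      · exact zero_ne_one hone
      · intro i hi
        have := h5 i hi
        simpa [(hα i).ne'] using this
    have h6 : hbar ^ 2 / 4 * m ≤ β j := by
      have : m * (hbar ^ 2 / 4 * m) ≤ m * β j := by nlinarith
      exact le_of_mul_le_mul_left this hm0
    have h7 := Real.log_le_log (by positivity) h6
    rw [Real.log_mul (by positivity) hm0.ne'] at h7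
    simp only [Real.log_inv, mul_neg, Finset.sum_neg_distrib] at hlogm
    linarith
  have hsum := Finset.sum_le_sum fun j (_ : j ∈ Finset.univ) => key j
  rw [Finset.sum_add_distrib, Finset.sum_comm] at hsum
  have h8 : ∀ i, ∑ j, inner ℝ (e i) (f j) ^ 2 * Real.log (α i) = Real.log (α i) := by
    intro i
    rw [← Finset.sum_mul]
    have := f.sum_sq_norm_inner_left (e i)
    have h9 : ∑ j, inner ℝ (e i) (f j) ^ 2 = 1 := by simpa using this
    rw [h9, one_mul]
  simp only [h8] at hsum
  simp only [Finset.sum_const, Finset.card_univ, Fintype.card_fin, nsmul_eq_mul] at hsum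
  linarith

end Uncertainty

/-! ### The function `gaussGap` -/

section Scalar

/-- Twice the relative entropy, in nats, of a centred Gaussian law on the line with respect to the
centred Gaussian law whose variance is larger by the factor `1 + x`. -/
def gaussGap (x : ℝ) : ℝ := Real.log (1 + x) - x / (1 + x)

lemma hasDerivAt_gaussGap {x : ℝ} (hx : 0 < 1 + x) :
    HasDerivAt gaussGap (x / (1 + x) ^ 2) x := by
  have h1 : HasDerivAt (fun y : ℝ => 1 + y) 1 x := (hasDerivAt_id x).const_add 1
  have h2 := (h1.log hx.ne').sub ((hasDerivAt_id x).div h1 hx.ne')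
  convert! h2 using 1
  field_simp
  simp

lemma gaussGap_zero : gaussGap 0 = 0 := by simp [gaussGap]

lemma gaussGap_le_gaussGap {x y : ℝ} (hx : 0 ≤ x) (hxy : x ≤ y) : gaussGap x ≤ gaussGap y := by
  have hpos : ∀ z ∈ Set.Ici (0 : ℝ), 0 < 1 + z := fun z hz => by
    have : (0 : ℝ) ≤ z := hz
    linarith
  have h : MonotoneOn gaussGap (Set.Ici 0) := by
    refine monotoneOn_of_deriv_nonneg (convex_Ici 0)
      (fun z hz => (hasDerivAt_gaussGap (hpos z hz)).continuousAt.continuousWithinAt)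
      (fun z hz => (hasDerivAt_gaussGap (hpos z
        (interior_subset hz))).differentiableAt.differentiableWithinAt) (fun z hz => ?_)
    have hz' : (0 : ℝ) ≤ z := interior_subset hz
    rw [(hasDerivAt_gaussGap (hpos z hz')).deriv]
    positivity
  exact h hx (hx.trans hxy) hxy

lemma gaussGap_nonneg {x : ℝ} (hx : 0 ≤ x) : 0 ≤ gaussGap x :=
  gaussGap_zero ▸ gaussGap_le_gaussGap le_rfl hx

/-- `gaussGap` is strictly convex as a function of `log x`, so it lies strictly above its tangents
in that variable. -/
lemma gaussGap_tangent_lt {c u : ℝ} (hc : 0 < c) (hu : 0 < u) (huc : u ≠ c) :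
    gaussGap c + c ^ 2 / (1 + c) ^ 2 * (Real.log u - Real.log c) < gaussGap u := by
  set κ := c ^ 2 / (1 + c) ^ 2 with hκ
  set φ : ℝ → ℝ := fun x => gaussGap x - κ * Real.log x with hφ
  have hd : ∀ x, 0 < x → HasDerivAt φ (x / (1 + x) ^ 2 - κ * x⁻¹) x := fun x hx =>
    (hasDerivAt_gaussGap (by linarith)).sub ((Real.hasDerivAt_log hx.ne').const_mul κ)
  have hd' : ∀ x, 0 < x → x / (1 + x) ^ 2 - κ * x⁻¹ =
      (x - c) * (x * (1 + c) + c * (1 + x)) / (x * ((1 + x) ^ 2 * (1 + c) ^ 2)) := by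
    intro x hx
    rw [hκ]
    have : 1 + x ≠ 0 := by positivity
    have : 1 + c ≠ 0 := by positivity
    field_simp
    ring
  have hlt : φ c < φ u := by
    rcases lt_or_gt_of_ne huc with h | h
    · have hanti : StrictAntiOn φ (Set.Icc u c) := by
        refine strictAntiOn_of_deriv_neg (convex_Icc u c)
          (fun z hz => (hd z (hu.trans_le hz.1)).continuousAt.continuousWithinAt) (fun z hz => ?_)
        rw [interior_Icc] at hz
        have hz0 : 0 < z := hu.trans hz.1
        rw [(hd z hz0).deriv, hd' z hz0]
        refine div_neg_of_neg_of_pos (mul_neg_of_neg_of_pos (by linarith [hz.2]) ?_) ?_ <;>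
          positivity
      exact hanti ⟨le_rfl, h.le⟩ ⟨h.le, le_rfl⟩ h
    · have hmono : StrictMonoOn φ (Set.Icc c u) := by
        refine strictMonoOn_of_deriv_pos (convex_Icc c u)
          (fun z hz => (hd z (hc.trans_le hz.1)).continuousAt.continuousWithinAt) (fun z hz => ?_)
        rw [interior_Icc] at hz
        have hz0 : 0 < z := hc.trans hz.1
        rw [(hd z hz0).deriv, hd' z hz0]
        have : 0 < z - c := by linarith [hz.1]
        positivity
      exact hmono ⟨le_rfl, h.le⟩ ⟨h.le, le_rfl⟩ h
  simp only [hφ] at hlt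
  linarith

lemma gaussGap_tangent_le {c u : ℝ} (hc : 0 < c) (hu : 0 < u) :
    gaussGap c + c ^ 2 / (1 + c) ^ 2 * (Real.log u - Real.log c) ≤ gaussGap u := by
  rcases eq_or_ne u c with rfl | h
  · simp
  · exact (gaussGap_tangent_lt hc hu h).le

/-- The tangent inequality at `c = ħ / (2 √(ε₁ ε₂))` summed over all eigenvalues: the logarithmic
terms add up to something nonnegative by the uncertainty relation. -/
lemma sum_gaussGap_ge {n : ℕ} {hbar ε₁ ε₂ : ℝ} (hbar_pos : 0 < hbar) (h1 : 0 < ε₁) (h2 : 0 < ε₂)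
    {α β : Fin n → ℝ} (hα : ∀ i, 0 < α i) (hβ : ∀ i, 0 < β i)
    (hdet : n * Real.log (hbar ^ 2 / 4) ≤ ∑ i, Real.log (α i) + ∑ j, Real.log (β j)) :
    2 * n * gaussGap (hbar / (2 * √(ε₁ * ε₂))) ≤
        ∑ i, gaussGap (α i / ε₁) + ∑ i, gaussGap (β i / ε₂) ∧
      (∑ i, gaussGap (α i / ε₁) + ∑ i, gaussGap (β i / ε₂) ≤
          2 * n * gaussGap (hbar / (2 * √(ε₁ * ε₂))) →
        (∀ i, α i = hbar / (2 * √(ε₁ * ε₂)) * ε₁) ∧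
          ∀ i, β i = hbar / (2 * √(ε₁ * ε₂)) * ε₂) := by
  set c := hbar / (2 * √(ε₁ * ε₂)) with hc
  have hc0 : 0 < c := by positivity
  set κ := c ^ 2 / (1 + c) ^ 2 with hκ
  have hκ0 : 0 < κ := by positivity
  have hlogc : 2 * Real.log c = Real.log (hbar ^ 2 / 4) - Real.log ε₁ - Real.log ε₂ := by
    have : c ^ 2 = hbar ^ 2 / 4 / (ε₁ * ε₂) := by
      rw [hc, div_pow, mul_pow, Real.sq_sqrt (by positivity)]
      field_simp
      ring
    rw [← Nat.cast_ofNat (R := ℝ), ← Real.log_pow, this, Real.log_div (by positivity)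
      (by positivity), Real.log_mul h1.ne' h2.ne']
    ring
  have hτ : ∀ {ε : ℝ} {x : ℝ}, 0 < ε → 0 < x →
      gaussGap c + κ * (Real.log x - Real.log ε - Real.log c) ≤ gaussGap (x / ε) := by
    intro ε x hε hx
    have := gaussGap_tangent_le hc0 (div_pos hx hε)
    rwa [Real.log_div hx.ne' hε.ne'] at this
  have hτ' : ∀ {ε : ℝ} {x : ℝ}, 0 < ε → 0 < x → x ≠ c * ε →
      gaussGap c + κ * (Real.log x - Real.log ε - Real.log c) < gaussGap (x / ε) := by
    intro ε x hε hx hne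
    have := gaussGap_tangent_lt hc0 (div_pos hx hε)
      (fun h => hne (by rw [← h]; field_simp))
    rwa [Real.log_div hx.ne' hε.ne'] at this
  have hS : 2 * n * gaussGap c ≤
      ∑ i, (gaussGap c + κ * (Real.log (α i) - Real.log ε₁ - Real.log c)) +
      ∑ i, (gaussGap c + κ * (Real.log (β i) - Real.log ε₂ - Real.log c)) := by
    simp only [Finset.sum_add_distrib, ← Finset.mul_sum, Finset.sum_sub_distrib,
      Finset.sum_const, Finset.card_univ, Fintype.card_fin, nsmul_eq_mul]
    have : 0 ≤ κ * (∑ i, Real.log (α i) + ∑ j, Real.log (β j) -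
        n * (Real.log ε₁ + Real.log ε₂ + 2 * Real.log c)) := by
      refine mul_nonneg hκ0.le ?_
      rw [hlogc]
      linarith
    linarith
  have hA := Finset.sum_le_sum fun i (_ : i ∈ Finset.univ) => hτ h1 (hα i)
  have hB := Finset.sum_le_sum fun i (_ : i ∈ Finset.univ) => hτ h2 (hβ i)
  refine ⟨by linarith, fun hle => ⟨fun i => ?_, fun i => ?_⟩⟩
  · by_contra hne
    have := Finset.sum_lt_sum (fun i (_ : i ∈ Finset.univ) => hτ h1 (hα i))
      ⟨i, Finset.mem_univ i, hτ' h1 (hα i) hne⟩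
    linarith
  · by_contra hne
    have := Finset.sum_lt_sum (fun i (_ : i ∈ Finset.univ) => hτ h2 (hβ i))
      ⟨i, Finset.mem_univ i, hτ' h2 (hβ i) hne⟩
    linarith

end Scalar

/-! ### Phases, translations and the Fourier transform on `L²(ℝⁿ)` -/

section FourierL2

open scoped FourierTransform SchwartzMap

variable {n : ℕ}

lemma memLp_cexp_inner (k : V n) :
    MemLp (fun y : V n => Complex.exp (Complex.I * ((inner ℝ k y : ℝ) : ℂ))) ∞ volume := by
  simpa using memLp_phase 1 0 k

/-- Multiplication by `y ↦ e^{i k·y}`. -/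
def phaseOp (k : V n) : L2 n →L[ℂ] L2 n := mulOp _ (memLp_cexp_inner k)

lemma coeFn_phaseOp (k : V n) (ψ : L2 n) :
    phaseOp k ψ =ᵐ[volume] fun y => Complex.exp (Complex.I * ((inner ℝ k y : ℝ) : ℂ)) * ψ y :=
  coeFn_mulOp _ _ ψ

lemma coeFn_translation (x : V n) (ψ : L2 n) :
    translation x ψ =ᵐ[volume] fun y => ψ (y - x) :=
  Lp.coeFn_compMeasurePreserving ψ (measurePreserving_sub_right volume x)

lemma coeFn_parity (ψ : L2 n) : parity n ψ =ᵐ[volume] fun y => ψ (-y) :=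
  Lp.coeFn_compMeasurePreserving ψ (Measure.measurePreserving_neg volume)

lemma quasiMeasurePreserving_sub_right' (x : V n) :
    Measure.QuasiMeasurePreserving (fun y : V n => y - x) volume volume :=
  (measurePreserving_sub_right volume x).quasiMeasurePreserving

lemma quasiMeasurePreserving_neg' :
    Measure.QuasiMeasurePreserving (fun y : V n => -y) volume volume :=
  (Measure.measurePreserving_neg (volume : Measure (V n))).quasiMeasurePreserving

lemma weyl_apply (hbar : ℝ) (x p : V n) (ψ : L2 n) :
    weyl hbar x p ψ = Complex.exp (-(Complex.I * ((inner ℝ p x / 2 / hbar : ℝ) : ℂ))) •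
      phaseOp (hbar⁻¹ • p) (translation x ψ) := by
  refine Lp.ext ?_
  filter_upwards [coeFn_mulOp _ (memLp_phase hbar (inner ℝ p x / 2) p) (translation x ψ),
    Lp.coeFn_smul (Complex.exp (-(Complex.I * ((inner ℝ p x / 2 / hbar : ℝ) : ℂ))))
      (phaseOp (hbar⁻¹ • p) (translation x ψ)),
    coeFn_phaseOp (hbar⁻¹ • p) (translation x ψ)] with y h1 h2 h3
  rw [h2, Pi.smul_apply, h3, weyl, mul_apply_eq_comp, h1, smul_eq_mul, ← mul_assoc,
    ← Complex.exp_add]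
  congr 2
  rw [real_inner_smul_left]
  push_cast
  ring

lemma lintegral_enorm_sq (f : L2 n) : ∫⁻ x, ‖f x‖ₑ ^ 2 = ‖f‖ₑ ^ 2 := by
  have h := eLpNorm_nnreal_pow_eq_lintegral (f := f) (μ := volume) (p := 2) (by norm_num)
  have h' : eLpNorm f 2 volume ^ 2 = ∫⁻ x, ‖f x‖ₑ ^ 2 := by
    simpa using h
  rw [← h', Lp.enorm_def]

/-- On integrable functions, the `L²` Fourier transform is given by the Fourier integral. -/
lemma fourierOp_toLp {h : V n → ℂ} (h1 : Integrable h) (h2 : MemLp h 2 volume) :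
    fourierOp n (h2.toLp h) =ᵐ[volume] 𝓕 h := by
  have hcont : Continuous (𝓕 h) := VectorFourier.fourierIntegral_continuous
    Real.continuous_fourierChar (by exact continuous_inner) h1
  refine ae_eq_of_integral_contDiff_smul_eq
    ((Lp.memLp (fourierOp n (h2.toLp h))).locallyIntegrable (by norm_num))
    hcont.locallyIntegrable fun g hg hgc => ?_
  -- both sides are tested against the Schwartz function `g`
  let u : 𝓢(V n, ℂ) := HasCompactSupport.toSchwartzMap (f := fun x => (g x : ℂ))
    (hgc.comp_left (g := ((↑) : ℝ → ℂ)) Complex.ofReal_zero)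
    (Complex.ofRealCLM.contDiff.comp hg)
  have hu : ∀ x, u x = g x := fun x => rfl
  have e1 : ∫ x, u x • fourierOp n (h2.toLp h) x = ∫ x, (𝓕 u) x • (h2.toLp h) x := by
    have := congrArg (fun T => T u) (Lp.fourier_toTemperedDistribution_eq (h2.toLp h))
    simp only [TemperedDistribution.fourier_apply, Lp.toTemperedDistribution_apply] at this
    exact this.symm
  have e2 : ∫ x, (𝓕 u) x • (h2.toLp h) x = ∫ x, (𝓕 u) x • h x := by
    refine integral_congr_ae ?_
    filter_upwards [h2.coeFn_toLp] with x hx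
    rw [hx]
  have e3 : ∫ x, (𝓕 u) x • h x = ∫ x, u x • 𝓕 h x := by
    have := VectorFourier.integral_fourierIntegral_smul_eq_flip (L := innerₗ (V n))
      (μ := volume) (ν := volume) Real.continuous_fourierChar
      (by exact continuous_inner) u.integrable h1
    rw [flip_innerₗ] at this
    exact this
  have e4 := e1.trans (e2.trans e3)
  simp only [hu] at e4
  simpa using e4

/-- Plancherel's theorem for the Fourier integral of a function in `L¹ ∩ L²`. -/
lemma lintegral_enorm_fourier_sq {h : V n → ℂ} (h1 : Integrable h) (h2 : MemLp h 2 volume) :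
    ∫⁻ ξ, ‖𝓕 h ξ‖ₑ ^ 2 = ∫⁻ x, ‖h x‖ₑ ^ 2 := by
  have e1 : ∫⁻ ξ, ‖𝓕 h ξ‖ₑ ^ 2 = ∫⁻ ξ, ‖fourierOp n (h2.toLp h) ξ‖ₑ ^ 2 := by
    refine lintegral_congr_ae ?_
    filter_upwards [fourierOp_toLp h1 h2] with x hx
    rw [hx]
  have e2 : ∫⁻ x, ‖h x‖ₑ ^ 2 = ∫⁻ x, ‖h2.toLp h x‖ₑ ^ 2 := by
    refine lintegral_congr_ae ?_
    filter_upwards [h2.coeFn_toLp] with x hx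
    rw [hx]
  rw [e1, e2, lintegral_enorm_sq, lintegral_enorm_sq, ← ofReal_norm, ← ofReal_norm,
    (fourierOp n).norm_map]

/-- Bounded operators on `L²(ℝⁿ)` are determined by their values on integrable functions. -/
lemma continuousLinearMap_ext_of_integrable {S T : L2 n →L[ℂ] L2 n}
    (H : ∀ (h : V n → ℂ) (_ : Integrable h) (h2 : MemLp h 2 volume),
      S (h2.toLp h) = T (h2.toLp h)) : S = T := by
  refine ContinuousLinearMap.ext fun ψ => ?_
  refine DenseRange.induction_on (p := fun ψ => S ψ = T ψ)
    (SchwartzMap.denseRange_toLpCLM (F := ℂ) (p := 2) ENNReal.ofNat_ne_top) ψ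
    (isClosed_eq S.continuous T.continuous) fun f => ?_
  exact H f f.integrable (f.memLp 2)

lemma fourier_comp_sub_right (h : V n → ℂ) (x ξ : V n) :
    𝓕 (fun y => h (y - x)) ξ =
      Complex.exp (Complex.I * ((inner ℝ (-(2 * Real.pi) • x) ξ : ℝ) : ℂ)) * 𝓕 h ξ := by
  have := congrFun (VectorFourier.fourierIntegral_comp_add_right Real.fourierChar volume
    (innerₗ (V n)) h (-x)) ξ
  have h1 : (h ∘ fun v => v + -x) = fun y => h (y - x) := by
    funext y; simp [sub_eq_add_neg]
  rw [h1] at this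
  refine Eq.trans this ?_
  rw [Circle.smul_def, Real.fourierChar_apply, smul_eq_mul]
  congr 2
  simp [real_inner_smul_left, inner_neg_left]
  ring

lemma fourier_cexp_mul (h : V n → ℂ) (k ξ : V n) :
    𝓕 (fun y => Complex.exp (Complex.I * ((inner ℝ k y : ℝ) : ℂ)) * h y) ξ =
      𝓕 h (ξ - (2 * Real.pi)⁻¹ • k) := by
  rw [Real.fourier_eq, Real.fourier_eq]
  refine integral_congr_ae (Filter.Eventually.of_forall fun y => ?_)
  simp only [Circle.smul_def, Real.fourierChar_apply, smul_eq_mul]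
  rw [← mul_assoc, ← Complex.exp_add]
  congr 2
  rw [inner_sub_right, real_inner_smul_right, real_inner_comm y k]
  push_cast
  field_simp
  ring

lemma fourier_comp_neg (h : V n → ℂ) (ξ : V n) : 𝓕 (fun y => h (-y)) ξ = 𝓕 h (-ξ) :=
  Real.fourier_comp_linearIsometry (LinearIsometryEquiv.neg ℝ) h ξ

lemma fourierOp_translation (x : V n) (ψ : L2 n) :
    fourierOp n (translation x ψ) = phaseOp (-(2 * Real.pi) • x) (fourierOp n ψ) := by
  have H : ((fourierOp n : L2 n ≃L[ℂ] L2 n) : L2 n →L[ℂ] L2 n) * translation x =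
      phaseOp (-(2 * Real.pi) • x) * ((fourierOp n : L2 n ≃L[ℂ] L2 n) : L2 n →L[ℂ] L2 n) := by
    refine continuousLinearMap_ext_of_integrable fun h h1 h2 => ?_
    have i1 : Integrable fun y => h (y - x) := h1.comp_sub_right x
    have i2 : MemLp (fun y => h (y - x)) 2 volume :=
      h2.comp_measurePreserving (measurePreserving_sub_right volume x)
    have e : translation x (h2.toLp h) = i2.toLp _ := by
      refine Lp.ext ?_
      filter_upwards [coeFn_translation x (h2.toLp h), i2.coeFn_toLp,
        (quasiMeasurePreserving_sub_right' x).ae h2.coeFn_toLp] with y a b c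
      rw [a, b, c]
    change fourierOp n (translation x (h2.toLp h)) =
      phaseOp (-(2 * Real.pi) • x) (fourierOp n (h2.toLp h))
    rw [e]
    refine Lp.ext ?_
    filter_upwards [fourierOp_toLp i1 i2, fourierOp_toLp h1 h2,
      coeFn_phaseOp (-(2 * Real.pi) • x) (fourierOp n (h2.toLp h))] with ξ a b c
    rw [a, c, b, fourier_comp_sub_right]
  exact congrArg (fun T => T ψ) H

lemma fourierOp_phaseOp (k : V n) (ψ : L2 n) :
    fourierOp n (phaseOp k ψ) = translation ((2 * Real.pi)⁻¹ • k) (fourierOp n ψ) := by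
  have H : ((fourierOp n : L2 n ≃L[ℂ] L2 n) : L2 n →L[ℂ] L2 n) * phaseOp k =
      translation ((2 * Real.pi)⁻¹ • k) *
        ((fourierOp n : L2 n ≃L[ℂ] L2 n) : L2 n →L[ℂ] L2 n) := by
    refine continuousLinearMap_ext_of_integrable fun h h1 h2 => ?_
    have i1 : Integrable fun y => Complex.exp (Complex.I * ((inner ℝ k y : ℝ) : ℂ)) * h y := by
      refine h1.bdd_mul (c := 1) (Continuous.aestronglyMeasurable (by fun_prop))
        (Filter.Eventually.of_forall fun y => ?_)
      rw [mul_comm, Complex.norm_exp_ofReal_mul_I]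
    have i2 : MemLp (fun y => Complex.exp (Complex.I * ((inner ℝ k y : ℝ) : ℂ)) * h y) 2 volume :=
      h2.mul (memLp_cexp_inner k)
    have e : phaseOp k (h2.toLp h) = i2.toLp _ := by
      refine Lp.ext ?_
      filter_upwards [coeFn_phaseOp k (h2.toLp h), i2.coeFn_toLp, h2.coeFn_toLp] with y a b c
      rw [a, b, c]
    change fourierOp n (phaseOp k (h2.toLp h)) =
      translation ((2 * Real.pi)⁻¹ • k) (fourierOp n (h2.toLp h))
    rw [e]
    refine Lp.ext ?_
    filter_upwards [fourierOp_toLp i1 i2,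
      (quasiMeasurePreserving_sub_right' ((2 * Real.pi)⁻¹ • k)).ae (fourierOp_toLp h1 h2),
      coeFn_translation ((2 * Real.pi)⁻¹ • k) (fourierOp n (h2.toLp h))] with ξ a b c
    rw [a, c, b, fourier_cexp_mul]
  exact congrArg (fun T => T ψ) H

lemma fourierOp_parity (ψ : L2 n) : fourierOp n (parity n ψ) = parity n (fourierOp n ψ) := by
  have H : ((fourierOp n : L2 n ≃L[ℂ] L2 n) : L2 n →L[ℂ] L2 n) * parity n =
      parity n * ((fourierOp n : L2 n ≃L[ℂ] L2 n) : L2 n →L[ℂ] L2 n) := by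
    refine continuousLinearMap_ext_of_integrable fun h h1 h2 => ?_
    have i1 : Integrable fun y => h (-y) := h1.comp_neg
    have i2 : MemLp (fun y => h (-y)) 2 volume :=
      h2.comp_measurePreserving (Measure.measurePreserving_neg volume)
    have e : parity n (h2.toLp h) = i2.toLp _ := by
      refine Lp.ext ?_
      filter_upwards [coeFn_parity (h2.toLp h), i2.coeFn_toLp,
        quasiMeasurePreserving_neg'.ae h2.coeFn_toLp] with y a b c
      rw [a, b, c]
    change fourierOp n (parity n (h2.toLp h)) = parity n (fourierOp n (h2.toLp h))
    rw [e]
    refine Lp.ext ?_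
    filter_upwards [fourierOp_toLp i1 i2, quasiMeasurePreserving_neg'.ae (fourierOp_toLp h1 h2),
      coeFn_parity (fourierOp n (h2.toLp h))] with ξ a b c
    rw [a, c, b, fourier_comp_neg]
  exact congrArg (fun T => T ψ) H

lemma translation_phaseOp (x k : V n) (ψ : L2 n) :
    translation x (phaseOp k ψ) = Complex.exp (-(Complex.I * ((inner ℝ k x : ℝ) : ℂ))) •
      phaseOp k (translation x ψ) := by
  refine Lp.ext ?_
  filter_upwards [coeFn_translation x (phaseOp k ψ), coeFn_phaseOp k (translation x ψ),
    coeFn_translation x ψ, (quasiMeasurePreserving_sub_right' x).ae (coeFn_phaseOp k ψ),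
    Lp.coeFn_smul (Complex.exp (-(Complex.I * ((inner ℝ k x : ℝ) : ℂ))))
      (phaseOp k (translation x ψ))] with y a b c d e
  rw [a, e, Pi.smul_apply, b, c, d, smul_eq_mul, ← mul_assoc, ← Complex.exp_add]
  congr 2
  rw [inner_sub_right]
  push_cast
  ring

end FourierL2

/-! ### States as sums of rank one operators -/

section Decomposition

lemma ofReal_re_eq_tsum {ι : Type*} {f : ι → ℂ} {z : ℂ} (h : HasSum f z)
    (h0 : ∀ i, 0 ≤ (f i).re) : ENNReal.ofReal z.re = ∑' i, ENNReal.ofReal (f i).re := by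
  rw [← (Complex.hasSum_re h).tsum_eq, ENNReal.ofReal_tsum_of_nonneg h0]
  exact (Complex.hasSum_re h).summable

lemma countable_of_hilbertBasis {H : Type*} [NormedAddCommGroup H] [InnerProductSpace ℂ H]
    [TopologicalSpace.SeparableSpace H] {ι : Type*}
    (b : HilbertBasis ι ℂ H) : Countable ι := by
  have hd : Pairwise (Function.onFun Disjoint fun i => Metric.ball (b i) (1 / 2)) := by
    intro i j hij
    refine Metric.ball_disjoint_ball ?_
    have h1 : ‖b i - b j‖ ^ 2 = 2 := by
      have := @norm_sub_sq ℂ _ _ _ _ (b i) (b j)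
      rw [b.orthonormal.1 i, b.orthonormal.1 j, b.orthonormal.2 hij] at this
      simp at this
      linarith
    rw [dist_eq_norm]
    nlinarith [norm_nonneg (b i - b j)]
  exact hd.countable_of_isOpen_disjoint (fun i => Metric.isOpen_ball) fun i => ⟨b i, by simp⟩

variable {H : Type} [NormedAddCommGroup H] [InnerProductSpace ℂ H] [CompleteSpace H]

/-- `ρ = ∑ᵢ |ψᵢ⟩⟨ψᵢ|`, a decomposition of a state into countably many (unnormalized) vector
states. The series converges weakly, and `hasSum_trace` expresses the expectation of a bounded
operator through the vectors `ψᵢ` instead of the basis that defines `trace`. -/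
structure IsDecomposition (ρ : DensityOperator H) {ι : Type} (ψ : ι → H) : Prop where
  countable : Countable ι
  hasSum_norm : HasSum (fun i => ‖ψ i‖ ^ 2) 1
  hasSum_inner : ∀ f g : H, HasSum (fun i => inner ℂ f (ψ i) * inner ℂ (ψ i) g)
    (inner ℂ f (ρ.op g))
  hasSum_trace : ∀ T : H →L[ℂ] H, HasSum (fun i => inner ℂ (ψ i) (T (ψ i))) (trace (ρ.op * T))

/-- The vectors `ψᵢ = √ρ eᵢ`, for an orthonormal basis `eᵢ`, decompose `ρ`. -/
lemma exists_isDecomposition [TopologicalSpace.SeparableSpace H] (ρ : DensityOperator H) :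
    ∃ (ι : Type) (ψ : ι → H), IsDecomposition ρ ψ := by
  obtain ⟨S, hS, hSS⟩ := ρ.exists_sqrt
  have hadj : ∀ x y : H, inner ℂ (S x) y = inner ℂ x (S y) := fun x y => by
    rw [← ContinuousLinearMap.adjoint_inner_left, hS.adjoint_eq]
  refine ⟨_, fun i => S (onb H i), countable_of_hilbertBasis (onb H), ?_, fun f g => ?_,
    fun T => ?_⟩
  · have h := ρ.trace_one
    have h2 : (fun i => inner ℂ (onb H i) (ρ.op (onb H i))) =
        fun i => ((‖S (onb H i)‖ ^ 2 : ℝ) : ℂ) := by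
      funext i
      rw [← hSS, mul_apply_eq_comp, ← hadj, inner_self_eq_norm_sq_to_K]
      simp
    rw [h2, ← Complex.ofReal_one] at h
    exact Complex.hasSum_ofReal.1 h
  · have h := (onb H).hasSum_inner_mul_inner (S f) (S g)
    rw [hadj f, ← mul_apply_eq_comp, hSS] at h
    simpa only [hadj] using h
  · rw [ρ.trace_mul hS hSS]
    refine Summable.hasSum (Summable.of_norm_bounded
      ((ρ.summable_sqrt hS hSS).mul_left ‖T‖) (fun j => ?_))
    calc _ ≤ ‖S (onb H j)‖ * ‖T (S (onb H j))‖ := norm_inner_le_norm _ _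
      _ ≤ ‖S (onb H j)‖ * (‖T‖ * ‖S (onb H j)‖) := by gcongr; exact T.le_opNorm _
      _ = _ := by ring

end Decomposition

/-! ### Distributions of position and momentum -/

section Distributions

variable {n : ℕ} {ι κ : Type}

lemma separableSpace_L2 (n : ℕ) : TopologicalSpace.SeparableSpace (L2 n) := by
  have : Fact ((2 : ℝ≥0∞) ≠ ∞) := ⟨by simp⟩
  infer_instance

lemma measurable_enorm_sq (f : L2 n) : Measurable fun x => ‖f x‖ₑ ^ 2 :=
  (Lp.stronglyMeasurable f).measurable.enorm.pow_const 2

/-- The measure with density `∑ᵢ |ψᵢ(x)|²`. -/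
def densMeasure (ψ : ι → L2 n) : Measure (V n) :=
  volume.withDensity fun x => ∑' i, ‖ψ i x‖ₑ ^ 2

lemma densMeasure_apply [Countable ι] (ψ : ι → L2 n) {s : Set (V n)} (hs : MeasurableSet s) :
    densMeasure ψ s = ∑' i, ∫⁻ x in s, ‖ψ i x‖ₑ ^ 2 := by
  rw [densMeasure, withDensity_apply _ hs,
    lintegral_tsum fun i => (measurable_enorm_sq (ψ i)).aemeasurable]

lemma isProbabilityMeasure_densMeasure [Countable ι] {ψ : ι → L2 n}
    (h : HasSum (fun i => ‖ψ i‖ ^ 2) 1) : IsProbabilityMeasure (densMeasure ψ) := by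
  refine ⟨?_⟩
  rw [densMeasure_apply ψ MeasurableSet.univ]
  simp_rw [setLIntegral_univ, lintegral_enorm_sq]
  have : ∀ i, ‖ψ i‖ₑ ^ 2 = ENNReal.ofReal (‖ψ i‖ ^ 2) := fun i => by
    rw [← ofReal_norm, ENNReal.ofReal_pow (norm_nonneg _)]
  simp_rw [this]
  rw [← ENNReal.ofReal_tsum_of_nonneg (fun i => by positivity) h.summable, h.tsum_eq]
  simp

lemma ofReal_re_inner_indicatorOp {s : Set (V n)} (hs : MeasurableSet s) (ψ : L2 n) :
    ENNReal.ofReal (inner ℂ ψ (indicatorOp s ψ)).re = ∫⁻ x in s, ‖ψ x‖ₑ ^ 2 := by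
  have h : ∫ x in s, inner ℂ (ψ x) (ψ x) = ((∫ x in s, ‖ψ x‖ ^ 2 : ℝ) : ℂ) := by
    rw [← integral_complex_ofReal]
    refine integral_congr_ae (Filter.Eventually.of_forall fun x => ?_)
    simp only [inner_self_eq_norm_sq_to_K]
    simp
  have hi : Integrable (fun x => ‖ψ x‖ ^ 2) volume := (Lp.memLp ψ).integrable_norm_pow (by simp)
  rw [inner_indicatorOp hs, h, Complex.ofReal_re,
    ofReal_integral_eq_lintegral_ofReal hi.integrableOn
      (Filter.Eventually.of_forall fun x => by positivity)]
  refine lintegral_congr fun x => ?_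
  rw [ENNReal.ofReal_pow (norm_nonneg _), ofReal_norm]

lemma position_dist_eq {ρ : State n} {ψ : ι → L2 n} (h : IsDecomposition ρ ψ) :
    (position n).dist ρ = densMeasure ψ := by
  have := h.countable
  refine Measure.ext fun s hs => ?_
  rw [densMeasure_apply ψ hs, POVM.dist, Measure.ofMeasurable_apply s hs,
    ofReal_re_eq_tsum (h.hasSum_trace _)
      (fun i => ((position n).pos s hs).re_inner_nonneg_right _)]
  exact tsum_congr fun i => ofReal_re_inner_indicatorOp hs (ψ i)

lemma inner_fourierOp_symm (φ ψ : L2 n) :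
    inner ℂ ψ ((fourierOp n).symm φ) = inner ℂ (fourierOp n ψ) φ := by
  rw [← (fourierOp n).inner_map_map, LinearIsometryEquiv.apply_symm_apply]

lemma momentum_dist_eq (hbar : ℝ) {ρ : State n} {ψ : ι → L2 n} (h : IsDecomposition ρ ψ) :
    (momentum n hbar).dist ρ =
      (densMeasure fun i => fourierOp n (ψ i)).map ((2 * Real.pi * hbar) • ·) := by
  have := h.countable
  refine Measure.ext fun s hs => ?_
  have hm : Measurable fun ξ : V n => (2 * Real.pi * hbar) • ξ := measurable_const_smul _
  rw [Measure.map_apply hm hs, densMeasure_apply _ (hm hs), POVM.dist,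
    Measure.ofMeasurable_apply s hs, ofReal_re_eq_tsum (h.hasSum_trace _)
      (fun i => ((momentum n hbar).pos s hs).re_inner_nonneg_right _)]
  refine tsum_congr fun i => ?_
  rw [← ofReal_re_inner_indicatorOp (hm hs), ← inner_fourierOp_symm]
  rfl

lemma inner_phaseOp_self (k : V n) (ψ : L2 n) : inner ℂ ψ (phaseOp k ψ) =
    ∫ x, Complex.exp ((inner ℝ x k : ℝ) * Complex.I) ∂(volume.withDensity fun x => ‖ψ x‖ₑ ^ 2) := by
  have h0 : (fun x => ‖ψ x‖ₑ ^ 2) = fun x => ((‖ψ x‖₊ ^ 2 : NNReal) : ℝ≥0∞) := by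
    funext x; simp [enorm_eq_nnnorm]
  rw [h0, integral_withDensity_eq_integral_smul
    ((Lp.stronglyMeasurable ψ).measurable.nnnorm.pow_const 2), L2.inner_def]
  refine integral_congr_ae ?_
  filter_upwards [coeFn_phaseOp k ψ] with x hx
  rw [hx, RCLike.inner_apply, NNReal.smul_def, Complex.real_smul, mul_assoc, Complex.mul_conj,
    Complex.normSq_eq_norm_sq, real_inner_comm]
  push_cast
  rw [mul_comm, mul_comm Complex.I]

lemma hasSum_charFun_densMeasure [Countable ι] {ψ : ι → L2 n}
    (h : HasSum (fun i => ‖ψ i‖ ^ 2) 1) (k : V n) :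
    HasSum (fun i => inner ℂ (ψ i) (phaseOp k (ψ i))) (charFun (densMeasure ψ) k) := by
  have := isProbabilityMeasure_densMeasure h
  have hsum : densMeasure ψ =
      Measure.sum fun i => volume.withDensity fun x => ‖ψ i x‖ₑ ^ 2 := by
    rw [← withDensity_tsum fun i => measurable_enorm_sq (ψ i), densMeasure]
    congr 1
    funext x
    rw [ENNReal.tsum_apply]
  simp_rw [inner_phaseOp_self]
  rw [charFun_apply]
  have hi : Integrable (fun x : V n => Complex.exp ((inner ℝ x k : ℝ) * Complex.I))
      (densMeasure ψ) := by
    refine (integrable_const (1 : ℝ)).mono' (Continuous.aestronglyMeasurable (by fun_prop))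
      (Filter.Eventually.of_forall fun x => ?_)
    rw [Complex.norm_exp_ofReal_mul_I]
  rw [hsum] at hi ⊢
  exact hasSum_integral_measure hi

lemma translation_zero (ψ : L2 n) : translation 0 ψ = ψ := by
  refine Lp.ext ?_
  filter_upwards [coeFn_translation 0 ψ] with x hx
  rw [hx, sub_zero]

lemma phaseOp_zero (ψ : L2 n) : phaseOp 0 ψ = ψ := by
  refine Lp.ext ?_
  filter_upwards [coeFn_phaseOp 0 ψ] with x hx
  rw [hx]
  simp

lemma hasSum_norm_fourierOp {ψ : ι → L2 n} (h : HasSum (fun i => ‖ψ i‖ ^ 2) 1) :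
    HasSum (fun i => ‖fourierOp n (ψ i)‖ ^ 2) 1 := by
  simpa only [LinearIsometryEquiv.norm_map] using h

lemma charFun_densMeasure {hbar : ℝ} (hbar0 : hbar ≠ 0) {ρ : State n} {ψ : ι → L2 n}
    (h : IsDecomposition ρ ψ) (k : V n) : charFun (densMeasure ψ) k = charFn hbar ρ k 0 := by
  have := h.countable
  refine (hasSum_charFun_densMeasure h.hasSum_norm k).unique ?_
  have hs := h.hasSum_trace (weyl hbar (-(hbar • 0)) (hbar • k))
  convert! hs using 2 with i
  rw [weyl_apply]
  simp [translation_zero, smul_smul, hbar0]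

lemma charFun_densMeasure_fourierOp {hbar : ℝ} {ρ : State n} {ψ : ι → L2 n}
    (h : IsDecomposition ρ ψ) (l : V n) :
    charFun (densMeasure fun i => fourierOp n (ψ i)) ((2 * Real.pi * hbar) • l) =
      charFn hbar ρ 0 l := by
  have := h.countable
  refine (hasSum_charFun_densMeasure (hasSum_norm_fourierOp h.hasSum_norm) _).unique ?_
  have hs := h.hasSum_trace (weyl hbar (-(hbar • l)) (hbar • 0))
  convert! hs using 2 with i
  rw [weyl_apply, ← (fourierOp n).inner_map_map (ψ i) (_ • _)]
  simp [phaseOp_zero, fourierOp_translation, smul_smul]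

end Distributions

/-! ### Marginals of the covariant phase-space observables -/

section Marginals

variable {n : ℕ} {ι κ : Type}

/-- The amplitude `⟨f, e^{2πi ξ·Q} T_x Π g⟩ = ∫ conj (f y) e^{2πi ξ·y} g(x - y) dy`. -/
def amp (f g : L2 n) (x ξ : V n) : ℂ :=
  inner ℂ f (phaseOp ((2 * Real.pi) • ξ) (translation x (parity n g)))

lemma amp_eq_integral (f g : L2 n) (x ξ : V n) : amp f g x ξ =
    ∫ y, Complex.exp (Complex.I * ((inner ℝ ((2 * Real.pi) • ξ) y : ℝ) : ℂ)) *
      (starRingEnd ℂ (f y) * g (x - y)) := by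
  rw [amp, L2.inner_def]
  refine integral_congr_ae ?_
  filter_upwards [coeFn_phaseOp ((2 * Real.pi) • ξ) (translation x (parity n g)),
    coeFn_translation x (parity n g),
    (quasiMeasurePreserving_sub_right' x).ae (coeFn_parity g)] with y a b c
  rw [a, b, c, RCLike.inner_apply, neg_sub]
  ring

lemma measurable_amp (f g : L2 n) : Measurable fun z : V n × V n => amp f g z.1 z.2 := by
  simp_rw [amp_eq_integral]
  refine StronglyMeasurable.measurable (StronglyMeasurable.integral_prod_right' (f := fun w :
    (V n × V n) × V n => Complex.exp (Complex.I * ((inner ℝ ((2 * Real.pi) • w.1.2) w.2 : ℝ) : ℂ)) *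
      (starRingEnd ℂ (f w.2) * g (w.1.1 - w.2))) ?_)
  refine Continuous.stronglyMeasurable (by fun_prop) |>.mul (StronglyMeasurable.mul ?_ ?_)
  · exact Complex.continuous_conj.comp_stronglyMeasurable
      ((Lp.stronglyMeasurable f).comp_measurable measurable_snd)
  · exact (Lp.stronglyMeasurable g).comp_measurable (by fun_prop)

lemma amp_eq_fourier (f g : L2 n) (x ξ : V n) :
    amp f g x ξ = FourierTransform.fourier (fun y => starRingEnd ℂ (f y) * g (x - y)) (-ξ) := by
  rw [amp_eq_integral, Real.fourier_eq]
  refine integral_congr_ae (Filter.Eventually.of_forall fun y => ?_)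
  simp only [Circle.smul_def, Real.fourierChar_apply, smul_eq_mul]
  congr 2
  rw [inner_neg_right, real_inner_smul_left, real_inner_comm]
  push_cast
  ring

lemma memLp_comp_sub_left (g : L2 n) (x : V n) : MemLp (fun y => g (x - y)) 2 volume :=
  (Lp.memLp g).comp_measurePreserving (Measure.measurePreserving_sub_left volume x)

lemma measurable_enorm_sq_mul_enorm_sq (f g : L2 n) :
    Measurable fun z : V n × V n => ‖f z.2‖ₑ ^ 2 * ‖g (z.1 - z.2)‖ₑ ^ 2 :=
  ((measurable_enorm_sq f).comp measurable_snd).mul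
    ((measurable_enorm_sq g).comp (measurable_fst.sub measurable_snd))

/-- Integrating the squared amplitude over all frequencies, by Plancherel's theorem: for fixed `x`,
the amplitude is the Fourier transform of a function in `L¹`, which for almost every `x` is also
in `L²`. -/
lemma lintegral_enorm_amp_sq (f g : L2 n) : ∀ᵐ x : V n, ∫⁻ ξ, ‖amp f g x ξ‖ₑ ^ 2 =
    ∫⁻ y, ‖f y‖ₑ ^ 2 * ‖g (x - y)‖ₑ ^ 2 := by
  have hfin : ∀ᵐ x : V n, ∫⁻ y, ‖f y‖ₑ ^ 2 * ‖g (x - y)‖ₑ ^ 2 < ∞ := by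
    refine ae_lt_top (measurable_enorm_sq_mul_enorm_sq f g).lintegral_prod_right' ?_
    rw [lintegral_lintegral_swap (measurable_enorm_sq_mul_enorm_sq f g).aemeasurable]
    have : ∀ y, ∫⁻ x, ‖f y‖ₑ ^ 2 * ‖g (x - y)‖ₑ ^ 2 = ‖f y‖ₑ ^ 2 * ‖g‖ₑ ^ 2 := by
      intro y
      have hm : Measurable fun x => ‖g (x - y)‖ₑ ^ 2 :=
        (measurable_enorm_sq g).comp (measurable_sub_const y)
      rw [lintegral_const_mul _ hm,
        lintegral_sub_right_eq_self (fun x => ‖g x‖ₑ ^ 2) y, lintegral_enorm_sq]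
    simp_rw [this]
    rw [lintegral_mul_const _ (measurable_enorm_sq f), lintegral_enorm_sq]
    exact ENNReal.mul_ne_top (by simp) (by simp)
  filter_upwards [hfin] with x hx
  have hf : MemLp (fun y => starRingEnd ℂ (f y)) 2 volume := (Lp.memLp f).star
  have h1 : Integrable (fun y => starRingEnd ℂ (f y) * g (x - y)) :=
    hf.integrable_mul (memLp_comp_sub_left g x)
  have he : ∀ y, ‖starRingEnd ℂ (f y) * g (x - y)‖ₑ ^ 2 = ‖f y‖ₑ ^ 2 * ‖g (x - y)‖ₑ ^ 2 := by
    intro y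
    rw [enorm_mul, mul_pow, RCLike.enorm_conj]
  have h2 : MemLp (fun y => starRingEnd ℂ (f y) * g (x - y)) 2 volume := by
    refine ⟨h1.aestronglyMeasurable, ?_⟩
    have h := eLpNorm_nnreal_pow_eq_lintegral (f := fun y => starRingEnd ℂ (f y) * g (x - y))
      (μ := volume) (p := 2) (by norm_num)
    have h' : eLpNorm (fun y => starRingEnd ℂ (f y) * g (x - y)) 2 volume ^ 2 =
      ∫⁻ y, ‖starRingEnd ℂ (f y) * g (x - y)‖ₑ ^ 2 := by simpa using h
    simp_rw [he] at h'
    by_contra hcon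
    rw [not_lt, top_le_iff] at hcon
    rw [hcon] at h'
    rw [← h'] at hx
    simp at hx
  simp_rw [amp_eq_fourier]
  rw [lintegral_neg_eq_self (fun ξ => ‖FourierTransform.fourier
    (fun y => starRingEnd ℂ (f y) * g (x - y)) ξ‖ₑ ^ 2), lintegral_enorm_fourier_sq h1 h2]
  simp_rw [he]

/-- The Fourier transform acts on the amplitudes as a rotation of phase space, which exchanges the
roles of position and momentum. -/
lemma enorm_amp_fourierOp (f g : L2 n) (x ξ : V n) :
    ‖amp f g x ξ‖ₑ = ‖amp (fourierOp n f) (fourierOp n g) ξ (-x)‖ₑ := by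
  rw [amp, ← (fourierOp n).inner_map_map, fourierOp_phaseOp, fourierOp_translation,
    fourierOp_parity, translation_phaseOp, inner_smul_right, enorm_mul, amp]
  have h1 : ∀ r : ℝ, ‖Complex.exp (-(Complex.I * (r : ℂ)))‖ₑ = 1 := by
    intro r
    rw [← ofReal_norm, show -(Complex.I * (r : ℂ)) = ((-r : ℝ) : ℂ) * Complex.I by push_cast; ring,
      Complex.norm_exp_ofReal_mul_I]
    simp
  rw [h1, one_mul, smul_smul, inv_mul_cancel₀ (by positivity), one_smul, smul_neg, neg_smul]

/-- Up to scaling, the phase-space density of `M^σ` in the state `ρ`, for `ρ = ∑ᵢ |ψᵢ⟩⟨ψᵢ|` and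
`σ = ∑ⱼ |φⱼ⟩⟨φⱼ|`. -/
def ampDensity (ψ : ι → L2 n) (φ : κ → L2 n) (x ξ : V n) : ℝ≥0∞ :=
  ∑' i, ∑' j, ‖amp (ψ i) (φ j) x ξ‖ₑ ^ 2

lemma measurable_ampDensity [Countable ι] [Countable κ] (ψ : ι → L2 n) (φ : κ → L2 n) :
    Measurable fun z : V n × V n => ampDensity ψ φ z.1 z.2 :=
  Measurable.tsum fun i => Measurable.tsum fun j =>
    (measurable_amp (ψ i) (φ j)).enorm.pow_const 2

lemma ampDensity_fourierOp (ψ : ι → L2 n) (φ : κ → L2 n) (x ξ : V n) : ampDensity ψ φ x ξ =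
    ampDensity (fun i => fourierOp n (ψ i)) (fun j => fourierOp n (φ j)) ξ (-x) := by
  rw [ampDensity, ampDensity]
  exact tsum_congr fun i => tsum_congr fun j => by rw [enorm_amp_fourierOp]

/-- Integrating the phase-space density over all momenta gives the density of a convolution. -/
lemma setLIntegral_ampDensity [Countable ι] [Countable κ] (ψ : ι → L2 n) (φ : κ → L2 n)
    {s : Set (V n)} (hs : MeasurableSet s) :
    ∫⁻ x in s, ∫⁻ ξ, ampDensity ψ φ x ξ = (densMeasure ψ ∗ densMeasure φ) s := by
  have hm : ∀ {ι' : Type} [Countable ι'] (χ : ι' → L2 n),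
      Measurable fun x => ∑' i, ‖χ i x‖ₑ ^ 2 := fun χ =>
    Measurable.tsum fun i => measurable_enorm_sq (χ i)
  rw [densMeasure, densMeasure, conv_withDensity_eq_lconvolution (hm ψ) (hm φ),
    withDensity_apply _ hs]
  refine setLIntegral_congr_fun_ae hs ?_
  have hall : ∀ᵐ x : V n, ∀ i j, ∫⁻ ξ, ‖amp (ψ i) (φ j) x ξ‖ₑ ^ 2 =
      ∫⁻ y, ‖ψ i y‖ₑ ^ 2 * ‖φ j (x - y)‖ₑ ^ 2 :=
    ae_all_iff.2 fun i => ae_all_iff.2 fun j => lintegral_enorm_amp_sq (ψ i) (φ j)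
  filter_upwards [hall] with x hx _
  have hmx : ∀ i j, Measurable fun ξ => ‖amp (ψ i) (φ j) x ξ‖ₑ ^ 2 := fun i j =>
    ((measurable_amp (ψ i) (φ j)).comp (measurable_prodMk_left (x := x))).enorm.pow_const 2
  have hmy : ∀ i j, Measurable fun y => ‖ψ i y‖ₑ ^ 2 * ‖φ j (x - y)‖ₑ ^ 2 := fun i j =>
    (measurable_enorm_sq (ψ i)).mul ((measurable_enorm_sq (φ j)).comp (measurable_const_sub x))
  change ∫⁻ ξ, ∑' i, ∑' j, ‖amp (ψ i) (φ j) x ξ‖ₑ ^ 2 = _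
  rw [lintegral_tsum fun i => (Measurable.tsum fun j => hmx i j).aemeasurable]
  have hi : ∀ i, ∫⁻ ξ, ∑' j, ‖amp (ψ i) (φ j) x ξ‖ₑ ^ 2 =
      ∫⁻ y, ∑' j, ‖ψ i y‖ₑ ^ 2 * ‖φ j (x - y)‖ₑ ^ 2 := fun i => by
    rw [lintegral_tsum fun j => (hmx i j).aemeasurable,
      lintegral_tsum fun j => (hmy i j).aemeasurable]
    exact tsum_congr (hx i)
  rw [tsum_congr hi, ← lintegral_tsum fun i => (Measurable.tsum fun j => hmy i j).aemeasurable,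
    lconvolution_def]
  refine lintegral_congr fun y => ?_
  simp_rw [ENNReal.tsum_mul_left, ENNReal.tsum_mul_right]
  rw [neg_add_eq_sub]

lemma inner_parity_left (f g : L2 n) : inner ℂ (parity n f) g = inner ℂ f (parity n g) := by
  have h1 : parity n (parity n g) = g := by
    refine Lp.ext ?_
    filter_upwards [coeFn_parity (parity n g), quasiMeasurePreserving_neg'.ae (coeFn_parity g)]
      with x a b
    rw [a, b, neg_neg]
  conv_lhs => rw [← h1]
  exact (Lp.compMeasurePreservingₗᵢ ℂ (fun y : V n => -y)
    (Measure.measurePreserving_neg volume)).inner_map_map f (parity n g)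

lemma ofReal_trace_phaseSpaceDensity {hbar : ℝ} (hbar_pos : 0 < hbar) {ρ σ : State n}
    {ψ : ι → L2 n} {φ : κ → L2 n} (hψ : IsDecomposition ρ ψ) (hφ : IsDecomposition σ φ)
    (x p : V n) : ENNReal.ofReal (trace (ρ.op * phaseSpaceDensity hbar σ x p)).re =
      ENNReal.ofReal (1 / (2 * Real.pi * hbar) ^ n) *
        ampDensity ψ φ x ((2 * Real.pi * hbar)⁻¹ • p) := by
  set c : ℝ := 1 / (2 * Real.pi * hbar) ^ n with hc
  have hc0 : 0 ≤ c := by positivity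
  have hinner : ∀ f : L2 n, HasSum
      (fun j => ((c * ‖amp f (φ j) x ((2 * Real.pi * hbar)⁻¹ • p)‖ ^ 2 : ℝ) : ℂ))
      (inner ℂ f (phaseSpaceDensity hbar σ x p f)) := by
    intro f
    set u := parity n (ContinuousLinearMap.adjoint (weyl hbar x p) f) with hu
    have h1 : inner ℂ f (phaseSpaceDensity hbar σ x p f) = (c : ℂ) * inner ℂ u (σ.op u) := by
      simp only [phaseSpaceDensity, smul_apply, inner_smul_right, mul_apply_eq_comp]
      rw [← ContinuousLinearMap.adjoint_inner_left, ← inner_parity_left]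
    rw [h1]
    convert! (hφ.hasSum_inner u u).mul_left (c : ℂ) using 2 with j
    have h2 : inner ℂ u (φ j) = Complex.exp (-(Complex.I *
        ((inner ℝ p x / 2 / hbar : ℝ) : ℂ))) * amp f (φ j) x ((2 * Real.pi * hbar)⁻¹ • p) := by
      rw [hu, inner_parity_left, ContinuousLinearMap.adjoint_inner_left, weyl_apply,
        inner_smul_right, amp, smul_smul]
      congr 4
      field_simp
    rw [← inner_conj_symm (φ j) u, Complex.mul_conj, Complex.normSq_eq_norm_sq, h2, norm_mul,
      show -(Complex.I * ((inner ℝ p x / 2 / hbar : ℝ) : ℂ)) =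
        ((-(inner ℝ p x / 2 / hbar) : ℝ) : ℂ) * Complex.I by push_cast; ring,
      Complex.norm_exp_ofReal_mul_I, one_mul]
    push_cast
    rfl
  have hf : ∀ f : L2 n, ENNReal.ofReal (inner ℂ f (phaseSpaceDensity hbar σ x p f)).re =
      ENNReal.ofReal c * ∑' j, ‖amp f (φ j) x ((2 * Real.pi * hbar)⁻¹ • p)‖ₑ ^ 2 := by
    intro f
    rw [ofReal_re_eq_tsum (hinner f) (fun j => by rw [Complex.ofReal_re]; positivity),
      ← ENNReal.tsum_mul_left]
    refine tsum_congr fun j => ?_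
    rw [Complex.ofReal_re, ENNReal.ofReal_mul hc0, ENNReal.ofReal_pow (norm_nonneg _), ofReal_norm]
  rw [ofReal_re_eq_tsum (hψ.hasSum_trace _) (fun i => ?_), ampDensity, ← ENNReal.tsum_mul_left]
  · exact tsum_congr fun i => hf (ψ i)
  · rw [← (Complex.hasSum_re (hinner (ψ i))).tsum_eq]
    refine tsum_nonneg fun j => ?_
    rw [Complex.ofReal_re]; positivity

lemma lintegral_comp_inv_smul {r : ℝ} (hr : 0 < r) {G : V n → ℝ≥0∞} (hG : Measurable G) :
    ENNReal.ofReal (1 / r ^ n) * ∫⁻ p, G (r⁻¹ • p) = ∫⁻ ξ, G ξ := by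
  have h := Measure.map_addHaar_smul (volume : Measure (V n)) (inv_ne_zero hr.ne')
  rw [← lintegral_map (μ := volume) hG (measurable_const_smul r⁻¹), h, lintegral_smul_measure,
    smul_eq_mul, ← mul_assoc, ← ENNReal.ofReal_mul (by positivity)]
  have : 1 / r ^ n * |(r⁻¹ ^ Module.finrank ℝ (V n))⁻¹| = 1 := by
    rw [finrank_euclideanSpace_fin, inv_pow, inv_inv, abs_of_pos (by positivity)]
    field_simp
  rw [this]
  simp

lemma measurable_uncurry_comp_smul {F : V n → V n → ℝ≥0∞} (r : ℝ)
    (hF : Measurable fun z : V n × V n => F z.1 z.2) :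
    Measurable fun z : V n × V n => F z.1 (r • z.2) := by
  have h : Measurable fun z : V n × V n => (z.1, r • z.2) := by fun_prop
  exact hF.comp h

lemma phaseSpaceDist_eq {hbar : ℝ} (hbar_pos : 0 < hbar) {ρ σ : State n}
    {ψ : ι → L2 n} {φ : κ → L2 n} (hψ : IsDecomposition ρ ψ) (hφ : IsDecomposition σ φ) :
    phaseSpaceDist hbar σ ρ = (volume : Measure (V n × V n)).withDensity fun z =>
      ENNReal.ofReal (1 / (2 * Real.pi * hbar) ^ n) *
        ampDensity ψ φ z.1 ((2 * Real.pi * hbar)⁻¹ • z.2) := by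
  rw [phaseSpaceDist]
  congr 1
  funext z
  exact ofReal_trace_phaseSpaceDensity hbar_pos hψ hφ z.1 z.2

/-- The position marginal of `M^σ` in the state `ρ` is the convolution of the position
distributions of `ρ` and `σ`. -/
lemma phaseSpaceDist_map_fst {hbar : ℝ} (hbar_pos : 0 < hbar) {ρ σ : State n}
    {ψ : ι → L2 n} {φ : κ → L2 n} (hψ : IsDecomposition ρ ψ) (hφ : IsDecomposition σ φ) :
    (phaseSpaceDist hbar σ ρ).map Prod.fst = densMeasure ψ ∗ densMeasure φ := by
  have := hψ.countable
  have := hφ.countable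
  have hD := measurable_ampDensity ψ φ
  have hr : 0 < 2 * Real.pi * hbar := by positivity
  refine Measure.ext fun s hs => ?_
  have hm : Measurable fun z : V n × V n => ENNReal.ofReal (1 / (2 * Real.pi * hbar) ^ n) *
      ampDensity ψ φ z.1 ((2 * Real.pi * hbar)⁻¹ • z.2) :=
    (measurable_uncurry_comp_smul _ hD).const_mul _
  rw [Measure.map_apply measurable_fst hs, phaseSpaceDist_eq hbar_pos hψ hφ,
    withDensity_apply _ (measurable_fst hs), ← setLIntegral_ampDensity ψ φ hs,
    ← Set.prod_univ, Measure.volume_eq_prod, setLIntegral_prod _ hm.aemeasurable]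
  refine lintegral_congr fun x => ?_
  have hx : Measurable fun ξ => ampDensity ψ φ x ξ := Measurable.of_uncurry_left (f := ampDensity ψ φ) hD
  have hx' : Measurable fun p => ampDensity ψ φ x ((2 * Real.pi * hbar)⁻¹ • p) :=
    hx.comp (measurable_const_smul _)
  rw [setLIntegral_univ, lintegral_const_mul _ hx', lintegral_comp_inv_smul hr hx]

/-- The momentum marginal of `M^σ` in the state `ρ` is the convolution of the momentum
distributions of `ρ` and `σ`. -/
lemma phaseSpaceDist_map_snd {hbar : ℝ} (hbar_pos : 0 < hbar) {ρ σ : State n}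
    {ψ : ι → L2 n} {φ : κ → L2 n} (hψ : IsDecomposition ρ ψ) (hφ : IsDecomposition σ φ) :
    (phaseSpaceDist hbar σ ρ).map Prod.snd =
      ((densMeasure fun i => fourierOp n (ψ i)) ∗ densMeasure fun j => fourierOp n (φ j)).map
        ((2 * Real.pi * hbar) • ·) := by
  have := hψ.countable
  have := hφ.countable
  have hD := measurable_ampDensity ψ φ
  have hD' := measurable_ampDensity (fun i => fourierOp n (ψ i)) (fun j => fourierOp n (φ j))
  have hr : 0 < 2 * Real.pi * hbar := by positivity
  have hms : Measurable fun ξ : V n => (2 * Real.pi * hbar) • ξ := measurable_const_smul _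
  refine Measure.ext fun s hs => ?_
  have hm : Measurable fun z : V n × V n => ENNReal.ofReal (1 / (2 * Real.pi * hbar) ^ n) *
      ampDensity ψ φ z.1 ((2 * Real.pi * hbar)⁻¹ • z.2) :=
    (measurable_uncurry_comp_smul _ hD).const_mul _
  rw [Measure.map_apply measurable_snd hs, phaseSpaceDist_eq hbar_pos hψ hφ,
    withDensity_apply _ (measurable_snd hs), Measure.map_apply hms hs,
    ← setLIntegral_ampDensity _ _ (hms hs), ← Set.univ_prod, Measure.volume_eq_prod,
    setLIntegral_prod_symm _ hm.aemeasurable, ← lintegral_indicator hs,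
    ← lintegral_indicator (hms hs)]
  set G : V n → ℝ≥0∞ := fun ξ => ∫⁻ x,
    ampDensity (fun i => fourierOp n (ψ i)) (fun j => fourierOp n (φ j)) ξ x with hGdef
  have hG : Measurable G := hD'.lintegral_prod_right'
  have hG' : Measurable fun p : V n => ((fun ξ : V n => (2 * Real.pi * hbar) • ξ) ⁻¹' s).indicator
      G ((2 * Real.pi * hbar)⁻¹ • p) := (hG.indicator (hms hs)).comp (measurable_const_smul _)
  rw [← lintegral_comp_inv_smul hr (hG.indicator (hms hs)), ← lintegral_const_mul _ hG']
  refine lintegral_congr fun p => ?_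
  have hmem : (2 * Real.pi * hbar)⁻¹ • p ∈ (fun ξ : V n => (2 * Real.pi * hbar) • ξ) ⁻¹' s ↔
      p ∈ s := by
    rw [Set.mem_preimage, smul_smul, mul_inv_cancel₀ hr.ne', one_smul]
  by_cases hp : p ∈ s
  · rw [Set.indicator_of_mem hp, Set.indicator_of_mem (hmem.2 hp), setLIntegral_univ, hGdef]
    have hx : Measurable fun x => ampDensity ψ φ x ((2 * Real.pi * hbar)⁻¹ • p) :=
      Measurable.of_uncurry_right (f := ampDensity ψ φ) hD
    rw [lintegral_const_mul _ hx]
    congr 1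
    simp_rw [ampDensity_fourierOp ψ φ]
    exact lintegral_neg_eq_self _
  · rw [Set.indicator_of_notMem hp, Set.indicator_of_notMem (mt hmem.1 hp), mul_zero]

end Marginals

/-! ### States are determined by their characteristic functions -/

section Uniqueness

open scoped FourierTransform SchwartzMap

variable {n : ℕ} {ι κ : Type}

lemma integrable_tsum_of_summable_integral_norm {X : Type*} [MeasurableSpace X] {μ : Measure X}
    [Countable ι] {F : ι → X → ℂ} (hm : ∀ i, Measurable (F i)) (hi : ∀ i, Integrable (F i) μ)
    (hs : Summable fun i => ∫ x, ‖F i x‖ ∂μ) : Integrable (fun x => ∑' i, F i x) μ := by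
  refine ⟨(Measurable.tsum hm).aestronglyMeasurable, ?_⟩
  have h1 : ∫⁻ x, ‖∑' i, F i x‖ₑ ∂μ ≤ ∫⁻ x, ∑' i, ‖F i x‖ₑ ∂μ :=
    lintegral_mono fun x => enorm_tsum_le_tsum_enorm
  refine lt_of_le_of_lt h1 ?_
  rw [lintegral_tsum fun i => (hm i).enorm.aemeasurable]
  have h2 : ∀ i, ∫⁻ x, ‖F i x‖ₑ ∂μ = ENNReal.ofReal (∫ x, ‖F i x‖ ∂μ) := fun i =>
    (ofReal_integral_norm_eq_lintegral_enorm (hi i)).symm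
  simp_rw [h2]
  rw [← ENNReal.ofReal_tsum_of_nonneg (fun i => integral_nonneg fun x => norm_nonneg _) hs]
  exact ENNReal.ofReal_lt_top

lemma ae_eq_zero_of_fourier_eq_zero {h : V n → ℂ} (h1 : Integrable h) (h0 : ∀ ξ, 𝓕 h ξ = 0) :
    ∀ᵐ x, h x = 0 := by
  refine ae_eq_zero_of_integral_contDiff_smul_eq_zero h1.locallyIntegrable fun g hg hgc => ?_
  -- `∫ u h = ∫ 𝓕(𝓕⁻ u) h = ∫ (𝓕⁻ u) 𝓕h = 0` for the test function `u = g`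
  let u : 𝓢(V n, ℂ) := HasCompactSupport.toSchwartzMap (f := fun x => (g x : ℂ))
    (hgc.comp_left (g := ((↑) : ℝ → ℂ)) Complex.ofReal_zero)
    (Complex.ofRealCLM.contDiff.comp hg)
  have e3 : ∫ x, (𝓕 (𝓕⁻ u)) x • h x = ∫ x, (𝓕⁻ u) x • 𝓕 h x := by
    have := VectorFourier.integral_fourierIntegral_smul_eq_flip (L := innerₗ (V n))
      (μ := volume) (ν := volume) Real.continuous_fourierChar
      (by exact continuous_inner) (𝓕⁻ u).integrable h1
    rw [flip_innerₗ] at this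
    exact this
  rw [FourierTransform.fourier_fourierInv_eq] at e3
  have hu : ∀ x, u x = g x := fun x => rfl
  simp only [h0, smul_zero, integral_zero, hu] at e3
  simpa using e3

lemma integral_norm_mul_le (f g : L2 n) : ∫ x, ‖f x‖ * ‖g x‖ ≤ ‖f‖ * ‖g‖ := by
  have h := integral_mul_le_Lp_mul_Lq_of_nonneg (μ := (volume : Measure (V n)))
    (f := fun x => ‖f x‖) (g := fun x => ‖g x‖) Real.HolderConjugate.two_two
    (Filter.Eventually.of_forall fun x => norm_nonneg _)
    (Filter.Eventually.of_forall fun x => norm_nonneg _)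
    (by simpa using (Lp.memLp f).norm) (by simpa using (Lp.memLp g).norm)
  have hn : ∀ f : L2 n, (∫ x, ‖f x‖ ^ (2 : ℝ)) ^ (1 / (2 : ℝ)) = ‖f‖ := by
    intro f
    have := L2.inner_def (𝕜 := ℂ) f f
    rw [inner_self_eq_norm_sq_to_K] at this
    have h2 : ((‖f‖ ^ 2 : ℝ) : ℂ) = ((∫ x, ‖f x‖ ^ 2 : ℝ) : ℂ) := by
      rw [← integral_complex_ofReal]
      push_cast
      refine Eq.trans this (integral_congr_ae (Filter.Eventually.of_forall fun x => ?_))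
      simp only [inner_self_eq_norm_sq_to_K]
      simp
    have h3 := Complex.ofReal_injective h2
    simp only [Real.rpow_two]
    rw [← h3, ← Real.sqrt_eq_rpow, Real.sqrt_sq (norm_nonneg _)]
  rwa [hn, hn] at h

/-- The correlation function `∑ᵢ conj (ψᵢ y) ψᵢ(x + y)`, which is the integral kernel of
`∑ᵢ |ψᵢ⟩⟨ψᵢ|` at `(x + y, y)`. -/
def corr (ψ : ι → L2 n) (x y : V n) : ℂ := ∑' i, starRingEnd ℂ (ψ i y) * ψ i (x + y)

lemma measurable_conj_mul_comp_add (f g : L2 n) :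
    Measurable fun z : V n × V n => starRingEnd ℂ (f z.2) * g (z.1 + z.2) := by
  have hf := (Lp.stronglyMeasurable f).measurable
  have hg := (Lp.stronglyMeasurable g).measurable
  have h1 : Measurable fun z : V n × V n => starRingEnd ℂ (f z.2) :=
    Complex.continuous_conj.measurable.comp (hf.comp measurable_snd)
  have h2 : Measurable fun z : V n × V n => g (z.1 + z.2) :=
    hg.comp (measurable_fst.add measurable_snd)
  exact h1.mul h2

lemma measurable_corr [Countable ι] (ψ : ι → L2 n) :
    Measurable fun z : V n × V n => corr ψ z.1 z.2 :=
  Measurable.tsum fun i => measurable_conj_mul_comp_add (ψ i) (ψ i)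

lemma integrable_conj_mul_comp_add (f : L2 n) (x : V n) :
    Integrable (fun y => starRingEnd ℂ (f y) * f (x + y)) ∧
      ∫ y, ‖starRingEnd ℂ (f y) * f (x + y)‖ ≤ ‖f‖ ^ 2 := by
  have h0 : translation (-x) f =ᵐ[volume] fun y => f (x + y) := by
    filter_upwards [coeFn_translation (-x) f] with y hy
    rw [hy, sub_neg_eq_add, add_comm]
  have hn : ‖translation (-x) f‖ = ‖f‖ :=
    (Lp.compMeasurePreservingₗᵢ ℂ (fun y : V n => y - -x)
      (measurePreserving_sub_right volume (-x))).norm_map f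
  have hf : MemLp (fun y => starRingEnd ℂ (f y)) 2 volume := (Lp.memLp f).star
  have hg : MemLp (fun y => f (x + y)) 2 volume := (memLp_congr_ae h0).1 (Lp.memLp _)
  refine ⟨hf.integrable_mul hg, ?_⟩
  have h1 := integral_norm_mul_le f (translation (-x) f)
  rw [hn, ← sq] at h1
  refine le_trans (le_of_eq ?_) h1
  refine integral_congr_ae ?_
  filter_upwards [h0] with y hy
  rw [hy, norm_mul, RCLike.norm_conj]

lemma hasSum_integral_corr [Countable ι] {ψ : ι → L2 n} (h : HasSum (fun i => ‖ψ i‖ ^ 2) 1)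
    (x k : V n) : Integrable (corr ψ x) ∧
      HasSum (fun i => inner ℂ (ψ i) (phaseOp k (translation (-x) (ψ i))))
        (∫ y, Complex.exp (Complex.I * ((inner ℝ k y : ℝ) : ℂ)) * corr ψ x y) := by
  have hm : ∀ i, Measurable fun y => starRingEnd ℂ (ψ i y) * ψ i (x + y) := fun i =>
    Measurable.of_uncurry_left (f := fun x y => starRingEnd ℂ (ψ i y) * ψ i (x + y))
      (measurable_conj_mul_comp_add (ψ i) (ψ i))
  have hs : Summable fun i => ∫ y, ‖starRingEnd ℂ (ψ i y) * ψ i (x + y)‖ :=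
    Summable.of_nonneg_of_le (fun i => integral_nonneg fun y => norm_nonneg _)
      (fun i => (integrable_conj_mul_comp_add (ψ i) x).2) h.summable
  refine ⟨integrable_tsum_of_summable_integral_norm hm
    (fun i => (integrable_conj_mul_comp_add (ψ i) x).1) hs, ?_⟩
  have hexp : ∀ y : V n, ‖Complex.exp (Complex.I * ((inner ℝ k y : ℝ) : ℂ))‖ = 1 := fun y => by
    rw [mul_comm, Complex.norm_exp_ofReal_mul_I]
  have hF := hasSum_integral_of_summable_integral_norm (μ := (volume : Measure (V n)))
    (F := fun i y => Complex.exp (Complex.I * ((inner ℝ k y : ℝ) : ℂ)) *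
      (starRingEnd ℂ (ψ i y) * ψ i (x + y)))
    (fun i => (integrable_conj_mul_comp_add (ψ i) x).1.bdd_mul (c := 1)
      (Continuous.aestronglyMeasurable (by fun_prop))
      (Filter.Eventually.of_forall fun y => (hexp y).le))
    (by simpa only [norm_mul, hexp, one_mul] using hs)
  simp only [tsum_mul_left] at hF
  convert! hF using 2 with i
  rw [L2.inner_def]
  refine integral_congr_ae ?_
  filter_upwards [coeFn_phaseOp k (translation (-x) (ψ i)), coeFn_translation (-x) (ψ i)]
    with y a b
  rw [a, b, RCLike.inner_apply, sub_neg_eq_add, add_comm y x]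
  ring

/-- The correlation function of a state is determined by the characteristic function. -/
lemma corr_ae_eq {hbar : ℝ} (hbar0 : hbar ≠ 0) {ρ σ : State n} {ψ : ι → L2 n} {φ : κ → L2 n}
    (hψ : IsDecomposition ρ ψ) (hφ : IsDecomposition σ φ)
    (h : ∀ k l, charFn hbar ρ k l = charFn hbar σ k l) (x : V n) :
    ∀ᵐ y, corr ψ x y = corr φ x y := by
  have := hψ.countable
  have := hφ.countable
  have key : ∀ k : V n, ∫ y, Complex.exp (Complex.I * ((inner ℝ k y : ℝ) : ℂ)) * corr ψ x y =
      ∫ y, Complex.exp (Complex.I * ((inner ℝ k y : ℝ) : ℂ)) * corr φ x y := by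
    intro k
    set c := Complex.exp (-(Complex.I * ((inner ℝ (hbar • k) (-x) / 2 / hbar : ℝ) : ℂ))) with hc
    have hW : ∀ f : L2 n, inner ℂ f (weyl hbar (-x) (hbar • k) f) =
        c * inner ℂ f (phaseOp k (translation (-x) f)) := by
      intro f
      rw [weyl_apply, inner_smul_right, smul_smul, inv_mul_cancel₀ hbar0, one_smul]
    have h1 := hψ.hasSum_trace (weyl hbar (-x) (hbar • k))
    have h2 := hφ.hasSum_trace (weyl hbar (-x) (hbar • k))
    have h3 := h k (hbar⁻¹ • x)
    rw [charFn, charFn, smul_smul, mul_inv_cancel₀ hbar0, one_smul] at h3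
    simp only [hW] at h1 h2
    have h4 := h1.unique ((hasSum_integral_corr hψ.hasSum_norm x k).2.mul_left c)
    have h5 := h2.unique ((hasSum_integral_corr hφ.hasSum_norm x k).2.mul_left c)
    rw [h4, h5] at h3
    exact mul_left_cancel₀ (Complex.exp_ne_zero _) h3
  have i1 := (hasSum_integral_corr hψ.hasSum_norm x 0).1
  have i2 := (hasSum_integral_corr hφ.hasSum_norm x 0).1
  have h0 := ae_eq_zero_of_fourier_eq_zero (i1.sub i2) (fun ξ => ?_)
  · filter_upwards [h0] with y hy
    exact sub_eq_zero.1 hy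
  · have h6 := key (-(2 * Real.pi) • ξ)
    have hb : ∀ {g : V n → ℂ}, Integrable g → Integrable fun y =>
        Complex.exp (Complex.I * ((inner ℝ (-(2 * Real.pi) • ξ) y : ℝ) : ℂ)) * g y := fun hg =>
      hg.bdd_mul (c := 1) (Continuous.aestronglyMeasurable (by fun_prop))
        (Filter.Eventually.of_forall fun y => by rw [mul_comm, Complex.norm_exp_ofReal_mul_I])
    rw [← sub_eq_zero, ← integral_sub (hb i1) (hb i2)] at h6
    rw [Real.fourier_eq, ← h6]
    refine integral_congr_ae (Filter.Eventually.of_forall fun y => ?_)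
    simp only [Circle.smul_def, Real.fourierChar_apply, smul_eq_mul, Pi.sub_apply]
    rw [← mul_sub]
    congr 2
    rw [real_inner_smul_left, real_inner_comm]
    push_cast
    ring

/-- The matrix elements of a state in terms of its integral kernel. -/
lemma inner_op_eq_integral_corr {ρ : State n} {ψ : ι → L2 n} (hψ : IsDecomposition ρ ψ)
    (f g : L2 n) : inner ℂ f (ρ.op g) = ∫ z : V n × V n,
      (starRingEnd ℂ (f (z.1 + z.2)) * g z.2) * corr ψ z.1 z.2 := by
  have := hψ.countable
  have hsh : MeasurePreserving (fun z : V n × V n => (z.1 + z.2, z.2)) volume volume :=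
    measurePreserving_add_prod volume volume
  have hemb : MeasurableEmbedding fun z : V n × V n => (z.1 + z.2, z.2) := by
    exact (MeasurableEquiv.mk ⟨fun z : V n × V n => (z.1 + z.2, z.2), fun z => (z.1 - z.2, z.2),
      fun z => by simp, fun z => by simp⟩ ((measurable_fst.add measurable_snd).prodMk
      measurable_snd) ((measurable_fst.sub measurable_snd).prodMk
      measurable_snd)).measurableEmbedding
  set G : ι → V n × V n → ℂ := fun i z =>
    (starRingEnd ℂ (f z.1) * ψ i z.1) * (starRingEnd ℂ (ψ i z.2) * g z.2) with hG
  have hprod : ∀ u v : L2 n, Integrable fun y => starRingEnd ℂ (u y) * v y := fun u v =>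
    MemLp.integrable_mul (p := 2) (q := 2) (Lp.memLp u).star (Lp.memLp v)
  have hGi : ∀ i, Integrable (G i) := fun i => (hprod f (ψ i)).mul_prod (hprod (ψ i) g)
  have hGint : ∀ i, ∫ z, G i z = inner ℂ f (ψ i) * inner ℂ (ψ i) g := by
    intro i
    have h1 : ∀ u v : L2 n, inner ℂ u v = ∫ y, starRingEnd ℂ (u y) * v y := by
      intro u v
      rw [L2.inner_def]
      refine integral_congr_ae (Filter.Eventually.of_forall fun y => ?_)
      simp only [RCLike.inner_apply, mul_comm]
    rw [h1, h1, Measure.volume_eq_prod]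
    exact integral_prod_mul (fun y => starRingEnd ℂ (f y) * ψ i y)
      (fun y => starRingEnd ℂ (ψ i y) * g y)
  have hGn : ∀ i, ∫ z, ‖G i z‖ ≤ ‖f‖ * ‖g‖ * ‖ψ i‖ ^ 2 := by
    intro i
    have h1 : ∫ z, ‖G i z‖ = (∫ y, ‖f y‖ * ‖ψ i y‖) * ∫ y, ‖ψ i y‖ * ‖g y‖ := by
      simp only [hG, norm_mul, RCLike.norm_conj]
      rw [Measure.volume_eq_prod]
      exact integral_prod_mul (fun y => ‖f y‖ * ‖ψ i y‖) (fun y => ‖ψ i y‖ * ‖g y‖)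
    rw [h1]
    calc _ ≤ (‖f‖ * ‖ψ i‖) * (‖ψ i‖ * ‖g‖) :=
          mul_le_mul (integral_norm_mul_le _ _) (integral_norm_mul_le _ _)
            (integral_nonneg fun y => by positivity) (by positivity)
      _ = _ := by ring
  have hK := hasSum_integral_of_summable_integral_norm (μ := (volume : Measure (V n × V n)))
    (F := fun i z => G i (z.1 + z.2, z.2))
    (fun i => (hsh.integrable_comp_emb hemb).2 (hGi i))
    (Summable.of_nonneg_of_le (fun i => integral_nonneg fun y => norm_nonneg _)
      (fun i => by
        rw [hsh.integral_comp hemb (fun z => ‖G i z‖)]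
        exact hGn i) (hψ.hasSum_norm.summable.mul_left _))
  have hK' : HasSum (fun i => inner ℂ f (ψ i) * inner ℂ (ψ i) g)
      (∫ z : V n × V n, ∑' i, G i (z.1 + z.2, z.2)) := by
    convert! hK using 2 with i
    rw [hsh.integral_comp hemb (G i), hGint]
  rw [(hψ.hasSum_inner f g).unique hK']
  refine integral_congr_ae (Filter.Eventually.of_forall fun z => ?_)
  simp only [corr, ← tsum_mul_left, hG]
  exact tsum_congr fun i => by ring

/-- A state is determined by its characteristic function. -/
lemma state_ext_of_charFn {hbar : ℝ} (hbar0 : hbar ≠ 0) {ρ σ : State n}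
    (h : ∀ k l, charFn hbar ρ k l = charFn hbar σ k l) : ρ = σ := by
  have := separableSpace_L2 n
  obtain ⟨ι, ψ, hψ⟩ := exists_isDecomposition ρ
  obtain ⟨κ, φ, hφ⟩ := exists_isDecomposition σ
  have := hψ.countable
  have := hφ.countable
  have hae : ∀ᵐ z : V n × V n, corr ψ z.1 z.2 = corr φ z.1 z.2 := by
    rw [Measure.volume_eq_prod, Measure.ae_prod_iff_ae_ae
      (measurableSet_eq_fun (measurable_corr ψ) (measurable_corr φ))]
    exact Filter.Eventually.of_forall fun x => corr_ae_eq hbar0 hψ hφ h x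
  have hop : ρ.op = σ.op := by
    refine ContinuousLinearMap.ext fun g => ext_inner_left ℂ fun f => ?_
    rw [inner_op_eq_integral_corr hψ, inner_op_eq_integral_corr hφ]
    refine integral_congr_ae ?_
    filter_upwards [hae] with z hz
    rw [hz]
  cases ρ
  cases σ
  simp only at hop
  subst hop
  rfl

end Uniqueness

/-! ### Mixtures of vector states -/

section Mixture

variable {H : Type} [NormedAddCommGroup H] [InnerProductSpace ℂ H]
  {X : Type} [TopologicalSpace X] [SecondCountableTopology X] [MeasurableSpace X] [BorelSpace X]
  (μ : Measure X) [IsProbabilityMeasure μ] (v : X → H)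

/-- The mixture `∫ |v(q)⟩⟨v(q)| dμ(q)` of a continuous family of vector states. -/
def mixtureOp : H →L[ℂ] H := ∫ q, InnerProductSpace.rankOne ℂ (v q) (v q) ∂μ

variable {v}

lemma mixtureOp_apply (hv : Continuous v) (hv1 : ∀ q, ‖v q‖ = 1) (f : H) :
    mixtureOp μ v f = ∫ q, (inner ℂ (v q) f) • v q ∂μ := by
  have hi : Integrable (fun q => InnerProductSpace.rankOne ℂ (v q) (v q)) μ := by
    have hc : Continuous fun q => InnerProductSpace.rankOne ℂ (v q) (v q) := by
      simp only [InnerProductSpace.rankOne_def]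
      fun_prop
    refine (integrable_const (1 : ℝ)).mono' hc.aestronglyMeasurable
      (Filter.Eventually.of_forall fun q => ?_)
    simp [hv1]
  rw [mixtureOp, ContinuousLinearMap.integral_apply hi]
  simp

variable [CompleteSpace H]

lemma inner_mixtureOp (hv : Continuous v) (hv1 : ∀ q, ‖v q‖ = 1) (f g : H) :
    inner ℂ f (mixtureOp μ v g) = ∫ q, inner ℂ f (v q) * inner ℂ (v q) g ∂μ := by
  have hi : Integrable (fun q => (inner ℂ (v q) g) • v q) μ := by
    refine (integrable_const ‖g‖).mono' (Continuous.aestronglyMeasurable (by fun_prop))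
      (Filter.Eventually.of_forall fun q => ?_)
    have := norm_inner_le_norm (𝕜 := ℂ) (v q) g
    rw [hv1, one_mul] at this
    rwa [norm_smul, hv1, mul_one]
  rw [mixtureOp_apply μ hv hv1, ← integral_inner hi]
  refine integral_congr_ae (Filter.Eventually.of_forall fun q => ?_)
  simp only [inner_smul_right, mul_comm]

lemma isPositive_mixtureOp (hv : Continuous v) (hv1 : ∀ q, ‖v q‖ = 1) :
    (mixtureOp μ v).IsPositive := by
  rw [ContinuousLinearMap.isPositive_iff_complex]
  intro f
  have h : inner ℂ (mixtureOp μ v f) f = ((∫ q, ‖inner ℂ (v q) f‖ ^ 2 ∂μ : ℝ) : ℂ) := by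
    rw [← inner_conj_symm, inner_mixtureOp μ hv hv1, ← integral_conj, ← integral_complex_ofReal]
    refine integral_congr_ae (Filter.Eventually.of_forall fun q => ?_)
    simp only
    rw [← inner_conj_symm f (v q), map_mul, Complex.conj_conj, Complex.mul_conj,
      Complex.normSq_eq_norm_sq]
  rw [h]
  constructor
  · simp
  · simpa using integral_nonneg fun q => by positivity

/-- The trace of a mixture against `T` is the mean of the expectations of `T`: the trace and the
integral are interchanged by dominated convergence. -/
lemma hasSum_mixtureOp [TopologicalSpace.SeparableSpace H] (hv : Continuous v)
    (hv1 : ∀ q, ‖v q‖ = 1) (T : H →L[ℂ] H) :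
    HasSum (fun i => inner ℂ (onb H i) (mixtureOp μ v (T (onb H i))))
      (∫ q, inner ℂ (v q) (T (v q)) ∂μ) := by
  have := countable_of_hilbertBasis (onb H)
  simp_rw [inner_mixtureOp μ hv hv1]
  set T' := ContinuousLinearMap.adjoint T with hT'
  have hb : ∀ q, HasSum (fun i => ‖inner ℂ (onb H i) (v q)‖ ^ 2 +
      ‖inner ℂ (onb H i) (T' (v q))‖ ^ 2) (‖v q‖ ^ 2 + ‖T' (v q)‖ ^ 2) := fun q =>
    (hasSum_sq_coeff (v q)).add (hasSum_sq_coeff (T' (v q)))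
  refine hasSum_integral_of_dominated_convergence
    (fun i q => ‖inner ℂ (onb H i) (v q)‖ ^ 2 + ‖inner ℂ (onb H i) (T' (v q))‖ ^ 2)
    (fun i => Continuous.aestronglyMeasurable (by fun_prop))
    (fun i => Filter.Eventually.of_forall fun q => ?_)
    (Filter.Eventually.of_forall fun q => (hb q).summable) ?_
    (Filter.Eventually.of_forall fun q => ?_)
  · rw [norm_mul, ← ContinuousLinearMap.adjoint_inner_left, ← hT', norm_inner_symm (T' (v q))]
    nlinarith [sq_nonneg (‖inner ℂ (onb H i) (v q)‖ - ‖inner ℂ (onb H i) (T' (v q))‖),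
      sq_nonneg ‖inner ℂ (onb H i) (v q)‖, sq_nonneg ‖inner ℂ (onb H i) (T' (v q))‖]
  · simp_rw [fun q => (hb q).tsum_eq]
    refine (integrable_const (1 + ‖T'‖ ^ 2)).mono' (Continuous.aestronglyMeasurable (by fun_prop))
      (Filter.Eventually.of_forall fun q => ?_)
    rw [Real.norm_of_nonneg (by positivity), hv1]
    have := T'.le_opNorm (v q)
    rw [hv1, mul_one] at this
    nlinarith [norm_nonneg (T' (v q))]
  · have h := (onb H).hasSum_inner_mul_inner (T' (v q)) (v q)
    rw [hT', ContinuousLinearMap.adjoint_inner_left] at h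
    simp only [ContinuousLinearMap.adjoint_inner_left] at h
    simpa only [mul_comm] using h

/-- Mixtures of vector states are states. -/
lemma exists_state_trace_eq_integral [TopologicalSpace.SeparableSpace H] (hv : Continuous v)
    (hv1 : ∀ q, ‖v q‖ = 1) :
    ∃ ρ : DensityOperator H, ∀ T : H →L[ℂ] H,
      trace (ρ.op * T) = ∫ q, inner ℂ (v q) (T (v q)) ∂μ := by
  refine ⟨⟨mixtureOp μ v, isPositive_mixtureOp μ hv hv1, ?_⟩, fun T => ?_⟩
  · have h := hasSum_mixtureOp μ hv hv1 1
    have h1 : ∫ q, inner ℂ (v q) ((1 : H →L[ℂ] H) (v q)) ∂μ = 1 := by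
      simp [hv1]
    rwa [h1] at h
  · exact (hasSum_mixtureOp μ hv hv1 T).tsum_eq

end Mixture

/-! ### Existence of Gaussian states -/

section Existence

variable {n : ℕ}

lemma translation_translation_comm (x y : V n) (ψ : L2 n) :
    translation x (translation y ψ) = translation y (translation x ψ) := by
  refine Lp.ext ?_
  filter_upwards [coeFn_translation x (translation y ψ), coeFn_translation y (translation x ψ),
    (quasiMeasurePreserving_sub_right' x).ae (coeFn_translation y ψ),
    (quasiMeasurePreserving_sub_right' y).ae (coeFn_translation x ψ)] with z a b c d
  rw [a, b, c, d, sub_right_comm]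

lemma inner_translation_translation (x : V n) (f g : L2 n) :
    inner ℂ (translation x f) (translation x g) = inner ℂ f g :=
  (Lp.compMeasurePreservingₗᵢ ℂ (fun y : V n => y - x)
    (measurePreserving_sub_right volume x)).inner_map_map f g

lemma norm_translation (x : V n) (f : L2 n) : ‖translation x f‖ = ‖f‖ :=
  (Lp.compMeasurePreservingₗᵢ ℂ (fun y : V n => y - x)
    (measurePreserving_sub_right volume x)).norm_map f

lemma continuous_translation (f : L2 n) : Continuous fun x : V n => translation x f := by
  have hc : Continuous fun z : V n × V n => z.2 - z.1 := by fun_prop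
  exact Continuous.compMeasurePreservingLp (μ := (volume : Measure (V n)))
    (ν := (volume : Measure (V n))) (p := 2) (f := fun _ : V n => f)
    (g := fun x => (ContinuousMap.curry ⟨_, hc⟩) x) continuous_const
    (ContinuousMap.curry ⟨_, hc⟩).continuous
    (fun x => measurePreserving_sub_right volume x) (by simp)

/-- Displacing the position by `q` multiplies the expectation of the Weyl operators by a phase. -/
lemma inner_translation_weyl {hbar : ℝ} (hbar0 : hbar ≠ 0) (q k l : V n) (ψ : L2 n) :
    inner ℂ (translation q ψ) (weyl hbar (-(hbar • l)) (hbar • k) (translation q ψ)) =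
      Complex.exp ((inner ℝ q k : ℝ) * Complex.I) *
        inner ℂ ψ (weyl hbar (-(hbar • l)) (hbar • k) ψ) := by
  rw [weyl_apply, weyl_apply, smul_smul, inv_mul_cancel₀ hbar0, one_smul,
    translation_translation_comm]
  have h := translation_phaseOp q k (translation (-(hbar • l)) ψ)
  have h2 : phaseOp k (translation q (translation (-(hbar • l)) ψ)) =
      Complex.exp ((inner ℝ q k : ℝ) * Complex.I) •
        translation q (phaseOp k (translation (-(hbar • l)) ψ)) := by
    rw [h, smul_smul, ← Complex.exp_add, real_inner_comm k q, mul_comm Complex.I,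
      add_neg_cancel, Complex.exp_zero, one_smul]
  rw [h2, inner_smul_right, inner_smul_right, inner_smul_right, inner_translation_translation]
  ring

lemma memLp_gaussian {c : ℝ} (hc : 0 < c) :
    MemLp (fun y : V n => Complex.exp (-(c : ℂ) * (‖y‖ : ℂ) ^ 2)) 2 volume := by
  have hm : AEStronglyMeasurable (fun y : V n => Complex.exp (-(c : ℂ) * (‖y‖ : ℂ) ^ 2))
    volume := Continuous.aestronglyMeasurable (by fun_prop)
  rw [memLp_two_iff_integrable_sq_norm hm]
  have h := (GaussianFourier.integrable_cexp_neg_mul_sq_norm_add (V := V n)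
    (b := ((2 * c : ℝ) : ℂ)) (by rw [Complex.ofReal_re]; positivity) 0 0).norm
  refine h.congr (Filter.Eventually.of_forall fun y => ?_)
  simp only
  rw [← Complex.ofReal_neg, ← Complex.ofReal_neg, ← Complex.ofReal_pow, ← Complex.ofReal_mul,
    ← Complex.ofReal_mul, zero_mul, add_zero, ← Complex.ofReal_exp, ← Complex.ofReal_exp,
    Complex.norm_real, Complex.norm_real, Real.norm_of_nonneg (Real.exp_nonneg _),
    Real.norm_of_nonneg (Real.exp_nonneg _), ← Real.exp_nat_mul]
  congr 1
  push_cast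
  ring

/-- The (unnormalized) Gaussian wave function `exp(-‖y‖² / (4α))`. -/
def gaussianVec (n : ℕ) {α : ℝ} (hα : 0 < α) : L2 n :=
  (memLp_gaussian (n := n) (c := 1 / (4 * α)) (by positivity)).toLp _

lemma inner_gaussianVec_weyl {hbar α : ℝ} (hbar0 : hbar ≠ 0) (hα : 0 < α) (k l : V n) :
    inner ℂ (gaussianVec n hα) (weyl hbar (-(hbar • l)) (hbar • k) (gaussianVec n hα)) =
      (Real.pi / ((1 / (2 * α) : ℝ) : ℂ)) ^ ((n : ℂ) / 2) *
        Complex.exp (-((1 / 2 * (α * ‖k‖ ^ 2 + hbar ^ 2 / (4 * α) * ‖l‖ ^ 2) : ℝ) : ℂ)) := by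
  set G : V n → ℂ := fun y => Complex.exp (-((1 / (4 * α) : ℝ) : ℂ) * (‖y‖ : ℂ) ^ 2) with hG
  have hGc : gaussianVec n hα =ᵐ[volume] G := MemLp.coeFn_toLp _
  set z := -(hbar • l) with hz
  have h1 : inner ℂ (gaussianVec n hα) (phaseOp k (translation z (gaussianVec n hα))) =
      ∫ y, Complex.exp (Complex.I * ((inner ℝ k y : ℝ) : ℂ)) * (G y * G (y - z)) := by
    rw [L2.inner_def]
    refine integral_congr_ae ?_
    filter_upwards [hGc, coeFn_phaseOp k (translation z (gaussianVec n hα)),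
      coeFn_translation z (gaussianVec n hα), (quasiMeasurePreserving_sub_right' z).ae hGc]
      with y a b c d
    rw [a, b, c, d, RCLike.inner_apply]
    have : starRingEnd ℂ (G y) = G y := by
      simp only [hG]
      rw [← Complex.ofReal_neg, ← Complex.ofReal_pow, ← Complex.ofReal_mul, ← Complex.ofReal_exp,
        Complex.conj_ofReal]
    rw [this]
    ring
  -- completing the square around the midpoint `z / 2` of the two Gaussians
  have h2 : ∫ y, Complex.exp (Complex.I * ((inner ℝ k y : ℝ) : ℂ)) * (G y * G (y - z)) =
      ∫ u, Complex.exp (Complex.I * ((inner ℝ k z / 2 : ℝ) : ℂ) -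
        ((‖z‖ ^ 2 / (8 * α) : ℝ) : ℂ)) *
        Complex.exp (-((1 / (2 * α) : ℝ) : ℂ) * (‖u‖ : ℂ) ^ 2 +
          Complex.I * ((inner ℝ k u : ℝ) : ℂ)) := by
    rw [← integral_add_right_eq_self _ ((1 / 2 : ℝ) • z)]
    refine integral_congr_ae (Filter.Eventually.of_forall fun u => ?_)
    simp only [hG]
    rw [← Complex.exp_add, ← Complex.exp_add, ← Complex.exp_add]
    congr 1
    have e1 : ‖u + (1 / 2 : ℝ) • z‖ ^ 2 = ‖u‖ ^ 2 + inner ℝ u z + ‖z‖ ^ 2 / 4 := by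
      rw [norm_add_sq_real, real_inner_smul_right, norm_smul]
      norm_num
      ring
    have e2 : ‖u + (1 / 2 : ℝ) • z - z‖ ^ 2 = ‖u‖ ^ 2 - inner ℝ u z + ‖z‖ ^ 2 / 4 := by
      have : u + (1 / 2 : ℝ) • z - z = u - (1 / 2 : ℝ) • z := by module
      rw [this, norm_sub_sq_real, real_inner_smul_right, norm_smul]
      norm_num
      ring
    have e3 : inner ℝ k (u + (1 / 2 : ℝ) • z) = inner ℝ k u + inner ℝ k z / 2 := by
      rw [inner_add_right, real_inner_smul_right]
      ring
    rw [← Complex.ofReal_pow, ← Complex.ofReal_pow, ← Complex.ofReal_pow, e1, e2, e3]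
    have hα' : (α : ℂ) ≠ 0 := by exact_mod_cast hα.ne'
    push_cast
    field_simp
    ring
  have hα' : (α : ℂ) ≠ 0 := by exact_mod_cast hα.ne'
  have hb' : (hbar : ℂ) ≠ 0 := by exact_mod_cast hbar0
  rw [weyl_apply, smul_smul, inv_mul_cancel₀ hbar0, one_smul, inner_smul_right, h1, h2,
    integral_const_mul, GaussianFourier.integral_cexp_neg_mul_sq_norm_add
      (by rw [Complex.ofReal_re]; positivity), finrank_euclideanSpace_fin]
  have hexp : ∀ M a b c : ℂ, Complex.exp a * (Complex.exp b * (M * Complex.exp c)) =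
      M * Complex.exp (a + b + c) := by
    intro M a b c
    rw [Complex.exp_add, Complex.exp_add]
    ring
  rw [hexp]
  congr 2
  have e4 : ‖z‖ ^ 2 = hbar ^ 2 * ‖l‖ ^ 2 := by
    rw [hz, norm_neg, norm_smul, mul_pow, Real.norm_eq_abs, sq_abs]
  rw [e4, real_inner_smul_left, Complex.I_sq]
  push_cast
  field_simp
  ring

lemma posSemidef_Vplus_smul_one {hbar α β : ℝ} (hα : 0 < α) (h : hbar ^ 2 / 4 ≤ α * β) :
    (Vplus hbar (α • (1 : Matrix (Fin n) (Fin n) ℝ)) (β • 1) 0).PosSemidef := by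
  have hA : ((α : ℂ) • (1 : Matrix (Fin n) (Fin n) ℂ)).PosDef :=
    Matrix.PosDef.one.smul (by exact_mod_cast hα)
  have hinv : ((α : ℂ) • (1 : Matrix (Fin n) (Fin n) ℂ)) * ((α : ℂ)⁻¹ • 1) = 1 := by
    rw [smul_mul_smul_comm, mul_inv_cancel₀ (by exact_mod_cast hα.ne'), one_smul, one_mul]
  let _ : Invertible ((α : ℂ) • (1 : Matrix (Fin n) (Fin n) ℂ)) :=
    ⟨(α : ℂ)⁻¹ • 1, by rw [mul_eq_one_comm]; exact hinv, hinv⟩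
  have hS := (Matrix.PosDef.fromBlocks₁₁ ((Complex.I * hbar / 2) • (1 : Matrix (Fin n) (Fin n) ℂ))
    ((β : ℂ) • (1 : Matrix (Fin n) (Fin n) ℂ)) hA).2 (by
      rw [Matrix.inv_eq_right_inv hinv]
      have : (β : ℂ) • (1 : Matrix (Fin n) (Fin n) ℂ) -
          ((Complex.I * hbar / 2) • (1 : Matrix (Fin n) (Fin n) ℂ)).conjTranspose *
            ((α : ℂ)⁻¹ • 1) * ((Complex.I * hbar / 2) • 1) =
          ((β - hbar ^ 2 / (4 * α) : ℝ) : ℂ) • (1 : Matrix (Fin n) (Fin n) ℂ) := by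
        rw [Matrix.conjTranspose_smul, Matrix.conjTranspose_one, smul_mul_smul_comm,
          smul_mul_smul_comm, one_mul, one_mul, ← sub_smul]
        congr 1
        have hα' : (α : ℂ) ≠ 0 := by exact_mod_cast hα.ne'
        simp
        field_simp
        ring_nf
        simp
      rw [this]
      refine Matrix.PosSemidef.one.smul ?_
      have : 0 ≤ β - hbar ^ 2 / (4 * α) := by
        rw [sub_nonneg, div_le_iff₀ (by positivity)]
        linarith
      exact_mod_cast this)
  have hsm : ∀ r : ℝ, (r • (1 : Matrix (Fin n) (Fin n) ℝ)).map Complex.ofReal =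
      (r : ℂ) • (1 : Matrix (Fin n) (Fin n) ℂ) := by
    intro r
    ext i j
    by_cases hij : i = j <;> simp [hij]
  have hV : Vplus hbar (α • (1 : Matrix (Fin n) (Fin n) ℝ)) (β • 1) 0 =
      Matrix.fromBlocks ((α : ℂ) • (1 : Matrix (Fin n) (Fin n) ℂ))
        ((Complex.I * hbar / 2) • (1 : Matrix (Fin n) (Fin n) ℂ))
        ((Complex.I * hbar / 2) • (1 : Matrix (Fin n) (Fin n) ℂ)).conjTranspose
        ((β : ℂ) • (1 : Matrix (Fin n) (Fin n) ℂ)) := by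
    rw [Vplus, hsm, hsm, Matrix.conjTranspose_smul, Matrix.conjTranspose_one]
    congr 1
    · ext i j; simp
    · ext i j
      by_cases hij : i = j <;> simp [hij, neg_div]
  rw [hV]
  exact hS

/-- There are centred Gaussian states with any scalar variances that the uncertainty relation
allows: the position of a pure Gaussian state with variances `ħ² / (4β)` and `β` is displaced at
random by a Gaussian law with variance `α - ħ² / (4β)`, which does not affect the momentum. -/
lemma exists_isGaussianWith {hbar α β : ℝ} (hbar_pos : 0 < hbar) (hα : 0 < α) (hβ : 0 < β)
    (h : hbar ^ 2 / 4 ≤ α * β) : ∃ ρ : State n, IsGaussianWith hbar ρ 0 0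
      (α • (1 : Matrix (Fin n) (Fin n) ℝ)) (β • 1) 0 := by
  have := separableSpace_L2 n
  have hα₀ : 0 < hbar ^ 2 / (4 * β) := by positivity
  set α₀ := hbar ^ 2 / (4 * β) with hα₀def
  have hle : 0 ≤ α - α₀ := by
    rw [sub_nonneg, hα₀def, div_le_iff₀ (by positivity)]
    linarith
  set g := gaussianVec n hα₀ with hg
  set N : ℂ := (Real.pi / ((1 / (2 * α₀) : ℝ) : ℂ)) ^ ((n : ℂ) / 2) with hN
  have hW := fun k l : V n => inner_gaussianVec_weyl (n := n) hbar_pos.ne' hα₀ k l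
  have hNg : ((‖g‖ : ℂ)) ^ 2 = N := by
    have := hW 0 0
    rw [weyl_apply, ← hg, ← hN] at this
    simp only [smul_zero, neg_zero, translation_zero, phaseOp_zero, inner_zero_left, norm_zero,
      zero_div, Complex.ofReal_zero, mul_zero, Complex.exp_zero, one_smul, add_zero, mul_one,
      ne_eq, OfNat.ofNat_ne_zero, not_false_eq_true, zero_pow] at this
    rw [← this]
    exact (inner_self_eq_norm_sq_to_K g).symm
  have hN0 : N ≠ 0 := by
    rw [hN, Complex.cpow_ne_zero_iff]
    left
    have : (Real.pi : ℂ) ≠ 0 := by exact_mod_cast Real.pi_ne_zero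
    refine div_ne_zero this ?_
    have : (1 / (2 * α₀) : ℝ) ≠ 0 := by positivity
    exact_mod_cast this
  have hg0 : ‖g‖ ≠ 0 := by
    intro h0
    rw [h0] at hNg
    simp at hNg
    exact hN0 hNg.symm
  set v₀ : L2 n := ((‖g‖⁻¹ : ℝ) : ℂ) • g with hv₀
  have hv₀1 : ‖v₀‖ = 1 := by
    rw [hv₀, norm_smul, Complex.norm_real, norm_inv, norm_norm, inv_mul_cancel₀ hg0]
  have hv₀W : ∀ k l : V n, inner ℂ v₀ (weyl hbar (-(hbar • l)) (hbar • k) v₀) =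
      Complex.exp (-((1 / 2 * (α₀ * ‖k‖ ^ 2 + β * ‖l‖ ^ 2) : ℝ) : ℂ)) := by
    intro k l
    have hβ' : hbar ^ 2 / (4 * α₀) = β := by
      rw [hα₀def]; field_simp
    rw [hv₀, map_smul, inner_smul_left, inner_smul_right, hW, hβ', Complex.conj_ofReal,
      ← mul_assoc, ← mul_assoc, ← hN, ← hNg]
    have : (‖g‖ : ℂ) ≠ 0 := by exact_mod_cast hg0
    push_cast
    field_simp
  set μ : Measure (V n) := (ProbabilityTheory.stdGaussian (V n)).map (√(α - α₀) • ·) with hμ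
  have : IsProbabilityMeasure μ :=
    Measure.isProbabilityMeasure_map (measurable_const_smul _).aemeasurable
  obtain ⟨ρ, hρ⟩ := exists_state_trace_eq_integral μ (v := fun q => translation q v₀)
    (continuous_translation v₀) (fun q => by rw [norm_translation, hv₀1])
  refine ⟨ρ, posSemidef_Vplus_smul_one hα h, fun k l => ?_⟩
  have hchar : ∫ q, Complex.exp ((inner ℝ q k : ℝ) * Complex.I) ∂μ =
      Complex.exp (-((1 / 2 * ((α - α₀) * ‖k‖ ^ 2) : ℝ) : ℂ)) := by
    rw [← charFun_apply, hμ, charFun_map_smul, ProbabilityTheory.charFun_stdGaussian]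
    congr 1
    rw [norm_smul, Real.norm_of_nonneg (Real.sqrt_nonneg _), ← Complex.ofReal_pow, mul_pow,
      Real.sq_sqrt hle]
    push_cast
    ring
  have hdot : ∀ w : V n, w.ofLp ⬝ᵥ w.ofLp = ‖w‖ ^ 2 := by
    intro w
    rw [← real_inner_self_eq_norm_sq, EuclideanSpace.inner_eq_star_dotProduct]
    simp
  rw [charFn, hρ]
  simp_rw [inner_translation_weyl hbar_pos.ne']
  rw [integral_mul_const, hchar, hv₀W, ← Complex.exp_add]
  congr 1
  simp only [Matrix.smul_mulVec, Matrix.one_mulVec, Matrix.zero_mulVec, dotProduct_smul,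
    smul_eq_mul, hdot, dotProduct_zero, inner_zero_right]
  push_cast
  ring

end Existence

/-! ### The error function of Gaussian states -/

section ErrorFunction

variable {n : ℕ} {hbar : ℝ}

lemma isProbabilityMeasure_position_dist (ρ : State n) :
    IsProbabilityMeasure ((position n).dist ρ) := by
  have := separableSpace_L2 n
  obtain ⟨ι, ψ, hψ⟩ := exists_isDecomposition ρ
  have := hψ.countable
  rw [position_dist_eq hψ]
  exact isProbabilityMeasure_densMeasure hψ.hasSum_norm

lemma isProbabilityMeasure_momentum_dist (hbar : ℝ) (ρ : State n) :
    IsProbabilityMeasure ((momentum n hbar).dist ρ) := by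
  have := separableSpace_L2 n
  obtain ⟨ι, ψ, hψ⟩ := exists_isDecomposition ρ
  have := hψ.countable
  rw [momentum_dist_eq hbar hψ]
  have := isProbabilityMeasure_densMeasure (hasSum_norm_fourierOp hψ.hasSum_norm)
  exact Measure.isProbabilityMeasure_map (measurable_const_smul _).aemeasurable

lemma charFun_position_dist (hbar0 : hbar ≠ 0) (ρ : State n) (k : V n) :
    charFun ((position n).dist ρ) k = charFn hbar ρ k 0 := by
  have := separableSpace_L2 n
  obtain ⟨ι, ψ, hψ⟩ := exists_isDecomposition ρ
  rw [position_dist_eq hψ, charFun_densMeasure hbar0 hψ]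

lemma charFun_momentum_dist (ρ : State n) (l : V n) :
    charFun ((momentum n hbar).dist ρ) l = charFn hbar ρ 0 l := by
  have := separableSpace_L2 n
  obtain ⟨ι, ψ, hψ⟩ := exists_isDecomposition ρ
  rw [momentum_dist_eq hbar hψ, charFun_map_smul, charFun_densMeasure_fourierOp hψ]

/-- The approximate position measurement adds an independent noise with the position distribution
of `σ`. -/
lemma phaseSpaceDist_map_fst_eq_conv (hbar_pos : 0 < hbar) (ρ σ : State n) :
    (phaseSpaceDist hbar σ ρ).map Prod.fst = (position n).dist ρ ∗ (position n).dist σ := by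
  have := separableSpace_L2 n
  obtain ⟨ι, ψ, hψ⟩ := exists_isDecomposition ρ
  obtain ⟨κ, φ, hφ⟩ := exists_isDecomposition σ
  rw [phaseSpaceDist_map_fst hbar_pos hψ hφ, position_dist_eq hψ, position_dist_eq hφ]

/-- The approximate momentum measurement adds an independent noise with the momentum distribution
of `σ`. -/
lemma phaseSpaceDist_map_snd_eq_conv (hbar_pos : 0 < hbar) (ρ σ : State n) :
    (phaseSpaceDist hbar σ ρ).map Prod.snd =
      (momentum n hbar).dist ρ ∗ (momentum n hbar).dist σ := by
  have := separableSpace_L2 n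
  obtain ⟨ι, ψ, hψ⟩ := exists_isDecomposition ρ
  obtain ⟨κ, φ, hφ⟩ := exists_isDecomposition σ
  have := hψ.countable
  have := hφ.countable
  have := isProbabilityMeasure_densMeasure (hasSum_norm_fourierOp hψ.hasSum_norm)
  have := isProbabilityMeasure_densMeasure (hasSum_norm_fourierOp hφ.hasSum_norm)
  rw [phaseSpaceDist_map_snd hbar_pos hψ hφ, momentum_dist_eq hbar hψ, momentum_dist_eq hbar hφ]
  exact Measure.map_conv_addMonoidHom
    (DistribSMul.toAddMonoidHom (V n) (2 * Real.pi * hbar)) (measurable_const_smul _)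

lemma HasGaussianCharFun.conv {μ ν : Measure (V n)} [IsFiniteMeasure μ] [IsFiniteMeasure ν]
    {a b : V n} {A B : Matrix (Fin n) (Fin n) ℝ} (hμ : HasGaussianCharFun μ a A)
    (hν : HasGaussianCharFun ν b B) : HasGaussianCharFun (μ ∗ ν) (a + b) (A + B) := by
  intro t
  rw [charFun_conv, hμ, hν, ← Complex.exp_add, inner_add_right, Matrix.add_mulVec, dotProduct_add]
  congr 1
  push_cast
  ring

namespace IsGaussianWith

variable {ρ σ : State n} {a b a' b' : V n} {A B C A' B' C' : Matrix (Fin n) (Fin n) ℝ}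

lemma hasGaussianCharFun_position (hbar0 : hbar ≠ 0) (h : IsGaussianWith hbar ρ a b A B C) :
    HasGaussianCharFun ((position n).dist ρ) a A := by
  intro t
  rw [charFun_position_dist hbar0, h.charFn_eq]
  simp

lemma hasGaussianCharFun_momentum (h : IsGaussianWith hbar ρ a b A B C) :
    HasGaussianCharFun ((momentum n hbar).dist ρ) b B := by
  intro t
  rw [charFun_momentum_dist, h.charFn_eq]
  simp

/-- A Gaussian state is determined by its parameters. -/
lemma state_unique (hbar0 : hbar ≠ 0) (hρ : IsGaussianWith hbar ρ a b A B C)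
    (hσ : IsGaussianWith hbar σ a b A B C) : ρ = σ :=
  state_ext_of_charFn hbar0 fun k l => by rw [hρ.charFn_eq, hσ.charFn_eq]

end IsGaussianWith

/-- The relative entropy of a Gaussian law with respect to its convolution with another one. -/
lemma HasGaussianCharFun.relEntropy_conv {μ ν : Measure (V n)} [IsProbabilityMeasure μ]
    [IsProbabilityMeasure ν] {a a' : V n} {A A' : Matrix (Fin n) (Fin n) ℝ}
    (hμ : HasGaussianCharFun μ a A) (hν : HasGaussianCharFun ν a' A')
    (e : OrthonormalBasis (Fin n) ℝ (V n)) {v v' : Fin n → ℝ} (hv : ∀ i, 0 < v i)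
    (hv' : ∀ i, 0 < v' i) (hA : ∀ i, A.mulVec (e i).ofLp = v i • (e i).ofLp)
    (hA' : ∀ i, A'.mulVec (e i).ofLp = v' i • (e i).ofLp) :
    relEntropy μ (μ ∗ ν) = ENNReal.ofReal ((2 * Real.log 2)⁻¹ *
      ∑ i, (gaussGap (v' i / v i) + inner ℝ (e i) a' ^ 2 / (v i + v' i))) := by
  have hlog : 0 < Real.log 2 := Real.log_pos (by norm_num)
  have hnn : ∀ i, 0 ≤ gaussGap (v' i / v i) + inner ℝ (e i) a' ^ 2 / (v i + v' i) := fun i => by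
    have := gaussGap_nonneg (div_pos (hv' i) (hv i)).le
    have := hv i
    have := hv' i
    positivity
  rw [relEntropy, hμ.klDiv_eq (hμ.conv hν) e hv (fun i => add_pos (hv i) (hv' i)) hA (fun i => by
    rw [Matrix.add_mulVec, hA, hA', add_smul])]
  have hterm : ∀ i, 2⁻¹ * (v i / (v i + v' i) - 1 - Real.log (v i / (v i + v' i)) +
      inner ℝ (e i) (a - (a + a')) ^ 2 / (v i + v' i)) =
      2⁻¹ * (gaussGap (v' i / v i) + inner ℝ (e i) a' ^ 2 / (v i + v' i)) := by
    intro i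
    have h1 := hv i
    have h2 := hv' i
    have e1 : 1 + v' i / v i = (v i / (v i + v' i))⁻¹ := by field_simp
    have e2 : a - (a + a') = -a' := by abel
    rw [e2, inner_neg_right, neg_sq, gaussGap, e1, Real.log_inv]
    congr 2
    field_simp
    ring
  simp_rw [hterm]
  rw [← ENNReal.ofReal_sum_of_nonneg fun i _ => mul_nonneg (by norm_num) (hnn i),
    ← Finset.mul_sum, ← ENNReal.ofReal_div_of_pos hlog]
  congr 1
  field_simp

namespace IsGaussianWith

variable {ρ σ : State n} {a b a' b' : V n} {A B C A' B' C' : Matrix (Fin n) (Fin n) ℝ}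

/-- The error function of two Gaussian states whose position variance matrices have a common
eigenbasis `e`, and whose momentum variance matrices have a common eigenbasis `f`. -/
lemma errorFn_eq (hbar_pos : 0 < hbar) (hρ : IsGaussianWith hbar ρ a b A B C)
    (hσ : IsGaussianWith hbar σ a' b' A' B' C') (e f : OrthonormalBasis (Fin n) ℝ (V n))
    {v v' w w' : Fin n → ℝ} (hv : ∀ i, 0 < v i) (hv' : ∀ i, 0 < v' i) (hw : ∀ i, 0 < w i)
    (hw' : ∀ i, 0 < w' i) (hA : ∀ i, A.mulVec (e i).ofLp = v i • (e i).ofLp)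
    (hA' : ∀ i, A'.mulVec (e i).ofLp = v' i • (e i).ofLp)
    (hB : ∀ i, B.mulVec (f i).ofLp = w i • (f i).ofLp)
    (hB' : ∀ i, B'.mulVec (f i).ofLp = w' i • (f i).ofLp) :
    errorFn hbar ρ σ = ENNReal.ofReal ((2 * Real.log 2)⁻¹ *
      (∑ i, (gaussGap (v' i / v i) + inner ℝ (e i) a' ^ 2 / (v i + v' i)) +
        ∑ i, (gaussGap (w' i / w i) + inner ℝ (f i) b' ^ 2 / (w i + w' i)))) := by
  have := isProbabilityMeasure_position_dist ρ
  have := isProbabilityMeasure_position_dist σ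
  have := isProbabilityMeasure_momentum_dist hbar ρ
  have := isProbabilityMeasure_momentum_dist hbar σ
  have hlog : 0 < Real.log 2 := Real.log_pos (by norm_num)
  have hnn : ∀ (v v' : Fin n → ℝ) (e : OrthonormalBasis (Fin n) ℝ (V n)) (a' : V n),
      (∀ i, 0 < v i) → (∀ i, 0 < v' i) →
      0 ≤ ∑ i, (gaussGap (v' i / v i) + inner ℝ (e i) a' ^ 2 / (v i + v' i)) := by
    intro v v' e a' hv hv'
    refine Finset.sum_nonneg fun i _ => ?_
    have := gaussGap_nonneg (div_pos (hv' i) (hv i)).le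
    have := hv i
    have := hv' i
    positivity
  rw [errorFn, phaseSpaceDist_map_fst_eq_conv hbar_pos, phaseSpaceDist_map_snd_eq_conv hbar_pos,
    (hρ.hasGaussianCharFun_position hbar_pos.ne').relEntropy_conv
      (hσ.hasGaussianCharFun_position hbar_pos.ne') e hv hv' hA hA',
    hρ.hasGaussianCharFun_momentum.relEntropy_conv hσ.hasGaussianCharFun_momentum f hw hw' hB hB',
    ← ENNReal.ofReal_add (mul_nonneg (by positivity) (hnn v v' e a' hv hv'))
      (mul_nonneg (by positivity) (hnn w w' f b' hw hw')), mul_add]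

end IsGaussianWith

lemma exists_eigenbasis {A : Matrix (Fin n) (Fin n) ℝ} (hA : A.IsHermitian)
    (hpos : ∀ k : Fin n → ℝ, k ≠ 0 → 0 < k ⬝ᵥ A.mulVec k) :
    ∃ (e : OrthonormalBasis (Fin n) ℝ (V n)) (v : Fin n → ℝ), (∀ i, 0 < v i) ∧
      ∀ i, A.mulVec (e i).ofLp = v i • (e i).ofLp := by
  refine ⟨hA.eigenvectorBasis, hA.eigenvalues, fun i => ?_, fun i => hA.mulVec_eigenvectorBasis i⟩
  have h0 : (hA.eigenvectorBasis i).ofLp ≠ 0 := by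
    have := hA.eigenvectorBasis.orthonormal.ne_zero i
    simpa using this
  have h := hpos _ h0
  rw [hA.mulVec_eigenvectorBasis i, dotProduct_smul, smul_eq_mul] at h
  have h2 : 0 ≤ (hA.eigenvectorBasis i).ofLp ⬝ᵥ (hA.eigenvectorBasis i).ofLp :=
    Finset.sum_nonneg fun j _ => mul_self_nonneg _
  exact pos_of_mul_pos_left h h2

lemma le_eigenvalue {A : Matrix (Fin n) (Fin n) ℝ} {ε v : ℝ}
    (h : (A - ε • (1 : Matrix (Fin n) (Fin n) ℝ)).PosSemidef) {x : V n} (hx : ‖x‖ = 1)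
    (hA : A.mulVec x.ofLp = v • x.ofLp) : ε ≤ v := by
  have h1 := h.dotProduct_mulVec_nonneg x.ofLp
  have h2 : x.ofLp ⬝ᵥ x.ofLp = 1 := by
    have : inner ℝ x x = 1 := by rw [real_inner_self_eq_norm_sq, hx, one_pow]
    rw [EuclideanSpace.inner_eq_star_dotProduct] at this
    simpa using this
  rw [Matrix.sub_mulVec, hA, Matrix.smul_mulVec, Matrix.one_mulVec, ← sub_smul, dotProduct_smul,
    star_trivial, h2, smul_eq_mul, mul_one] at h1
  linarith

lemma eq_smul_one_of_mulVec_basis {A : Matrix (Fin n) (Fin n) ℝ} {c : ℝ}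
    (e : OrthonormalBasis (Fin n) ℝ (V n)) (h : ∀ i, A.mulVec (e i).ofLp = c • (e i).ofLp) :
    A = c • (1 : Matrix (Fin n) (Fin n) ℝ) := by
  have h1 : Matrix.toLpLin 2 2 A = Matrix.toLpLin 2 2 (c • (1 : Matrix (Fin n) (Fin n) ℝ)) := by
    refine e.toBasis.ext fun i => ?_
    simp only [OrthonormalBasis.coe_toBasis, Matrix.toLpLin_apply, h, Matrix.smul_mulVec,
      Matrix.one_mulVec]
  exact (Matrix.toLpLin 2 2).injective h1

lemma smul_one_mulVec_eq (c : ℝ) (x : Fin n → ℝ) :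
    (c • (1 : Matrix (Fin n) (Fin n) ℝ)).mulVec x = c • x := by
  rw [Matrix.smul_mulVec, Matrix.one_mulVec]

lemma logb_two_exp_one : Real.logb 2 (Real.exp 1) = (Real.log 2)⁻¹ := by
  rw [Real.logb, Real.log_exp, one_div]

namespace IsGaussianWith

variable {ρ σ : State n} {a b a' b' : V n} {A B C A' B' C' : Matrix (Fin n) (Fin n) ℝ}

/-- For the noise of a centred Gaussian state with variances `c ε₁ 1` and `c ε₂ 1`, the error is
largest at the smallest variances that are admitted. -/
lemma errorFn_le (hbar_pos : 0 < hbar) {c ε₁ ε₂ : ℝ} (hc : 0 < c) (h1 : 0 < ε₁) (h2 : 0 < ε₂)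
    (hσ : IsGaussianWith hbar σ 0 0 ((c * ε₁) • (1 : Matrix (Fin n) (Fin n) ℝ))
      ((c * ε₂) • (1 : Matrix (Fin n) (Fin n) ℝ)) 0)
    (hρ : ρ ∈ gaussianStatesGE n hbar ε₁ ε₂) :
    errorFn hbar ρ σ ≤ ENNReal.ofReal (n * Real.logb 2 (Real.exp 1) * gaussGap c) := by
  obtain ⟨a, b, A, B, C, hρ, hA, hB⟩ := hρ
  have hlog : 0 < Real.log 2 := Real.log_pos (by norm_num)
  obtain ⟨e, v, hv, he⟩ := exists_eigenbasis (isHermitian_left_of_Vplus hρ.posSemidef)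
    (fun k hk => quadForm_left_pos_of_Vplus hbar_pos hρ.posSemidef hk)
  obtain ⟨f, w, hw, hf⟩ := exists_eigenbasis (isHermitian_right_of_Vplus hρ.posSemidef)
    (fun k hk => quadForm_right_pos_of_Vplus hbar_pos hρ.posSemidef hk)
  rw [hρ.errorFn_eq hbar_pos hσ e f (v' := fun _ => c * ε₁) (w' := fun _ => c * ε₂) hv
    (fun _ => by positivity) hw (fun _ => by positivity) he (fun i => smul_one_mulVec_eq _ _) hf
    (fun i => smul_one_mulVec_eq _ _), logb_two_exp_one]
  refine ENNReal.ofReal_le_ofReal ?_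
  have hle : ∀ {ε x : ℝ}, 0 < ε → ε ≤ x → gaussGap (c * ε / x) ≤ gaussGap c := by
    intro ε x hε hx
    have hx0 : 0 < x := hε.trans_le hx
    refine gaussGap_le_gaussGap (by positivity) ?_
    rw [div_le_iff₀ hx0]
    gcongr
  have s1 : ∑ i, gaussGap (c * ε₁ / v i) ≤ n * gaussGap c := by
    refine (Finset.sum_le_sum fun i _ =>
      hle h1 (le_eigenvalue hA (e.orthonormal.norm_eq_one i) (he i))).trans_eq ?_
    simp
  have s2 : ∑ i, gaussGap (c * ε₂ / w i) ≤ n * gaussGap c := by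
    refine (Finset.sum_le_sum fun i _ =>
      hle h2 (le_eigenvalue hB (f.orthonormal.norm_eq_one i) (hf i))).trans_eq ?_
    simp
  simp only [inner_zero_right, ne_eq, OfNat.ofNat_ne_zero, not_false_eq_true, zero_pow, zero_div,
    add_zero]
  calc (2 * Real.log 2)⁻¹ * (∑ i, gaussGap (c * ε₁ / v i) + ∑ i, gaussGap (c * ε₂ / w i))
      ≤ (2 * Real.log 2)⁻¹ * (n * gaussGap c + n * gaussGap c) := by gcongr
    _ = n * (Real.log 2)⁻¹ * gaussGap c := by field_simp; ring

/-- No Gaussian noise disturbs a Gaussian state with variances `ε₁ 1` and `ε₂ 1` less than the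
centred one whose variances are proportional to those of the state, with the smallest factor
that the uncertainty relation allows, and this optimal noise is unique. -/
lemma le_errorFn (hbar_pos : 0 < hbar) {ε₁ ε₂ : ℝ} (h1 : 0 < ε₁) (h2 : 0 < ε₂)
    (hρ : IsGaussianWith hbar ρ a b (ε₁ • (1 : Matrix (Fin n) (Fin n) ℝ))
      (ε₂ • (1 : Matrix (Fin n) (Fin n) ℝ)) C)
    (hσ : σ ∈ gaussianStates n hbar) :
    ENNReal.ofReal (n * Real.logb 2 (Real.exp 1) * gaussGap (hbar / (2 * √(ε₁ * ε₂)))) ≤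
        errorFn hbar ρ σ ∧
      (errorFn hbar ρ σ ≤ ENNReal.ofReal (n * Real.logb 2 (Real.exp 1) *
          gaussGap (hbar / (2 * √(ε₁ * ε₂)))) →
        IsGaussianWith hbar σ 0 0
          ((hbar / (2 * √(ε₁ * ε₂)) * ε₁) • (1 : Matrix (Fin n) (Fin n) ℝ))
          ((hbar / (2 * √(ε₁ * ε₂)) * ε₂) • (1 : Matrix (Fin n) (Fin n) ℝ)) 0) := by
  obtain ⟨a', b', A', B', C', hσ⟩ := hσ
  have hlog : 0 < Real.log 2 := Real.log_pos (by norm_num)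
  obtain ⟨e, v, hv, he⟩ := exists_eigenbasis (isHermitian_left_of_Vplus hσ.posSemidef)
    (fun k hk => quadForm_left_pos_of_Vplus hbar_pos hσ.posSemidef hk)
  obtain ⟨f, w, hw, hf⟩ := exists_eigenbasis (isHermitian_right_of_Vplus hσ.posSemidef)
    (fun k hk => quadForm_right_pos_of_Vplus hbar_pos hσ.posSemidef hk)
  obtain ⟨hge, heq⟩ := sum_gaussGap_ge hbar_pos h1 h2 hv hw
    (sum_log_eigenvalues_ge hbar_pos hσ.posSemidef e f hv he hf)
  have hc0 : 0 < hbar / (2 * √(ε₁ * ε₂)) := by positivity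
  have hcc : (hbar / (2 * √(ε₁ * ε₂)) * ε₁) * (hbar / (2 * √(ε₁ * ε₂)) * ε₂) = hbar ^ 2 / 4 := by
    have : √(ε₁ * ε₂) ^ 2 = ε₁ * ε₂ := Real.sq_sqrt (by positivity)
    field_simp
    rw [this]
    ring
  set c := hbar / (2 * √(ε₁ * ε₂)) with hc
  rw [hρ.errorFn_eq hbar_pos hσ e f (v := fun _ => ε₁) (w := fun _ => ε₂) (fun _ => h1) hv
    (fun _ => h2) hw (fun i => smul_one_mulVec_eq _ _) he (fun i => smul_one_mulVec_eq _ _) hf,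
    logb_two_exp_one, Finset.sum_add_distrib, Finset.sum_add_distrib]
  have t1 : ∀ i, 0 ≤ inner ℝ (e i) a' ^ 2 / (ε₁ + v i) := fun i => by
    have := hv i
    positivity
  have t2 : ∀ i, 0 ≤ inner ℝ (f i) b' ^ 2 / (ε₂ + w i) := fun i => by
    have := hw i
    positivity
  have T1 := Finset.sum_nonneg fun i (_ : i ∈ Finset.univ) => t1 i
  have T2 := Finset.sum_nonneg fun i (_ : i ∈ Finset.univ) => t2 i
  have hval : n * (Real.log 2)⁻¹ * gaussGap c = (2 * Real.log 2)⁻¹ * (2 * n * gaussGap c) := by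
    field_simp
  have hg0 := gaussGap_nonneg hc0.le
  rw [hval]
  refine ⟨ENNReal.ofReal_le_ofReal (mul_le_mul_of_nonneg_left (by linarith) (by positivity)),
    fun hle => ?_⟩
  rw [ENNReal.ofReal_le_ofReal_iff (by positivity)] at hle
  have hle' := le_of_mul_le_mul_left hle (by positivity)
  obtain ⟨hv_eq, hw_eq⟩ := heq (by linarith)
  have z1 := (Finset.sum_eq_zero_iff_of_nonneg fun i (_ : i ∈ Finset.univ) => t1 i).1
    (le_antisymm (by linarith) T1)
  have z2 := (Finset.sum_eq_zero_iff_of_nonneg fun i (_ : i ∈ Finset.univ) => t2 i).1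
    (le_antisymm (by linarith) T2)
  have ha : a' = 0 := by
    rw [← e.sum_repr' a']
    refine Finset.sum_eq_zero fun i _ => ?_
    have h := z1 i (Finset.mem_univ i)
    have := hv i
    rw [div_eq_zero_iff, or_iff_left (by positivity), sq_eq_zero_iff] at h
    rw [h, zero_smul]
  have hb : b' = 0 := by
    rw [← f.sum_repr' b']
    refine Finset.sum_eq_zero fun i _ => ?_
    have h := z2 i (Finset.mem_univ i)
    have := hw i
    rw [div_eq_zero_iff, or_iff_left (by positivity), sq_eq_zero_iff] at h
    rw [h, zero_smul]
  have hA := eq_smul_one_of_mulVec_basis e (fun i => by rw [he, hv_eq])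
  have hB := eq_smul_one_of_mulVec_basis f (fun i => by rw [hf, hw_eq])
  subst ha hb hA hB
  have hC := covariance_eq_zero_of_Vplus (by positivity) hcc hσ.posSemidef
  subst hC
  exact hσ

lemma mem_gaussianStatesGE {ε₁ ε₂ α β : ℝ} (hα : ε₁ ≤ α) (hβ : ε₂ ≤ β)
    (hρ : IsGaussianWith hbar ρ a b (α • (1 : Matrix (Fin n) (Fin n) ℝ))
      (β • (1 : Matrix (Fin n) (Fin n) ℝ)) C) : ρ ∈ gaussianStatesGE n hbar ε₁ ε₂ := by
  refine ⟨a, b, _, _, C, hρ, ?_, ?_⟩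
  · rw [← sub_smul]
    exact Matrix.PosSemidef.one.smul (sub_nonneg.2 hα)
  · rw [← sub_smul]
    exact Matrix.PosSemidef.one.smul (sub_nonneg.2 hβ)

end IsGaussianWith

lemma gaussGap_one : gaussGap 1 = Real.log 2 - 1 / 2 := by
  norm_num [gaussGap]

lemma gaussGap_div {x y : ℝ} (hx : 0 < x) (hy : 0 < y) :
    gaussGap (x / y) = Real.log (1 + x / y) - x / (y + x) := by
  rw [gaussGap]
  congr 1
  field_simp

end ErrorFunction

end QGauss

end

theorem mainTheorem1 (n : ℕ) (hn : 0 < n) (hbar ε₁ ε₂ : ℝ)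
    (hbar_pos : 0 < hbar) (hε₁ : 0 < ε₁) (hε₂ : 0 < ε₂) :
    -- part (i)
    (hbar ^ 2 / 4 ≤ ε₁ * ε₂ →
      QGauss.incompatibilityDegree n hbar ε₁ ε₂ =
        ENNReal.ofReal (n * Real.logb 2 (Real.exp 1) *
          (Real.log (1 + hbar / (2 * √(ε₁ * ε₂))) - hbar / (2 * √(ε₁ * ε₂) + hbar))) ∧
      ∃ σ : QGauss.State n,
        QGauss.IsGaussianWith hbar σ 0 0
          ((hbar / 2 * √(ε₁ / ε₂)) • (1 : Matrix (Fin n) (Fin n) ℝ))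
          ((hbar / 2 * √(ε₂ / ε₁)) • (1 : Matrix (Fin n) (Fin n) ℝ)) 0 ∧
        QGauss.IsMinimumUncertainty hbar σ ∧
        QGauss.incompatibilityDegree n hbar ε₁ ε₂ = QGauss.divergence hbar ε₁ ε₂ σ ∧
        ∀ σ' ∈ QGauss.gaussianStates n hbar,
          QGauss.incompatibilityDegree n hbar ε₁ ε₂ = QGauss.divergence hbar ε₁ ε₂ σ' →
            σ' = σ) ∧
    -- part (ii)
    (ε₁ * ε₂ < hbar ^ 2 / 4 →
      ENNReal.ofReal (n * Real.logb 2 (Real.exp 1) * (Real.log 2 - 1 / 2)) ≤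
        QGauss.incompatibilityDegree n hbar ε₁ ε₂ ∧
      ∃ σ : QGauss.State n,
        QGauss.IsGaussianWith hbar σ 0 0 (ε₁ • (1 : Matrix (Fin n) (Fin n) ℝ))
          ((hbar ^ 2 / (4 * ε₁)) • (1 : Matrix (Fin n) (Fin n) ℝ)) 0 ∧
        (∀ σ' : QGauss.State n,
          QGauss.IsGaussianWith hbar σ' 0 0 (ε₁ • (1 : Matrix (Fin n) (Fin n) ℝ))
            ((hbar ^ 2 / (4 * ε₁)) • (1 : Matrix (Fin n) (Fin n) ℝ)) 0 → σ' = σ) ∧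
        ∀ (ρ : QGauss.State n) (a b : QGauss.V n) (C : Matrix (Fin n) (Fin n) ℝ),
          QGauss.IsGaussianWith hbar ρ a b (ε₁ • (1 : Matrix (Fin n) (Fin n) ℝ))
            ((hbar ^ 2 / (4 * ε₁)) • (1 : Matrix (Fin n) (Fin n) ℝ)) C →
          ρ ∈ QGauss.gaussianStatesGE n hbar ε₁ ε₂ ∧
          ENNReal.ofReal (n * Real.logb 2 (Real.exp 1) * (Real.log 2 - 1 / 2)) =
              QGauss.errorFn hbar ρ σ ∧
            QGauss.errorFn hbar ρ σ =
              ⨅ τ ∈ QGauss.gaussianStates n hbar, QGauss.errorFn hbar ρ τ) ∧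
    -- the state independent measurement uncertainty relation
    ((∃ ρ : QGauss.State n, ∃ (a b : QGauss.V n) (C : Matrix (Fin n) (Fin n) ℝ),
        QGauss.IsGaussianWith hbar ρ a b (ε₁ • (1 : Matrix (Fin n) (Fin n) ℝ))
          ((if hbar ^ 2 / 4 ≤ ε₁ * ε₂ then ε₂ else hbar ^ 2 / (4 * ε₁)) •
            (1 : Matrix (Fin n) (Fin n) ℝ)) C) ∧
      ∀ (ρ : QGauss.State n) (a b : QGauss.V n) (C : Matrix (Fin n) (Fin n) ℝ),
        QGauss.IsGaussianWith hbar ρ a b (ε₁ • (1 : Matrix (Fin n) (Fin n) ℝ))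
          ((if hbar ^ 2 / 4 ≤ ε₁ * ε₂ then ε₂ else hbar ^ 2 / (4 * ε₁)) •
            (1 : Matrix (Fin n) (Fin n) ℝ)) C →
        ρ ∈ QGauss.gaussianStatesGE n hbar ε₁ ε₂ ∧
        ∀ σ ∈ QGauss.gaussianStates n hbar,
          ENNReal.ofReal (n * Real.logb 2 (Real.exp 1) *
            (if hbar ^ 2 / 4 ≤ ε₁ * ε₂ then
              Real.log (1 + hbar / (2 * √(ε₁ * ε₂))) - hbar / (2 * √(ε₁ * ε₂) + hbar)
            else Real.log 2 - 1 / 2)) ≤ QGauss.errorFn hbar ρ σ) := by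
  have hlog2 : QGauss.gaussGap 1 = Real.log 2 - 1 / 2 := QGauss.gaussGap_one
  -- for `ε₁ ε₂ < ħ² / 4` the momentum variance `ε₂` is replaced by `ħ² / (4 ε₁)`
  have hβ0 : 0 < hbar ^ 2 / (4 * ε₁) := by positivity
  have hεβ : ε₁ * (hbar ^ 2 / (4 * ε₁)) = hbar ^ 2 / 4 := by field_simp
  have hc1 : hbar / (2 * √(ε₁ * (hbar ^ 2 / (4 * ε₁)))) = 1 := by
    rw [hεβ, show hbar ^ 2 / 4 = (hbar / 2) ^ 2 by ring, Real.sqrt_sq (by positivity)]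
    field_simp
  have hβε : ε₁ * ε₂ < hbar ^ 2 / 4 → ε₂ ≤ hbar ^ 2 / (4 * ε₁) := fun h => by
    rw [le_div_iff₀ (by positivity)]
    linarith
  have hgap : QGauss.gaussGap (hbar / (2 * √(ε₁ * ε₂))) =
      Real.log (1 + hbar / (2 * √(ε₁ * ε₂))) - hbar / (2 * √(ε₁ * ε₂) + hbar) :=
    QGauss.gaussGap_div hbar_pos (by positivity)
  refine ⟨fun h => ?_, fun h => ?_, ?_⟩
  · rw [← hgap]
    have hc0 : 0 < hbar / (2 * √(ε₁ * ε₂)) := by positivity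
    have hs1 : √ε₁ ^ 2 = ε₁ := Real.sq_sqrt hε₁.le
    have hs2 : √ε₂ ^ 2 = ε₂ := Real.sq_sqrt hε₂.le
    have hs1' : 0 < √ε₁ := Real.sqrt_pos.2 hε₁
    have hs2' : 0 < √ε₂ := Real.sqrt_pos.2 hε₂
    have hA : hbar / (2 * √(ε₁ * ε₂)) * ε₁ = hbar / 2 * √(ε₁ / ε₂) := by
      rw [Real.sqrt_mul hε₁.le, Real.sqrt_div hε₁.le]
      field_simp
      rw [hs1]
    have hB : hbar / (2 * √(ε₁ * ε₂)) * ε₂ = hbar / 2 * √(ε₂ / ε₁) := by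
      rw [Real.sqrt_mul hε₁.le, Real.sqrt_div hε₂.le]
      field_simp
      rw [hs2]
    have hAB : hbar / 2 * √(ε₁ / ε₂) * (hbar / 2 * √(ε₂ / ε₁)) = hbar ^ 2 / 4 := by
      rw [Real.sqrt_div hε₁.le, Real.sqrt_div hε₂.le]
      field_simp
      norm_num
    obtain ⟨σ, hσ⟩ := QGauss.exists_isGaussianWith (n := n) hbar_pos
      (α := hbar / 2 * √(ε₁ / ε₂)) (β := hbar / 2 * √(ε₂ / ε₁)) (by positivity) (by positivity)
      hAB.ge
    obtain ⟨ρ, hρ⟩ := QGauss.exists_isGaussianWith (n := n) hbar_pos hε₁ hε₂ h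
    have hρmem := hρ.mem_gaussianStatesGE le_rfl le_rfl
    have hσ' := hσ
    rw [← hA, ← hB] at hσ'
    have hupper : QGauss.divergence hbar ε₁ ε₂ σ ≤ ENNReal.ofReal (n * Real.logb 2 (Real.exp 1) *
        QGauss.gaussGap (hbar / (2 * √(ε₁ * ε₂)))) :=
      iSup₂_le fun τ hτ => QGauss.IsGaussianWith.errorFn_le hbar_pos hc0 hε₁ hε₂ hσ' hτ
    have hlower : ENNReal.ofReal (n * Real.logb 2 (Real.exp 1) *
        QGauss.gaussGap (hbar / (2 * √(ε₁ * ε₂)))) ≤ QGauss.incompatibilityDegree n hbar ε₁ ε₂ :=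
      le_iInf₂ fun τ hτ => (hρ.le_errorFn hbar_pos hε₁ hε₂ hτ).1.trans
        (le_iSup₂ (f := fun ρ (_ : ρ ∈ QGauss.gaussianStatesGE n hbar ε₁ ε₂) =>
          QGauss.errorFn hbar ρ τ) ρ hρmem)
    have hinf : QGauss.incompatibilityDegree n hbar ε₁ ε₂ ≤ QGauss.divergence hbar ε₁ ε₂ σ :=
      iInf₂_le σ ⟨_, _, _, _, _, hσ⟩
    have hval := le_antisymm (hinf.trans hupper) hlower
    refine ⟨hval, σ, hσ, ⟨_, _, _, _, _, hσ, ?_⟩, le_antisymm hinf (hupper.trans hlower),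
      fun σ' hσ'mem hdeg => ?_⟩
    · rw [Matrix.det_smul, Matrix.det_smul, Matrix.det_one, mul_one, mul_one, Fintype.card_fin,
        ← mul_pow, hAB, pow_mul]
      congr 1
      ring
    · have hle : QGauss.errorFn hbar ρ σ' ≤ QGauss.divergence hbar ε₁ ε₂ σ' :=
        le_iSup₂ (f := fun ρ (_ : ρ ∈ QGauss.gaussianStatesGE n hbar ε₁ ε₂) =>
          QGauss.errorFn hbar ρ σ') ρ hρmem
      rw [← hdeg, hval] at hle
      exact ((hρ.le_errorFn hbar_pos hε₁ hε₂ hσ'mem).2 hle).state_unique hbar_pos.ne' hσ'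
  · rw [← hlog2]
    have hlow : ∀ (ρ : QGauss.State n) (a b : QGauss.V n) (C : Matrix (Fin n) (Fin n) ℝ),
        QGauss.IsGaussianWith hbar ρ a b (ε₁ • (1 : Matrix (Fin n) (Fin n) ℝ))
          ((hbar ^ 2 / (4 * ε₁)) • (1 : Matrix (Fin n) (Fin n) ℝ)) C →
        ∀ τ ∈ QGauss.gaussianStates n hbar,
          ENNReal.ofReal (n * Real.logb 2 (Real.exp 1) * QGauss.gaussGap 1) ≤
            QGauss.errorFn hbar ρ τ := fun ρ a b C hρ τ hτ => by
      have := (hρ.le_errorFn hbar_pos hε₁ hβ0 hτ).1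
      rwa [hc1] at this
    obtain ⟨σ, hσ⟩ := QGauss.exists_isGaussianWith (n := n) hbar_pos hε₁ hβ0 hεβ.ge
    refine ⟨le_iInf₂ fun τ hτ => (hlow σ _ _ _ hσ τ hτ).trans
      (le_iSup₂ (f := fun ρ (_ : ρ ∈ QGauss.gaussianStatesGE n hbar ε₁ ε₂) =>
        QGauss.errorFn hbar ρ τ) σ (hσ.mem_gaussianStatesGE le_rfl (hβε h))), σ, hσ,
      fun σ' h' => h'.state_unique hbar_pos.ne' hσ, fun ρ a b C hρ => ?_⟩
    have hval : QGauss.errorFn hbar ρ σ =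
        ENNReal.ofReal (n * Real.logb 2 (Real.exp 1) * QGauss.gaussGap 1) :=
      le_antisymm (QGauss.IsGaussianWith.errorFn_le hbar_pos one_pos hε₁ hβ0
        (by simpa only [one_mul] using hσ) (hρ.mem_gaussianStatesGE le_rfl le_rfl))
        (hlow ρ a b C hρ σ ⟨_, _, _, _, _, hσ⟩)
    refine ⟨hρ.mem_gaussianStatesGE le_rfl (hβε h), hval.symm, le_antisymm ?_
      (iInf₂_le σ ⟨_, _, _, _, _, hσ⟩)⟩
    rw [hval]
    exact le_iInf₂ fun τ hτ => hlow ρ a b C hρ τ hτ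
  · split_ifs with h
    · obtain ⟨ρ, hρ⟩ := QGauss.exists_isGaussianWith (n := n) hbar_pos hε₁ hε₂ h
      refine ⟨⟨ρ, _, _, _, hρ⟩, fun ρ a b C hρ =>
        ⟨hρ.mem_gaussianStatesGE le_rfl le_rfl, fun τ hτ => ?_⟩⟩
      rw [← hgap]
      exact (hρ.le_errorFn hbar_pos hε₁ hε₂ hτ).1
    · obtain ⟨ρ, hρ⟩ := QGauss.exists_isGaussianWith (n := n) hbar_pos hε₁ hβ0 hεβ.ge
      refine ⟨⟨ρ, _, _, _, hρ⟩, fun ρ a b C hρ =>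
        ⟨hρ.mem_gaussianStatesGE le_rfl (hβε (not_le.1 h)), fun τ hτ => ?_⟩⟩
      have := (hρ.le_errorFn hbar_pos hε₁ hβ0 hτ).1
      rwa [hc1, hlog2] at this
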